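/- Let $\mathbf\Sigma\in\mathbb R^{m\times n}$ have rank $d\ge1$ with singular values $\sigma_1\ge\dots\ge\sigma_d>0$, and let $f(\mathbf U,\mathbf V)=\frac12\|\mathbf U\mathbf V^\top-\mathbf\Sigma\|_F^2$ for $\mathbf U\in\mathbb R^{m\times d}$, $\mathbf V\in\mathbb R^{n\times d}$. Let the entries of $\mathbf U_0,\mathbf V_0$ be independent Gaussians with mean $0$ and variance $\varepsilon^2$, and let $(\mathbf U_t,\mathbf V_t)_{t\ge0}$ be the gradient flow $$\dot{\mathbf U}=(\mathbf\Sigma-\mathbf U\mathbf V^\top)\mathbf V,\qquad \dot{\mathbf V}=(\mathbf\Sigma-\mathbf U\mathbf V^\top)^\top\mathbf U$$ started at $(\mathbf U_0,\mathbf V_0)$. Write $\ln^+x=\max\{0,\ln x\}$. There are absolute constants $C>0$ and $q\in\mathbb N$ such that for every $p\in(0,1)$ there is $k>0$, depending only on $p$, with the following property. For all $m,n,d,\mathbf\Sigma$ as above, all $\varepsilon$ with $$0<\varepsilon\le \frac{k\,\sigma_d}{\sqrt{d^3\sigma_1}\,(m+n)}\Big(1+\ln\big((m+n)\tfrac{\sigma_1}{\sigma_d}\big)\Big)^{-q}$$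 and all $\delta>0$, there is a deterministic $T\ge0$ with $$T\le C\Big(\frac1{\sigma_d}\ln\frac{d\sigma_d}{\varepsilon^2}+\frac1{\sigma_d}\ln^+\frac{\sigma_d^2}{\delta}\Big),$$ and, whenever $\sigma_d\ge1$ or $\delta\le\sigma_d^2$, also $$T\le C\Big(\frac1{\sigma_d}\ln\frac{d\sigma_d}{\varepsilon}+\frac1{\sigma_d}\ln^+\frac{\sigma_d}{\delta}\Big),$$ such that with probability at least $1-p$ over the initialization, the flow exists for all times and $f(\mathbf U_t,\mathbf V_t)\le\delta$ for all $t\ge T$. -/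

import Mathlib

open MeasureTheory ProbabilityTheory

noncomputable section

namespace MatrixFactorization

/-- The `i`-th largest singular value `σ_i` of a real matrix, with `i = 1` the largest one
(Mathlib's sequence of singular values starts at index `0`). -/
def sigma {m n : ℕ} (S : Matrix (Fin m) (Fin n) ℝ) (i : ℕ) : ℝ :=
  (Matrix.toEuclideanLin S).singularValues (i - 1)

/-- The objective `f(U, V) = ½ ‖U Vᵀ - Σ‖_F²`. -/
def objective {m n d : ℕ} (S : Matrix (Fin m) (Fin n) ℝ)
    (U : Matrix (Fin m) (Fin d) ℝ) (V : Matrix (Fin n) (Fin d) ℝ) : ℝ :=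
  (1 / 2) * ∑ i, ∑ j, ((U * V.transpose - S) i j) ^ 2

/-- `(U, V)` is a gradient flow on `[0, ∞)` started at `(U₀, V₀)`:
`U' = (Σ - U Vᵀ) V` and `V' = (Σ - U Vᵀ)ᵀ U`, with derivatives taken entrywise
(one-sided at time `0`). -/
structure IsGradientFlow {m n d : ℕ} (S : Matrix (Fin m) (Fin n) ℝ)
    (U₀ : Matrix (Fin m) (Fin d) ℝ) (V₀ : Matrix (Fin n) (Fin d) ℝ)
    (U : ℝ → Matrix (Fin m) (Fin d) ℝ) (V : ℝ → Matrix (Fin n) (Fin d) ℝ) : Prop where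
  init_U : U 0 = U₀
  init_V : V 0 = V₀
  deriv_U : ∀ t : ℝ, 0 ≤ t → ∀ i k,
    HasDerivWithinAt (fun s => U s i k)
      (((S - U t * (V t).transpose) * V t) i k) (Set.Ici 0) t
  deriv_V : ∀ t : ℝ, 0 ≤ t → ∀ j k,
    HasDerivWithinAt (fun s => V s j k)
      (((S - U t * (V t).transpose).transpose * U t) j k) (Set.Ici 0) t

/-- Gradient flow started at `(U₀, V₀)` exists for all times, and `f ≤ δ` along it at
all times `t ≥ T`. -/
def ReachesBy {m n d : ℕ} (S : Matrix (Fin m) (Fin n) ℝ) (δ T : ℝ)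
    (U₀ : Matrix (Fin m) (Fin d) ℝ) (V₀ : Matrix (Fin n) (Fin d) ℝ) : Prop :=
  (∃ U V, IsGradientFlow S U₀ V₀ U V) ∧
    ∀ U V, IsGradientFlow S U₀ V₀ U V → ∀ t : ℝ, T ≤ t → objective S (U t) (V t) ≤ δ

/-- The law of the entries of an `m × d` matrix with independent Gaussian entries of mean `0`
and variance `ε²`. -/
def gaussianEntries (m d : ℕ) (ε : ℝ) : Measure (Fin m → Fin d → ℝ) :=
  Measure.pi fun _ => Measure.pi fun _ => gaussianReal 0 (Real.toNNReal (ε ^ 2))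

/-- The law of the initialization `(U₀, V₀)`: all entries of both matrices are independent
Gaussians of mean `0` and variance `ε²`. -/
def initLaw (m n d : ℕ) (ε : ℝ) : Measure ((Fin m → Fin d → ℝ) × (Fin n → Fin d → ℝ)) :=
  (gaussianEntries m d ε).prod (gaussianEntries n d ε)

end MatrixFactorization

end

/-! Work in the singular frames of the target, where it becomes a diagonal matrix `D` with `lam ≤ D
≤ r ^ 2`, `lam = σ_d`, `r ^ 2 = σ_1`. The factors turn into square blocks `U`, `V` and components
`J`, `K` orthogonal to the singular subspaces. Near zero the half-sum `A = (U + V) / 2` grows and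
the half-difference `B = (U - V) / 2` decays; the proof shows that this picture survives the
nonlinearity. Let `N` bound the norm of the initialization and `s` bound the smallest singular value
of `A 0` from below.

Up to a time `T` with `r N T ≤ 1 / 5`, `B` keeps size `O(N)` and the symmetric part `D - A Aᵀ + B
Bᵀ` of the residual stays above `-r N / 10` (`small_difference_of_flow`). The two bounds support
each other, so they are proved together by a first-exit argument (`forall_pos_of_barrier`). Under
them the least eigenvalue `y` of `A Aᵀ` dominates a solution of `y' = lam y - 2 y ^ 2`
(`logistic_le_of_flow`), hence exceeds `lam / 4` after time `log (lam / s ^ 2) / lam`. Then `U` and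
`V` are both well conditioned, a Polyak–Łojasiewicz inequality (`mul_blockLoss_le_blockGradSq`)
holds, and the loss decays at rate `lam / 8`.

Control of `B` is lost after `T`, but by then the loss is at most `lam ^ 2 / 32`. A small residual
together with the conserved quantity `UᵀU + JᵀJ - VᵀV - KᵀK` keeps the factors well conditioned
(`le_transpose_mulVec_of_residual`), so the exponential decay continues forever
(`IsBlockFlow.blockLoss_le`).

The randomness enters only through `N` and `s`. Markov's inequality bounds the norm. The compressed
sum `Φᵀ U₀ + Ψᵀ V₀` is again a Gaussian matrix, with entries of variance `2 ε ^ 2`, whose least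
singular value is rarely far below `ε / √d` (`gaussianEntries_smallest_singular`). The smallness of
`ε` then gives `200 r N ^ 2 ≤ lam s` and `r N T ≤ 1 / 5`. -/

noncomputable section

namespace MatrixFactorization

open Matrix Set Filter Topology

set_option linter.unusedSectionVars false

/-! ### Frobenius inner product, entrywise derivatives and the barrier principle -/

section Calculus

variable {ι κ l : Type*} [Fintype ι] [Fintype κ] [Fintype l]

/-- The Frobenius inner product of two real matrices. -/
def ip (A B : Matrix ι κ ℝ) : ℝ := ∑ i, ∑ j, A i j * B i j

lemma ip_comm (A B : Matrix ι κ ℝ) : ip A B = ip B A := by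
  simp only [ip, mul_comm]

lemma ip_eq_trace (A B : Matrix ι κ ℝ) : ip A B = (A * Bᵀ).trace := by
  simp [ip, Matrix.trace, Matrix.mul_apply]

lemma ip_add_left (A B C : Matrix ι κ ℝ) : ip (A + B) C = ip A C + ip B C := by
  simp [ip_eq_trace, Matrix.add_mul]

lemma ip_sub_left (A B C : Matrix ι κ ℝ) : ip (A - B) C = ip A C - ip B C := by
  simp [ip_eq_trace, Matrix.sub_mul]

lemma ip_neg_left (A C : Matrix ι κ ℝ) : ip (-A) C = -ip A C := by
  simp [ip_eq_trace]

lemma ip_smul_left (c : ℝ) (A C : Matrix ι κ ℝ) : ip (c • A) C = c * ip A C := by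
  simp [ip_eq_trace]

lemma ip_add_right (A B C : Matrix ι κ ℝ) : ip A (B + C) = ip A B + ip A C := by
  simp [ip_comm A, ip_add_left]

lemma ip_sub_right (A B C : Matrix ι κ ℝ) : ip A (B - C) = ip A B - ip A C := by
  simp [ip_comm A, ip_sub_left]

lemma ip_neg_right (A C : Matrix ι κ ℝ) : ip A (-C) = -ip A C := by
  simp [ip_comm A, ip_neg_left]

lemma ip_smul_right (c : ℝ) (A C : Matrix ι κ ℝ) : ip A (c • C) = c * ip A C := by
  simp [ip_comm A, ip_smul_left]

lemma ip_transpose (A B : Matrix ι κ ℝ) : ip Aᵀ Bᵀ = ip A B := by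
  simp only [ip, Matrix.transpose_apply]
  exact Finset.sum_comm

lemma ip_mul_left_right (A : Matrix ι κ ℝ) (B : Matrix κ l ℝ) (C : Matrix ι l ℝ) :
    ip (A * B) C = ip A (C * Bᵀ) := by
  simp [ip_eq_trace, Matrix.mul_assoc]

lemma ip_mul_left_left (A : Matrix ι κ ℝ) (B : Matrix κ l ℝ) (C : Matrix ι l ℝ) :
    ip (A * B) C = ip B (Aᵀ * C) := by
  rw [← ip_transpose, Matrix.transpose_mul, ip_mul_left_right, ← ip_transpose]
  simp

lemma ip_self_nonneg (A : Matrix ι κ ℝ) : 0 ≤ ip A A :=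
  Finset.sum_nonneg fun _ _ => Finset.sum_nonneg fun _ _ => mul_self_nonneg _

lemma sq_ip_le (A B : Matrix ι κ ℝ) : ip A B ^ 2 ≤ ip A A * ip B B := by
  have h := Finset.sum_mul_sq_le_sq_mul_sq (Finset.univ : Finset (ι × κ))
    (fun p => A p.1 p.2) (fun p => B p.1 p.2)
  simpa [ip, Fintype.sum_prod_type, sq] using h

lemma sq_dot_le (x y : ι → ℝ) : (x ⬝ᵥ y) ^ 2 ≤ (x ⬝ᵥ x) * (y ⬝ᵥ y) := by
  have h := Finset.sum_mul_sq_le_sq_mul_sq (Finset.univ : Finset ι) x y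
  simpa [dotProduct, sq] using h

lemma dot_self_nonneg (x : ι → ℝ) : 0 ≤ x ⬝ᵥ x :=
  Finset.sum_nonneg fun _ _ => mul_self_nonneg _

lemma mulVec_dot (A : Matrix ι κ ℝ) (x : κ → ℝ) (y : ι → ℝ) :
    (A *ᵥ x) ⬝ᵥ y = x ⬝ᵥ (Aᵀ *ᵥ y) := by
  rw [Matrix.mulVec_transpose, dotProduct_comm, Matrix.dotProduct_mulVec, dotProduct_comm]

lemma ip_eq_sum_row (A B : Matrix ι κ ℝ) : ip A B = ∑ i, (A i) ⬝ᵥ (B i) := rfl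

lemma mulVec_dot_self_le (A : Matrix ι κ ℝ) (x : κ → ℝ) :
    (A *ᵥ x) ⬝ᵥ (A *ᵥ x) ≤ ip A A * (x ⬝ᵥ x) := by
  rw [ip_eq_sum_row, Finset.sum_mul, dotProduct]
  refine Finset.sum_le_sum fun i _ => ?_
  rw [← sq]
  exact sq_dot_le _ _

lemma mul_row (A : Matrix ι κ ℝ) (B : Matrix κ l ℝ) (i : ι) : (A * B) i = Bᵀ *ᵥ (A i) := by
  ext j
  simp [Matrix.mul_apply, Matrix.mulVec, dotProduct, mul_comm]

/-- A bound for `x ↦ Bᵀ x` gives a bound for right multiplication by `B`. -/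
lemma ip_mul_self_le_of_forall {B : Matrix κ l ℝ} {c : ℝ}
    (h : ∀ x, (Bᵀ *ᵥ x) ⬝ᵥ (Bᵀ *ᵥ x) ≤ c * (x ⬝ᵥ x)) (A : Matrix ι κ ℝ) :
    ip (A * B) (A * B) ≤ c * ip A A := by
  simp only [ip_eq_sum_row, Finset.mul_sum, mul_row]
  exact Finset.sum_le_sum fun i _ => h _

lemma le_ip_mul_self_of_forall {B : Matrix κ l ℝ} {c : ℝ}
    (h : ∀ x, c * (x ⬝ᵥ x) ≤ (Bᵀ *ᵥ x) ⬝ᵥ (Bᵀ *ᵥ x)) (A : Matrix ι κ ℝ) :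
    c * ip A A ≤ ip (A * B) (A * B) := by
  simp only [ip_eq_sum_row, Finset.mul_sum, mul_row]
  exact Finset.sum_le_sum fun i _ => h _

lemma ip_mul_self_le (A : Matrix ι κ ℝ) (B : Matrix κ l ℝ) :
    ip (A * B) (A * B) ≤ ip A A * ip B B := by
  rw [mul_comm, ← ip_transpose B B]
  exact ip_mul_self_le_of_forall (fun x => mulVec_dot_self_le _ x) A

/-- `A'` is the entrywise derivative of `A` at `t` within `[0, ∞)`. -/
def HasEntryDeriv (A : ℝ → Matrix ι κ ℝ) (A' : Matrix ι κ ℝ) (t : ℝ) : Prop :=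
  ∀ i j, HasDerivWithinAt (fun τ => A τ i j) (A' i j) (Ici 0) t

namespace HasEntryDeriv

variable {A B : ℝ → Matrix ι κ ℝ} {A' B' : Matrix ι κ ℝ} {t : ℝ}

lemma add (hA : HasEntryDeriv A A' t) (hB : HasEntryDeriv B B' t) :
    HasEntryDeriv (fun τ => A τ + B τ) (A' + B') t := fun i j => (hA i j).add (hB i j)

lemma sub (hA : HasEntryDeriv A A' t) (hB : HasEntryDeriv B B' t) :
    HasEntryDeriv (fun τ => A τ - B τ) (A' - B') t := fun i j => (hA i j).sub (hB i j)

lemma const_smul (c : ℝ) (hA : HasEntryDeriv A A' t) :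
    HasEntryDeriv (fun τ => c • A τ) (c • A') t := fun i j => (hA i j).const_mul c

lemma const (C : Matrix ι κ ℝ) : HasEntryDeriv (fun _ => C) 0 t :=
  fun i j => hasDerivWithinAt_const t _ (C i j)

lemma transpose (hA : HasEntryDeriv A A' t) : HasEntryDeriv (fun τ => (A τ)ᵀ) A'ᵀ t :=
  fun i j => hA j i

lemma mul {C : ℝ → Matrix κ l ℝ} {C' : Matrix κ l ℝ} (hA : HasEntryDeriv A A' t)
    (hC : HasEntryDeriv C C' t) :
    HasEntryDeriv (fun τ => A τ * C τ) (A' * C t + A t * C') t := by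
  intro i j
  simp only [Matrix.add_apply, Matrix.mul_apply, ← Finset.sum_add_distrib]
  exact HasDerivWithinAt.fun_sum fun k _ => (hA i k).mul (hC k j)

lemma ip (hA : HasEntryDeriv A A' t) (hB : HasEntryDeriv B B' t) :
    HasDerivWithinAt (fun τ => ip (A τ) (B τ))
      (MatrixFactorization.ip A' (B t) + MatrixFactorization.ip (A t) B') (Ici 0) t := by
  simp only [MatrixFactorization.ip, ← Finset.sum_add_distrib]
  exact HasDerivWithinAt.fun_sum fun i _ => HasDerivWithinAt.fun_sum fun j _ =>
    (hA i j).mul (hB i j)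

lemma ip_self (hA : HasEntryDeriv A A' t) :
    HasDerivWithinAt (fun τ => MatrixFactorization.ip (A τ) (A τ))
      (2 * MatrixFactorization.ip (A t) A') (Ici 0) t := by
  convert hA.ip hA using 1
  rw [ip_comm A', two_mul]

lemma mulVec_apply (hA : HasEntryDeriv A A' t) (x : κ → ℝ) (i : ι) :
    HasDerivWithinAt (fun τ => (A τ *ᵥ x) i) ((A' *ᵥ x) i) (Ici 0) t := by
  simp only [mulVec, dotProduct]
  exact HasDerivWithinAt.fun_sum fun j _ => (hA i j).mul_const _

lemma mulVec_dot_self (hA : HasEntryDeriv A A' t) (x : κ → ℝ) :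
    HasDerivWithinAt (fun τ => (A τ *ᵥ x) ⬝ᵥ (A τ *ᵥ x)) (2 * ((A t *ᵥ x) ⬝ᵥ (A' *ᵥ x)))
      (Ici 0) t := by
  have : 2 * ((A t *ᵥ x) ⬝ᵥ (A' *ᵥ x))
      = ∑ i, ((A' *ᵥ x) i * (A t *ᵥ x) i + (A t *ᵥ x) i * (A' *ᵥ x) i) := by
    rw [dotProduct, Finset.mul_sum]
    exact Finset.sum_congr rfl fun i _ => by ring
  rw [this]
  exact HasDerivWithinAt.fun_sum fun i _ => (hA.mulVec_apply x i).mul (hA.mulVec_apply x i)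

end HasEntryDeriv

lemma continuousOn_entry {A A' : ℝ → Matrix ι κ ℝ} (h : ∀ t, 0 ≤ t → HasEntryDeriv A (A' t) t)
    (i : ι) (j : κ) : ContinuousOn (fun τ => A τ i j) (Ici 0) :=
  fun t ht => (h t ht i j).continuousWithinAt

/-- Joint continuity of the squared length of `A(t) x`. -/
lemma continuousOn_mulVec_dot_self {A A' : ℝ → Matrix ι κ ℝ}
    (h : ∀ t, 0 ≤ t → HasEntryDeriv A (A' t) t) :
    ContinuousOn (fun p : ℝ × (κ → ℝ) => (A p.1 *ᵥ p.2) ⬝ᵥ (A p.1 *ᵥ p.2)) (Ici 0 ×ˢ univ) := by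
  have hA : ∀ i j, ContinuousOn (fun p : ℝ × (κ → ℝ) => A p.1 i j) (Ici 0 ×ˢ univ) := fun i j =>
    (continuousOn_entry h i j).comp continuousOn_fst fun p hp => hp.1
  have hx : ∀ j, Continuous (fun p : ℝ × (κ → ℝ) => p.2 j) := fun j => by fun_prop
  simp only [dotProduct, mulVec]
  have hs : ∀ i, ContinuousOn (fun p : ℝ × (κ → ℝ) => ∑ j, A p.1 i j * p.2 j) (Ici 0 ×ˢ univ) :=
    fun i => continuousOn_finsetSum _ fun j _ => (hA i j).mul (hx j).continuousOn
  exact continuousOn_finsetSum _ fun i _ => (hs i).mul (hs i)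

/-- Monotonicity from the sign of a one-sided derivative. -/
lemma le_of_hasDerivWithinAt_nonpos {g g' : ℝ → ℝ} {a b : ℝ} (ha : 0 ≤ a) (hab : a ≤ b)
    (hg : ∀ t, 0 ≤ t → HasDerivWithinAt g (g' t) (Ici 0) t)
    (hneg : ∀ t, a ≤ t → t ≤ b → g' t ≤ 0) : g b ≤ g a := by
  refine antitoneOn_of_deriv_nonpos (convex_Icc a b) ?_ ?_ ?_ (left_mem_Icc.2 hab)
    (right_mem_Icc.2 hab) hab
  · exact fun t ht => ((hg t (ha.trans ht.1)).continuousWithinAt).mono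
      fun x hx => ha.trans hx.1
  all_goals
    rw [interior_Icc]
    intro t ht
    have hd : HasDerivAt g (g' t) t :=
      (hg t (ha.trans ht.1.le)).hasDerivAt (Ici_mem_nhds (ha.trans_lt ht.1))
  · exact hd.differentiableAt.differentiableWithinAt
  · rw [hd.deriv]
    exact hneg t ht.1.le ht.2.le

/-- Exponential decay from a linear differential inequality. -/
lemma le_exp_mul_of_hasDerivWithinAt {g g' : ℝ → ℝ} {a b c : ℝ} (ha : 0 ≤ a) (hab : a ≤ b)
    (hg : ∀ t, 0 ≤ t → HasDerivWithinAt g (g' t) (Ici 0) t)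
    (hneg : ∀ t, a ≤ t → t ≤ b → g' t ≤ -c * g t) : g b ≤ g a * Real.exp (-c * (b - a)) := by
  have hexp : ∀ t, HasDerivWithinAt (fun τ => Real.exp (c * (τ - a)))
      (Real.exp (c * (t - a)) * c) (Ici 0) t := fun t => by
    have h1 : HasDerivAt (fun τ : ℝ => c * (τ - a)) c t := by
      simpa using ((hasDerivAt_id t).sub_const a).const_mul c
    exact h1.exp.hasDerivWithinAt
  have h := le_of_hasDerivWithinAt_nonpos ha hab
    (g := fun t => g t * Real.exp (c * (t - a)))
    (g' := fun t => g' t * Real.exp (c * (t - a)) + g t * (Real.exp (c * (t - a)) * c))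
    (fun t ht => (hg t ht).mul (hexp t)) (fun t h1 h2 => by
      have := hneg t h1 h2
      have he := Real.exp_pos (c * (t - a))
      nlinarith)
  simp only [sub_self, mul_zero, Real.exp_zero, mul_one] at h
  have he := Real.exp_pos (-c * (b - a))
  calc g b = (g b * Real.exp (c * (b - a))) * Real.exp (-c * (b - a)) := by
        rw [mul_assoc, ← Real.exp_add]
        simp
    _ ≤ _ := by gcongr

/-- A finite family of continuous functions of time and of a compact parameter which are positive
at time `0` stays positive, provided that at any time at which the family is nonnegative, each of
its zeros has a positive time derivative. -/
lemma forall_pos_of_barrier {X θ : Type*} [TopologicalSpace X] [Finite θ] {K : Set X}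
    (hK : IsCompact K) {φ : θ → ℝ → X → ℝ} {T : ℝ}
    (hcont : ∀ i, ContinuousOn (fun p : ℝ × X => φ i p.1 p.2) (Icc 0 T ×ˢ K))
    (h0 : ∀ i, ∀ x ∈ K, 0 < φ i 0 x)
    (hstep : ∀ t, 0 ≤ t → t ≤ T → (∀ i, ∀ x ∈ K, 0 ≤ φ i t x) → ∀ i, ∀ x ∈ K, φ i t x = 0 →
      ∃ D, 0 < D ∧ HasDerivWithinAt (fun τ => φ i τ x) D (Ici 0) t) :
    ∀ t, 0 ≤ t → t ≤ T → ∀ i, ∀ x ∈ K, 0 < φ i t x := by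
  by_contra! hbad
  obtain ⟨t₁, ht₁, ht₁T, i₁, x₁, hx₁, hφ₁⟩ := hbad
  -- The set of times at which positivity fails is the projection of a compact set, so it has a
  -- first element `s`. There some function of the family vanishes after being positive, so its left
  -- difference quotients are nonpositive, against `hstep`.
  set bad : Set ℝ := ⋃ i, Prod.fst '' {p ∈ Icc 0 T ×ˢ K | φ i p.1 p.2 ≤ 0} with hbad
  have hcomp : IsCompact bad := by
    refine isCompact_iUnion fun i => IsCompact.image ?_ continuous_fst
    have hc : IsCompact (Icc (0 : ℝ) T ×ˢ K) := isCompact_Icc.prod hK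
    have hcs : CompactSpace (Icc (0 : ℝ) T ×ˢ K : Set (ℝ × X)) := isCompact_iff_compactSpace.1 hc
    have hcl : IsClosed {p : (Icc (0 : ℝ) T ×ˢ K : Set (ℝ × X)) | φ i p.1.1 p.1.2 ≤ 0} :=
      isClosed_le (continuousOn_iff_continuous_domRestrict.1 (hcont i)) continuous_const
    have := hcl.isCompact.image continuous_subtype_val
    convert this using 1
    ext p
    simp only [mem_ofPred_eq, mem_image, Subtype.exists, exists_and_left, exists_prop]
    constructor
    · exact fun h => ⟨p, h.2, h.1, rfl⟩
    · rintro ⟨q, h2, h1, rfl⟩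
      exact ⟨h1, h2⟩
  have hmem : ∀ t, t ∈ bad ↔ ∃ i, ∃ x ∈ K, (0 ≤ t ∧ t ≤ T) ∧ φ i t x ≤ 0 := by
    intro t
    simp only [hbad, mem_iUnion, mem_image, mem_ofPred_eq, Prod.exists, mem_prod, mem_Icc]
    constructor
    · rintro ⟨i, a, b, ⟨⟨h1, h2⟩, h3⟩, rfl⟩
      exact ⟨i, b, h2, h1, h3⟩
    · rintro ⟨i, b, h2, h1, h3⟩
      exact ⟨i, t, b, ⟨⟨h1, h2⟩, h3⟩, rfl⟩
  obtain ⟨s, hs, hmin⟩ := hcomp.exists_isLeast ⟨t₁, (hmem _).2 ⟨i₁, x₁, hx₁, ⟨ht₁, ht₁T⟩, hφ₁⟩⟩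
  obtain ⟨i, x, hx, ⟨hs0, hsT⟩, hφ⟩ := (hmem _).1 hs
  have hspos : 0 < s := lt_of_le_of_ne hs0 fun h => by
    subst h
    exact absurd (h0 i x hx) (not_lt.2 hφ)
  have hbefore : ∀ t, 0 ≤ t → t < s → ∀ j, ∀ y ∈ K, 0 < φ j t y := by
    intro t ht hts j y hy
    by_contra! h
    exact absurd (hmin ((hmem t).2 ⟨j, y, hy, ⟨ht, hts.le.trans hsT⟩, h⟩)) (not_le.2 hts)
  have hnhds : (Ico 0 s) ∈ 𝓝[<] s := by
    rw [mem_nhdsWithin]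
    exact ⟨Ioi 0, isOpen_Ioi, hspos, fun y hy => ⟨le_of_lt hy.1, hy.2⟩⟩
  have hnonneg : ∀ j, ∀ y ∈ K, 0 ≤ φ j s y := by
    intro j y hy
    have hc : ContinuousWithinAt (fun τ => φ j τ y) (Ico 0 s) s := by
      have h1 : ContinuousWithinAt (fun p : ℝ × X => φ j p.1 p.2) (Icc 0 T ×ˢ K) (s, y) :=
        hcont j (s, y) ⟨⟨hs0, hsT⟩, hy⟩
      exact ContinuousWithinAt.comp (f := fun τ : ℝ => (τ, y)) h1
        (by fun_prop) fun τ hτ => ⟨⟨hτ.1, hτ.2.le.trans hsT⟩, hy⟩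
    have hlim : Tendsto (fun τ => φ j τ y) (𝓝[<] s) (𝓝 (φ j s y)) :=
      hc.mono_left (nhdsWithin_le_iff.2 hnhds)
    refine ge_of_tendsto hlim ?_
    filter_upwards [hnhds] with τ hτ
    exact (hbefore τ hτ.1 hτ.2 j y hy).le
  obtain ⟨D, hD, hder⟩ := hstep s hs0 hsT hnonneg i x hx (le_antisymm hφ (hnonneg i x hx))
  have hd : HasDerivAt (fun τ => φ i τ x) D s := hder.hasDerivAt (Ici_mem_nhds hspos)
  have hslope : Tendsto (slope (fun τ => φ i τ x) s) (𝓝[<] s) (𝓝 D) :=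
    (hasDerivAt_iff_tendsto_slope.1 hd).mono_left
      (nhdsWithin_mono s (fun y (hy : y < s) => ne_of_lt hy))
  have hle : D ≤ 0 := by
    refine le_of_tendsto hslope ?_
    filter_upwards [hnhds] with τ hτ
    have h1 := hbefore τ hτ.1 hτ.2 i x hx
    rw [slope_def_field]
    exact div_nonpos_of_nonneg_of_nonpos (by linarith) (by linarith [hτ.2])
  linarith

lemma isCompact_dot_self_eq_one : IsCompact {x : ι → ℝ | x ⬝ᵥ x = 1} := by
  refine Metric.isCompact_of_isClosed_isBounded ?_ ?_
  · exact isClosed_eq (by unfold dotProduct; fun_prop) continuous_const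
  · refine (Metric.isBounded_closedBall (x := (0 : ι → ℝ)) (r := 1)).subset fun x hx => ?_
    rw [mem_closedBall_zero_iff, pi_norm_le_iff_of_nonneg zero_le_one]
    intro i
    have h1 : x i * x i ≤ x ⬝ᵥ x :=
      Finset.single_le_sum (f := fun i => x i * x i) (fun j _ => mul_self_nonneg (x j))
        (Finset.mem_univ i)
    rw [Set.mem_ofPred_eq] at hx
    rw [Real.norm_eq_abs]
    rw [← abs_one]
    exact sq_le_sq.1 (by nlinarith)

/-- A homogeneous quadratic inequality may be checked on unit vectors. -/
lemma forall_of_forall_unit {q : (ι → ℝ) → ℝ} (hq : ∀ (c : ℝ) x, q (c • x) = c ^ 2 * q x)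
    (h : ∀ x, x ⬝ᵥ x = 1 → 0 ≤ q x) (x : ι → ℝ) : 0 ≤ q x := by
  rcases (dot_self_nonneg x).eq_or_lt with h0 | h0
  · have : x = 0 := dotProduct_self_eq_zero.1 h0.symm
    have h2 := hq 0 0
    subst this
    simp at h2
    exact h2.ge
  · set r := Real.sqrt (x ⬝ᵥ x) with hr
    have hrp : 0 < r := Real.sqrt_pos.2 h0
    have hr2 : r ^ 2 = x ⬝ᵥ x := Real.sq_sqrt h0.le
    have h1 := h (r⁻¹ • x) (by
      rw [smul_dotProduct, dotProduct_smul, smul_eq_mul, smul_eq_mul, ← hr2]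
      field_simp)
    have h2 := hq r (r⁻¹ • x)
    rw [smul_smul, mul_inv_cancel₀ hrp.ne', one_smul] at h2
    rw [h2]
    positivity

end Calculus

/-! ### The flow in the variables `A` and `B` -/

section Symmetrized

variable {ι μ ν : Type*} [Fintype ι] [Fintype μ] [Fintype ν]

/-- A zero of a positive semidefinite form lies in the kernel. Applied to a matrix shifted by its
minimal value on the sphere, this yields the eigenvector equation at a minimizer. -/
lemma mulVec_eq_zero_of_quadratic {X : Matrix ι ι ℝ} (hX : Xᵀ = X)
    (h : ∀ w, 0 ≤ w ⬝ᵥ (X *ᵥ w)) {v : ι → ℝ} (hv : v ⬝ᵥ (X *ᵥ v) = 0) : X *ᵥ v = 0 := by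
  have hp : X.PosSemidef := by
    refine Matrix.PosSemidef.of_dotProduct_mulVec_nonneg ?_ ?_
    · rw [Matrix.IsHermitian, Matrix.conjTranspose_eq_transpose_of_trivial, hX]
    · intro x
      simpa using h x
  exact (hp.dotProduct_mulVec_zero_iff v).1 (by simpa using hv)

/-- Cauchy–Schwarz for `|A y|² = y · Aᵀ (A y)`, followed by division by `|A y|²`. -/
lemma mulVec_le_of_transpose_mulVec_le {A : Matrix ι μ ℝ} {c : ℝ} (hc : 0 ≤ c)
    (h : ∀ x, (Aᵀ *ᵥ x) ⬝ᵥ (Aᵀ *ᵥ x) ≤ c * (x ⬝ᵥ x)) (y : μ → ℝ) :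
    (A *ᵥ y) ⬝ᵥ (A *ᵥ y) ≤ c * (y ⬝ᵥ y) := by
  have h1 := sq_dot_le y (Aᵀ *ᵥ (A *ᵥ y))
  rw [← mulVec_dot] at h1
  have h2 := h (A *ᵥ y)
  have h3 := dot_self_nonneg (A *ᵥ y)
  have h4 := dot_self_nonneg y
  rcases h3.eq_or_lt with h0 | h0
  · rw [← h0]
    positivity
  · have h5 : ((A *ᵥ y) ⬝ᵥ (A *ᵥ y)) * ((A *ᵥ y) ⬝ᵥ (A *ᵥ y))
        ≤ (c * (y ⬝ᵥ y)) * ((A *ᵥ y) ⬝ᵥ (A *ᵥ y)) := by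
      nlinarith [mul_le_mul_of_nonneg_left h2 h4]
    exact le_of_mul_le_mul_right h5 h0

/-- Squareness matters: the bound makes `Aᵀ` injective, hence surjective, so `y = Aᵀ x` for some
`x`, and Cauchy–Schwarz for `x · A Aᵀ x` concludes. -/
lemma le_mulVec_of_le_transpose_mulVec [DecidableEq ι] {A : Matrix ι ι ℝ} {c : ℝ} (hc : 0 < c)
    (h : ∀ x, c * (x ⬝ᵥ x) ≤ (Aᵀ *ᵥ x) ⬝ᵥ (Aᵀ *ᵥ x)) (y : ι → ℝ) :
    c * (y ⬝ᵥ y) ≤ (A *ᵥ y) ⬝ᵥ (A *ᵥ y) := by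
  have hinj : Function.Injective Aᵀ.mulVec := by
    intro x z hxz
    have h1 := h (x - z)
    rw [Matrix.mulVec_sub, show Aᵀ *ᵥ x = Aᵀ *ᵥ z from hxz, sub_self, dotProduct_zero] at h1
    have h2 := dot_self_nonneg (x - z)
    have h3 : (x - z) ⬝ᵥ (x - z) = 0 := by nlinarith
    exact sub_eq_zero.1 (dotProduct_self_eq_zero.1 h3)
  have hunit := Matrix.mulVec_injective_iff_isUnit.1 hinj
  obtain ⟨x, rfl⟩ := Matrix.mulVec_surjective_iff_isUnit.2 hunit y
  have h1 := h x
  have h2 := sq_dot_le x (A *ᵥ (Aᵀ *ᵥ x))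
  rw [dotProduct_comm, mulVec_dot] at h2
  have h3 := dot_self_nonneg x
  have h4 := dot_self_nonneg (A *ᵥ (Aᵀ *ᵥ x))
  rcases (dot_self_nonneg (Aᵀ *ᵥ x)).eq_or_lt with h0 | h0
  · rw [← h0]
    simpa using h4
  · have h5 : (c * ((Aᵀ *ᵥ x) ⬝ᵥ (Aᵀ *ᵥ x))) * ((Aᵀ *ᵥ x) ⬝ᵥ (Aᵀ *ᵥ x))
        ≤ ((A *ᵥ (Aᵀ *ᵥ x)) ⬝ᵥ (A *ᵥ (Aᵀ *ᵥ x))) * ((Aᵀ *ᵥ x) ⬝ᵥ (Aᵀ *ᵥ x)) := by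
      nlinarith [mul_le_mul_of_nonneg_right h1 h4]
    exact le_of_mul_le_mul_right h5 h0

/-- The symmetric part of the residual `D - (A + B)(A - B)ᵀ`. -/
def symPart (D A B : Matrix ι ι ℝ) : Matrix ι ι ℝ := D - A * Aᵀ + B * Bᵀ

/-- The skew-symmetric part of the residual `D - (A + B)(A - B)ᵀ`. -/
def skewPart (A B : Matrix ι ι ℝ) : Matrix ι ι ℝ := A * Bᵀ - B * Aᵀ

/-- The velocity of `A = (U + V) / 2` along the flow. -/
def velA (D A B : Matrix ι ι ℝ) (J : Matrix μ ι ℝ) (K : Matrix ν ι ℝ) : Matrix ι ι ℝ :=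
  symPart D A B * A - skewPart A B * B
    - (1 / 2 : ℝ) • (A * (Kᵀ * K + Jᵀ * J) + B * (Kᵀ * K - Jᵀ * J))

/-- The velocity of `B = (U - V) / 2` along the flow. -/
def velB (D A B : Matrix ι ι ℝ) (J : Matrix μ ι ℝ) (K : Matrix ν ι ℝ) : Matrix ι ι ℝ :=
  skewPart A B * A - symPart D A B * B
    - (1 / 2 : ℝ) • (A * (Kᵀ * K - Jᵀ * J) + B * (Kᵀ * K + Jᵀ * J))

lemma transpose_symPart {D : Matrix ι ι ℝ} (hD : Dᵀ = D) (A B : Matrix ι ι ℝ) :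
    (symPart D A B)ᵀ = symPart D A B := by
  simp [symPart, hD]

lemma transpose_skewPart (A B : Matrix ι ι ℝ) : (skewPart A B)ᵀ = -skewPart A B := by
  simp [skewPart]

lemma dot_symPart_mulVec (D A B : Matrix ι ι ℝ) (v : ι → ℝ) :
    v ⬝ᵥ (symPart D A B *ᵥ v)
      = v ⬝ᵥ (D *ᵥ v) - (Aᵀ *ᵥ v) ⬝ᵥ (Aᵀ *ᵥ v) + (Bᵀ *ᵥ v) ⬝ᵥ (Bᵀ *ᵥ v) := by
  rw [mulVec_dot Aᵀ, mulVec_dot Bᵀ]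
  simp [symPart, Matrix.add_mulVec, Matrix.sub_mulVec, dotProduct_add, dotProduct_sub]

/-- Half the time derivative of `|Aᵀ v|²`, arranged so that every term is a product of vectors whose
lengths are controlled; `dot_velB` does the same for `B`, and the mixed terms of the two are equal
or opposite in a way that lets them cancel. -/
lemma dot_velA {D : Matrix ι ι ℝ} (hD : Dᵀ = D) (A B : Matrix ι ι ℝ) (J : Matrix μ ι ℝ)
    (K : Matrix ν ι ℝ) (v : ι → ℝ) {a b : ι → ℝ} (ha : Aᵀ *ᵥ v = a) (hb : Bᵀ *ᵥ v = b) :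
    (Aᵀ *ᵥ v) ⬝ᵥ ((velA D A B J K)ᵀ *ᵥ v)
      = (A *ᵥ a) ⬝ᵥ (symPart D A B *ᵥ v) + (B *ᵥ a) ⬝ᵥ (A *ᵥ b) - (B *ᵥ a) ⬝ᵥ (B *ᵥ a)
        - (1 / 2) * ((K *ᵥ a) ⬝ᵥ (K *ᵥ a) + (J *ᵥ a) ⬝ᵥ (J *ᵥ a)
          + (K *ᵥ a) ⬝ᵥ (K *ᵥ b) - (J *ᵥ a) ⬝ᵥ (J *ᵥ b)) := by
  have h : (velA D A B J K)ᵀ *ᵥ v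
      = Aᵀ *ᵥ (symPart D A B *ᵥ v) + Bᵀ *ᵥ (A *ᵥ b) - Bᵀ *ᵥ (B *ᵥ a)
        - (1 / 2 : ℝ) • (Kᵀ *ᵥ (K *ᵥ a) + Jᵀ *ᵥ (J *ᵥ a) + Kᵀ *ᵥ (K *ᵥ b) - Jᵀ *ᵥ (J *ᵥ b)) := by
    rw [velA, transpose_sub, transpose_sub, transpose_mul, transpose_mul, transpose_symPart hD,
      transpose_skewPart, ← ha, ← hb]
    simp only [skewPart, transpose_smul, transpose_add, transpose_sub, transpose_mul,
      transpose_transpose, sub_mulVec, add_mulVec, smul_mulVec, neg_mulVec, mulVec_mulVec,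
      Matrix.mul_neg, Matrix.mul_sub, Matrix.add_mul, Matrix.mul_assoc]
    module
  rw [h, ha]
  simp only [mulVec_dot, dotProduct_add, dotProduct_sub, dotProduct_smul, smul_eq_mul]

lemma dot_velB {D : Matrix ι ι ℝ} (hD : Dᵀ = D) (A B : Matrix ι ι ℝ) (J : Matrix μ ι ℝ)
    (K : Matrix ν ι ℝ) (v : ι → ℝ) {a b : ι → ℝ} (ha : Aᵀ *ᵥ v = a) (hb : Bᵀ *ᵥ v = b) :
    (Bᵀ *ᵥ v) ⬝ᵥ ((velB D A B J K)ᵀ *ᵥ v)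
      = -((A *ᵥ b) ⬝ᵥ (A *ᵥ b)) + (A *ᵥ b) ⬝ᵥ (B *ᵥ a) - (B *ᵥ b) ⬝ᵥ (symPart D A B *ᵥ v)
        - (1 / 2) * ((K *ᵥ b) ⬝ᵥ (K *ᵥ a) - (J *ᵥ b) ⬝ᵥ (J *ᵥ a)
          + (K *ᵥ b) ⬝ᵥ (K *ᵥ b) + (J *ᵥ b) ⬝ᵥ (J *ᵥ b)) := by
  have h : (velB D A B J K)ᵀ *ᵥ v
      = -(Aᵀ *ᵥ (A *ᵥ b)) + Aᵀ *ᵥ (B *ᵥ a) - Bᵀ *ᵥ (symPart D A B *ᵥ v)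
        - (1 / 2 : ℝ) • (Kᵀ *ᵥ (K *ᵥ a) - Jᵀ *ᵥ (J *ᵥ a) + Kᵀ *ᵥ (K *ᵥ b) + Jᵀ *ᵥ (J *ᵥ b)) := by
    rw [velB, transpose_sub, transpose_sub, transpose_mul, transpose_mul, transpose_symPart hD,
      transpose_skewPart, ← ha, ← hb]
    simp only [skewPart, transpose_smul, transpose_add, transpose_sub, transpose_mul,
      transpose_transpose, sub_mulVec, add_mulVec, smul_mulVec, neg_mulVec, mulVec_mulVec,
      Matrix.mul_neg, Matrix.mul_sub, Matrix.add_mul, Matrix.mul_assoc]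
    module
  rw [h, hb]
  simp only [mulVec_dot, dotProduct_add, dotProduct_sub, dotProduct_smul, smul_eq_mul,
    dotProduct_neg]

/-- With `M = B Aᵀ` the expression is `⟨M, Mᵀ⟩ - ⟨M, M⟩`, which Cauchy–Schwarz makes nonpositive.
Thus the skew part of the residual, although driven by the large factor `A`, never makes `B` grow.
-/
lemma ip_skewPart_mul_nonpos (A B : Matrix ι ι ℝ) : ip B (skewPart A B * A) ≤ 0 := by
  have h1 : ip B (skewPart A B * A) = ip (B * Aᵀ) (B * Aᵀ)ᵀ - ip (B * Aᵀ) (B * Aᵀ) := by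
    rw [ip_mul_left_right, ip_mul_left_right, skewPart, ← ip_sub_right]
    simp [Matrix.sub_mul, Matrix.mul_assoc]
  have h2 := sq_ip_le (B * Aᵀ) (B * Aᵀ)ᵀ
  rw [ip_transpose] at h2
  have h3 := ip_self_nonneg (B * Aᵀ)
  rw [h1]
  nlinarith [abs_le_of_sq_le_sq (by nlinarith : ip (B * Aᵀ) (B * Aᵀ)ᵀ ^ 2
    ≤ ip (B * Aᵀ) (B * Aᵀ) ^ 2) h3]

lemma le_ip_mul_of_forall {P : Matrix ι ι ℝ} {c : ℝ} (h : ∀ v, c * (v ⬝ᵥ v) ≤ v ⬝ᵥ (P *ᵥ v))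
    (B : Matrix ι μ ℝ) : c * ip B B ≤ ip B (P * B) := by
  rw [← ip_transpose B B, ← ip_transpose B (P * B), transpose_mul]
  simp only [ip_eq_sum_row, mul_row, transpose_transpose, Finset.mul_sum]
  exact Finset.sum_le_sum fun i _ => h _

/-- A bound for the mixed term `⟨B, A Kᵀ K⟩`. -/
lemma abs_ip_mul_gram_le {A B : Matrix ι ι ℝ} (K : Matrix ν ι ℝ) {r β : ℝ} (hr : 0 ≤ r)
    (hβ : 0 ≤ β) (hA : ∀ x, (A *ᵥ x) ⬝ᵥ (A *ᵥ x) ≤ (2 * r) ^ 2 * (x ⬝ᵥ x))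
    (hB : ip B B ≤ β ^ 2) : |ip B (A * (Kᵀ * K))| ≤ 2 * r * β * ip K K := by
  have hK := ip_self_nonneg K
  have h1 : ip B (A * (Kᵀ * K)) = ip (B * Kᵀ) (A * Kᵀ) := by
    rw [ip_mul_left_right, transpose_transpose, Matrix.mul_assoc]
  have h2 := sq_ip_le (B * Kᵀ) (A * Kᵀ)
  have h3 := ip_mul_self_le B Kᵀ
  rw [ip_transpose] at h3
  have h4 : ip (A * Kᵀ) (A * Kᵀ) ≤ (2 * r) ^ 2 * ip K K := by
    rw [← ip_transpose, transpose_mul, transpose_transpose]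
    exact ip_mul_self_le_of_forall (by simpa using hA) K
  have h5 := ip_self_nonneg (B * Kᵀ)
  have h6 : ip (B * Kᵀ) (B * Kᵀ) ≤ β ^ 2 * ip K K := h3.trans (by gcongr)
  rw [h1]
  refine abs_le_of_sq_le_sq (h2.trans ?_) (by positivity)
  calc _ ≤ (β ^ 2 * ip K K) * ((2 * r) ^ 2 * ip K K) :=
        mul_le_mul h6 h4 (ip_self_nonneg _) (by positivity)
    _ = _ := by ring

end Symmetrized

/-! ### Smallness of `B` and near nonnegativity of the symmetric residual -/

section Growth

variable {ι μ ν : Type*} [Fintype ι] [DecidableEq ι] [Fintype μ] [Fintype ν]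

lemma transpose_mulVec_dot_self_le (B : Matrix ι μ ℝ) (v : ι → ℝ) :
    (Bᵀ *ᵥ v) ⬝ᵥ (Bᵀ *ᵥ v) ≤ ip B B * (v ⬝ᵥ v) := by
  rw [← ip_transpose B B]
  exact mulVec_dot_self_le _ _

lemma abs_dot_le {x y : ι → ℝ} {c d : ℝ} (hc : 0 ≤ c) (hd : 0 ≤ d) (hx : x ⬝ᵥ x ≤ c ^ 2)
    (hy : y ⬝ᵥ y ≤ d ^ 2) : |x ⬝ᵥ y| ≤ c * d := by
  refine abs_le_of_sq_le_sq ((sq_dot_le x y).trans ?_) (by positivity)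
  rw [mul_pow]
  exact mul_le_mul hx hy (dot_self_nonneg y) (by positivity)

/-- If the symmetric part of the residual is nearly nonnegative and `B` is small, then `A` is
bounded. -/
lemma transpose_mulVec_le_of_symPart {D A B : Matrix ι ι ℝ} {r N : ℝ} (hr : 0 < r) (hN : 0 < N)
    (hNr : 200 * N ≤ r) (hhi : ∀ v, v ⬝ᵥ (D *ᵥ v) ≤ r ^ 2 * (v ⬝ᵥ v))
    (hB : ip B B ≤ (2 * N) ^ 2)
    (hP : ∀ v, -(r * N / 10) * (v ⬝ᵥ v) ≤ v ⬝ᵥ (symPart D A B *ᵥ v)) (v : ι → ℝ) :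
    (Aᵀ *ᵥ v) ⬝ᵥ (Aᵀ *ᵥ v) ≤ (2 * r) ^ 2 * (v ⬝ᵥ v) := by
  have h1 := hP v
  rw [dot_symPart_mulVec] at h1
  have h2 := hhi v
  have h3 := transpose_mulVec_dot_self_le B v
  have h0 := dot_self_nonneg v
  have h4 : ip B B * (v ⬝ᵥ v) ≤ (2 * N) ^ 2 * (v ⬝ᵥ v) := by gcongr
  have h5 : (r * N / 10 + r ^ 2 + (2 * N) ^ 2) * (v ⬝ᵥ v) ≤ (2 * r) ^ 2 * (v ⬝ᵥ v) := by
    refine mul_le_mul_of_nonneg_right ?_ h0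
    nlinarith
  nlinarith

/-- The growth rate of the Frobenius norm of `B`. -/
lemma two_mul_ip_velB_le {D A B : Matrix ι ι ℝ} {J : Matrix μ ι ℝ} {K : Matrix ν ι ℝ} {r N : ℝ}
    (hr : 0 < r) (hN : 0 < N)
    (hAv : ∀ x, (A *ᵥ x) ⬝ᵥ (A *ᵥ x) ≤ (2 * r) ^ 2 * (x ⬝ᵥ x))
    (hP : ∀ v, -(r * N / 10) * (v ⬝ᵥ v) ≤ v ⬝ᵥ (symPart D A B *ᵥ v))
    (hB2 : ip B B ≤ (2 * N) ^ 2) (hJK : ip J J + ip K K ≤ N ^ 2) :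
    2 * ip B (velB D A B J K) ≤ 5 * (r * N) * N ^ 2 := by
  have e1 : ip B (velB D A B J K)
      = ip B (skewPart A B * A) - ip B (symPart D A B * B)
        - 1 / 2 * (ip B (A * (Kᵀ * K)) - ip B (A * (Jᵀ * J))
          + (ip (B * Kᵀ) (B * Kᵀ) + ip (B * Jᵀ) (B * Jᵀ))) := by
    simp only [velB, ip_sub_right, ip_add_right, ip_smul_right, Matrix.mul_add,
      Matrix.mul_sub, ip_mul_left_right, transpose_transpose, Matrix.mul_assoc]
  have e2 := ip_skewPart_mul_nonpos A B
  have e3 := le_ip_mul_of_forall hP B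
  have e4 := abs_le.1 (abs_ip_mul_gram_le K hr.le (by positivity) hAv hB2)
  have e5 := abs_le.1 (abs_ip_mul_gram_le J hr.le (by positivity) hAv hB2)
  have e6 := ip_self_nonneg (B * Kᵀ)
  have e7 := ip_self_nonneg (B * Jᵀ)
  have e8 : 2 * r * (2 * N) * ip K K + 2 * r * (2 * N) * ip J J
      ≤ 4 * r * N * N ^ 2 := by
    have := mul_le_mul_of_nonneg_left hJK (by positivity : 0 ≤ 4 * r * N)
    linarith
  have e9 : r * N / 10 * ip B B ≤ r * N / 10 * (2 * N) ^ 2 := by gcongr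
  rw [e1]
  nlinarith

/-- At a minimizer of the symmetric part of the residual on the unit sphere, at which its value is
`-r N / 10`, the time derivative of this value is positive. -/
lemma deriv_symPart_pos {D A B : Matrix ι ι ℝ} (hD : Dᵀ = D) {J : Matrix μ ι ℝ}
    {K : Matrix ν ι ℝ} {lam r N : ℝ} (hr : 0 < r) (hN : 0 < N) (hNr : 200 * N ≤ r)
    (hrN : 200 * (r * N) ≤ lam) (hlo : ∀ v, lam * (v ⬝ᵥ v) ≤ v ⬝ᵥ (D *ᵥ v))
    (hAv : ∀ x, (A *ᵥ x) ⬝ᵥ (A *ᵥ x) ≤ (2 * r) ^ 2 * (x ⬝ᵥ x))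
    (hP : ∀ v, -(r * N / 10) * (v ⬝ᵥ v) ≤ v ⬝ᵥ (symPart D A B *ᵥ v))
    (hB2 : ip B B ≤ (2 * N) ^ 2) (hJK : ip J J + ip K K ≤ N ^ 2) {v : ι → ℝ} (hv : v ⬝ᵥ v = 1)
    (hz : v ⬝ᵥ (D *ᵥ v) - (Aᵀ *ᵥ v) ⬝ᵥ (Aᵀ *ᵥ v) + (Bᵀ *ᵥ v) ⬝ᵥ (Bᵀ *ᵥ v)
      + r * N / 10 * (v ⬝ᵥ v) = 0) :
    0 < -(2 * ((Aᵀ *ᵥ v) ⬝ᵥ ((velA D A B J K)ᵀ *ᵥ v)))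
        + 2 * ((Bᵀ *ᵥ v) ⬝ᵥ ((velB D A B J K)ᵀ *ᵥ v)) := by
  have hrN0 : 0 < r * N := by positivity
  set a := Aᵀ *ᵥ v with ha
  set b := Bᵀ *ᵥ v with hb
  -- The shifted form is nonnegative and vanishes at `v`, so `v` is an eigenvector of the symmetric
  -- part with eigenvalue `-r N / 10`.
  have hX : (symPart D A B + (r * N / 10) • (1 : Matrix ι ι ℝ)) *ᵥ v = 0 := by
    refine mulVec_eq_zero_of_quadratic ?_ ?_ ?_
    · simp [transpose_symPart hD]
    · intro w
      have := hP w
      simp only [add_mulVec, smul_mulVec, one_mulVec, dotProduct_add, dotProduct_smul,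
        smul_eq_mul]
      linarith
    · simp only [add_mulVec, smul_mulVec, one_mulVec, dotProduct_add, dotProduct_smul,
        smul_eq_mul, dot_symPart_mulVec]
      linarith
  have hPv : symPart D A B *ᵥ v = -(r * N / 10) • v := by
    rw [add_mulVec, smul_mulVec, one_mulVec] at hX
    rw [eq_neg_of_add_eq_zero_left hX, neg_smul]
  rw [dot_velA hD _ _ _ _ v ha.symm hb.symm, dot_velB hD _ _ _ _ v ha.symm hb.symm, hPv]
  simp only [dotProduct_smul, smul_eq_mul]
  rw [mulVec_dot A a v, ← ha, mulVec_dot B b v, ← hb]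
  rw [hv] at hz
  have f1 := dot_self_nonneg (B *ᵥ a)
  have f2 := hAv b
  have f3 : b ⬝ᵥ b ≤ (2 * N) ^ 2 := by
    have := transpose_mulVec_dot_self_le B v
    rw [hv, ← hb] at this
    linarith
  have f4 := mulVec_dot_self_le J b
  have f5 := mulVec_dot_self_le K b
  have f6 := dot_self_nonneg (J *ᵥ a)
  have f7 := dot_self_nonneg (K *ᵥ a)
  have f8 := hlo v
  rw [hv] at f8
  have f9 := dot_self_nonneg b
  have f10 : (ip J J + ip K K) * (b ⬝ᵥ b) ≤ N ^ 2 * (2 * N) ^ 2 :=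
    mul_le_mul hJK f3 f9 (by positivity)
  have f11 : (2 * r) ^ 2 * (b ⬝ᵥ b) ≤ (2 * r) ^ 2 * (2 * N) ^ 2 := by gcongr
  -- The gain `r N / 10 · |a|²` is at least `20 (r N)²`, because `|a|² ≥ lam ≥ 200 r N`. It beats
  -- the losses: `16 (r N)²` from `A b` and less than `4 (r N)²` from `J b` and `K b`. The terms
  -- mixing `a` and `b` cancel between the two velocities.
  have f12 : 20 * (r * N) * (r * N) ≤ r * N / 10 * (a ⬝ᵥ a) := by
    have : lam ≤ a ⬝ᵥ a := by linarith
    nlinarith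
  have f13 : 0 ≤ r * N / 10 * (b ⬝ᵥ b) := by positivity
  have f14 : N ^ 2 * (2 * N) ^ 2 < 4 * (r * N) * (r * N) := by
    have : N ^ 2 < r ^ 2 := by nlinarith
    have hN2 : 0 < N ^ 2 := by positivity
    nlinarith
  have c1 := dotProduct_comm (K *ᵥ a) (K *ᵥ b)
  have c2 := dotProduct_comm (J *ᵥ a) (J *ᵥ b)
  have c3 := dotProduct_comm (B *ᵥ a) (A *ᵥ b)
  nlinarith

/-- Along the flow, up to any time `T` with `r N T ≤ 1 / 5`, the difference `B` stays of the order
of its initial size and the symmetric part of the residual stays nearly nonnegative. -/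
lemma small_difference_of_flow [Nonempty ι] {D : Matrix ι ι ℝ} (hD : Dᵀ = D) {lam r N T : ℝ}
    (hr : 0 < r) (hN : 0 < N) (hlr : lam ≤ r ^ 2)
    (hrN : 200 * (r * N) ≤ lam) (hT : 0 < T) (hNT : r * N * T ≤ 1 / 5)
    (hlo : ∀ v, lam * (v ⬝ᵥ v) ≤ v ⬝ᵥ (D *ᵥ v))
    (hhi : ∀ v, v ⬝ᵥ (D *ᵥ v) ≤ r ^ 2 * (v ⬝ᵥ v))
    {A B : ℝ → Matrix ι ι ℝ} {J : ℝ → Matrix μ ι ℝ} {K : ℝ → Matrix ν ι ℝ}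
    (hA : ∀ t, 0 ≤ t → HasEntryDeriv A (velA D (A t) (B t) (J t) (K t)) t)
    (hB : ∀ t, 0 ≤ t → HasEntryDeriv B (velB D (A t) (B t) (J t) (K t)) t)
    (hJK : ∀ t, 0 ≤ t → ip (J t) (J t) + ip (K t) (K t) ≤ N ^ 2)
    (hA0 : ip (A 0) (A 0) ≤ N ^ 2) (hB0 : ip (B 0) (B 0) ≤ N ^ 2) :
    ∀ t, 0 ≤ t → t ≤ T → ip (B t) (B t) ≤ (2 * N) ^ 2 ∧
      ∀ v, -(r * N / 10) * (v ⬝ᵥ v) ≤ v ⬝ᵥ (symPart D (A t) (B t) *ᵥ v) := by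
  have hNr : 200 * N ≤ r := by
    by_contra! h
    nlinarith
  have hrN0 : 0 < r * N := by positivity
  set q : ℝ → (ι → ℝ) → ℝ := fun t v => v ⬝ᵥ (D *ᵥ v) - ((A t)ᵀ *ᵥ v) ⬝ᵥ ((A t)ᵀ *ᵥ v)
    + ((B t)ᵀ *ᵥ v) ⬝ᵥ ((B t)ᵀ *ᵥ v) + r * N / 10 * (v ⬝ᵥ v) with hq
  -- The allowance for `|B|²` rises linearly from `2 N ^ 2` to `4 N ^ 2` on `[0, T]`. Its slope `2 N
  -- ^ 2 / T` exceeds the possible growth rate `5 r N · N ^ 2` since `r N T ≤ 1 / 5`.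
  set g : ℝ → ℝ := fun t => N ^ 2 * (2 + 2 * (t / T)) - ip (B t) (B t) with hg
  set φ : Bool → ℝ → (ι → ℝ) → ℝ := fun i t v => if i then q t v else g t with hφ
  have hform : ∀ t, (∀ v, v ⬝ᵥ v = 1 → 0 ≤ q t v) →
      ∀ v, -(r * N / 10) * (v ⬝ᵥ v) ≤ v ⬝ᵥ (symPart D (A t) (B t) *ᵥ v) := by
    intro t ht v
    have := forall_of_forall_unit (q := q t) (fun c x => by
      simp only [hq, mulVec_smul, smul_dotProduct, dotProduct_smul, smul_eq_mul]
      ring) ht v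
    rw [dot_symPart_mulVec]
    simp only [hq] at this
    linarith
  have hBle : ∀ t, 0 ≤ t → t ≤ T → 0 ≤ g t → ip (B t) (B t) ≤ (2 * N) ^ 2 := by
    intro t h0 h1 h
    have : t / T ≤ 1 := (div_le_one hT).2 h1
    simp only [hg] at h
    nlinarith [mul_le_mul_of_nonneg_left this (sq_nonneg N)]
  -- The scalar barrier `g` is also quantified over the unit sphere, so reading it off requires a
  -- point of the sphere.
  obtain ⟨i₀⟩ := ‹Nonempty ι›
  have hunit : (Pi.single i₀ (1 : ℝ) : ι → ℝ) ⬝ᵥ Pi.single i₀ 1 = 1 := by simp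
  have key := forall_pos_of_barrier (isCompact_dot_self_eq_one (ι := ι)) (φ := φ) (T := T)
    ?_ ?_ ?_
  · intro t h0 h1
    have hB2 : ip (B t) (B t) ≤ (2 * N) ^ 2 := hBle t h0 h1 (key t h0 h1 false _ hunit).le
    exact ⟨hB2, hform t fun v hv => (key t h0 h1 true v hv).le⟩
  · intro i
    have hsub : Icc (0 : ℝ) T ×ˢ {x : ι → ℝ | x ⬝ᵥ x = 1} ⊆ Ici 0 ×ˢ univ :=
      fun p hp => ⟨hp.1.1, trivial⟩
    refine ContinuousOn.mono ?_ hsub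
    cases i
    · simp only [hφ, hg, Bool.false_eq_true, if_false]
      refine ContinuousOn.sub (by fun_prop) ?_
      have : ContinuousOn (fun t => ip (B t) (B t)) (Ici 0) :=
        fun t ht => ((hB t ht).ip_self).continuousWithinAt
      exact this.comp continuousOn_fst fun p hp => hp.1
    · simp only [hφ, hq, if_true]
      have h1 := continuousOn_mulVec_dot_self fun t ht => (hA t ht).transpose
      have h2 := continuousOn_mulVec_dot_self fun t ht => (hB t ht).transpose
      have h3 : Continuous fun p : ℝ × (ι → ℝ) => p.2 ⬝ᵥ (D *ᵥ p.2) := by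
        simp only [dotProduct, mulVec]
        fun_prop
      have h4 : Continuous fun p : ℝ × (ι → ℝ) => r * N / 10 * (p.2 ⬝ᵥ p.2) := by
        simp only [dotProduct]
        fun_prop
      exact ((h3.continuousOn.sub h1).add h2).add h4.continuousOn
  · intro i v hv
    replace hv : v ⬝ᵥ v = 1 := hv
    cases i
    · simp only [hφ, hg, Bool.false_eq_true, if_false, zero_div]
      nlinarith
    · simp only [hφ, hq, if_true]
      have h1 := transpose_mulVec_dot_self_le (A 0) v
      have h2 := hlo v
      have h3 := dot_self_nonneg ((B 0)ᵀ *ᵥ v)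
      rw [hv] at h1 h2 ⊢
      nlinarith
  · intro t h0 h1 hnn i v hv hz
    replace hv : v ⬝ᵥ v = 1 := hv
    have hP := hform t fun v hv => hnn true v hv
    have hB2 := hBle t h0 h1 (hnn false v hv)
    have hAT := transpose_mulVec_le_of_symPart hr hN hNr hhi hB2 hP
    have hAv := mulVec_le_of_transpose_mulVec_le (by positivity) hAT
    cases i
    · refine ⟨N ^ 2 * (2 / T) - 2 * ip (B t) (velB D (A t) (B t) (J t) (K t)), ?_, ?_⟩
      · have e10 := two_mul_ip_velB_le hr hN hAv hP hB2 (hJK t h0)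
        have e11 : 5 * (r * N) * N ^ 2 < N ^ 2 * (2 / T) := by
          have : 5 * (r * N) < 2 / T := by
            rw [lt_div_iff₀ hT]
            linarith
          nlinarith [sq_pos_of_pos hN]
        linarith
      · simp only [hφ, hg, Bool.false_eq_true, if_false]
        have d1 : HasDerivAt (fun τ : ℝ => N ^ 2 * (2 + 2 * (τ / T))) (N ^ 2 * (2 / T)) t := by
          have := (((hasDerivAt_id t).div_const T).const_mul 2).const_add 2 |>.const_mul (N ^ 2)
          simpa [mul_div_assoc, div_eq_mul_inv] using this
        exact d1.hasDerivWithinAt.sub (hB t h0).ip_self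
    · refine ⟨-(2 * (((A t)ᵀ *ᵥ v) ⬝ᵥ ((velA D (A t) (B t) (J t) (K t))ᵀ *ᵥ v)))
        + 2 * (((B t)ᵀ *ᵥ v) ⬝ᵥ ((velB D (A t) (B t) (J t) (K t))ᵀ *ᵥ v)), ?_, ?_⟩
      · exact deriv_symPart_pos hD hr hN hNr hrN hlo hAv hP hB2 (hJK t h0) hv hz
      · simp only [hφ, hq, if_true]
        have d1 := (hA t h0).transpose.mulVec_dot_self v
        have d2 := (hB t h0).transpose.mulVec_dot_self v
        exact ((d1.const_sub (v ⬝ᵥ (D *ᵥ v))).add d2).add_const (r * N / 10 * (v ⬝ᵥ v))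

/-! ### Logistic growth of the least eigenvalue of `A Aᵀ` -/

/-- The logistic lower bound for the smallest eigenvalue of `A Aᵀ`. -/
def logistic (lam s t : ℝ) : ℝ := (2 / lam + 2 * Real.exp (-lam * t) / s ^ 2)⁻¹

lemma logistic_pos {lam s : ℝ} (hlam : 0 < lam) (hs : 0 < s) (t : ℝ) : 0 < logistic lam s t := by
  unfold logistic
  positivity

/-- Without `B`, `J`, `K` the least eigenvalue would satisfy `y' ≥ 2 lam y - 2 y ^ 2`. The
comparison function uses only half of the linear rate; the remaining `lam y` pays for the error
terms. -/
lemma hasDerivAt_logistic {lam s : ℝ} (hlam : 0 < lam) (hs : 0 < s) (t : ℝ) :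
    HasDerivAt (logistic lam s) (lam * logistic lam s t - 2 * logistic lam s t ^ 2) t := by
  have h1 : HasDerivAt (fun τ : ℝ => 2 / lam + 2 * Real.exp (-lam * τ) / s ^ 2)
      (2 * (Real.exp (-lam * t) * (-lam)) / s ^ 2) t := by
    have h2 : HasDerivAt (fun τ : ℝ => -lam * τ) (-lam) t := by
      simpa using (hasDerivAt_id t).const_mul (-lam)
    exact ((h2.exp.const_mul 2).div_const _).const_add _
  have hpos : 0 < 2 / lam + 2 * Real.exp (-lam * t) / s ^ 2 := by positivity
  have h3 : HasDerivAt (logistic lam s) _ t := h1.inv hpos.ne'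
  convert h3 using 1
  unfold logistic
  have he := Real.exp_pos (-lam * t)
  field_simp
  ring

/-- This floor is what allows an error of order `r N ^ 2 √y` to be compared with `lam y` at all
times. -/
lemma logistic_ge {lam s t : ℝ} (hlam : 0 < lam) (hs : 0 < s) (hsl : s ^ 2 ≤ lam) (ht : 0 ≤ t) :
    (s / 2) ^ 2 ≤ logistic lam s t := by
  unfold logistic
  have he : Real.exp (-lam * t) ≤ 1 := Real.exp_le_one_iff.2 (by nlinarith)
  have hep := Real.exp_pos (-lam * t)
  rw [le_inv_comm₀ (by positivity) (by positivity)]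
  have h1 : 2 / lam ≤ 2 / s ^ 2 := by gcongr
  have h2 : 2 * Real.exp (-lam * t) / s ^ 2 ≤ 2 * 1 / s ^ 2 := by gcongr
  have h3 : ((s / 2) ^ 2)⁻¹ = 2 / s ^ 2 + 2 * 1 / s ^ 2 := by
    field_simp
    ring
  linarith

lemma logistic_zero_lt {lam s : ℝ} (hlam : 0 < lam) (hs : 0 < s) : logistic lam s 0 < s ^ 2 := by
  unfold logistic
  rw [inv_lt_comm₀ (by positivity) (by positivity)]
  simp only [mul_zero, Real.exp_zero]
  have h1 : 0 < 2 / lam := by positivity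
  have h2 : 0 < 1 / s ^ 2 := by positivity
  have h3 : (s ^ 2)⁻¹ = 1 / s ^ 2 := by rw [one_div]
  have h4 : 2 * 1 / s ^ 2 = 2 * (1 / s ^ 2) := by ring
  linarith

lemma logistic_ge_of_exp_le {lam s t : ℝ} (hlam : 0 < lam) (hs : 0 < s)
    (ht : Real.log (lam / s ^ 2) / lam ≤ t) : lam / 4 ≤ logistic lam s t := by
  unfold logistic
  rw [le_inv_comm₀ (by positivity) (by positivity)]
  have h1 : Real.exp (-lam * t) ≤ s ^ 2 / lam := by
    rw [div_le_iff₀ hlam] at ht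
    calc Real.exp (-lam * t) ≤ Real.exp (-Real.log (lam / s ^ 2)) :=
          Real.exp_le_exp.2 (by linarith)
      _ = s ^ 2 / lam := by
          rw [Real.exp_neg, Real.exp_log (by positivity), inv_div]
  have h2 : 2 * Real.exp (-lam * t) / s ^ 2 ≤ 2 * (s ^ 2 / lam) / s ^ 2 := by gcongr
  have h3 : 2 * (s ^ 2 / lam) / s ^ 2 = 2 / lam := by field_simp
  have h4 : (lam / 4)⁻¹ = 2 / lam + 2 / lam := by
    field_simp
    ring
  linarith

lemma abs_mulVec_dot_mulVec_le (L : Matrix μ ι ℝ) {a b : ι → ℝ} {α β : ℝ} (hα : 0 ≤ α)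
    (hβ : 0 ≤ β) (ha : a ⬝ᵥ a ≤ α ^ 2) (hb : b ⬝ᵥ b ≤ β ^ 2) :
    |(L *ᵥ a) ⬝ᵥ (L *ᵥ b)| ≤ ip L L * (α * β) := by
  have hL := ip_self_nonneg L
  have h1 := (mulVec_dot_self_le L a).trans (mul_le_mul_of_nonneg_left ha hL)
  have h2 := (mulVec_dot_self_le L b).trans (mul_le_mul_of_nonneg_left hb hL)
  refine abs_le_of_sq_le_sq ((sq_dot_le _ _).trans ?_) (by positivity)
  calc _ ≤ (ip L L * α ^ 2) * (ip L L * β ^ 2) :=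
        mul_le_mul h1 h2 (dot_self_nonneg _) (by positivity)
    _ = _ := by ring

/-- At a minimizer of `|Aᵀ v|²` on the unit sphere, with minimal value `x²`, the minimal value
grows faster than the logistic function. -/
lemma deriv_gram_gt {D A B : Matrix ι ι ℝ} (hD : Dᵀ = D) {J : Matrix μ ι ℝ}
    {K : Matrix ν ι ℝ} {lam r N s x : ℝ} (hr : 0 < r) (hN : 0 < N) (hNr : 200 * N ≤ r)
    (hrN : 200 * (r * N) ≤ lam) (hx : 0 < x) (hsx : s ≤ 2 * x)
    (hrs : 200 * (r * N ^ 2) ≤ lam * s) (hlo : ∀ v, lam * (v ⬝ᵥ v) ≤ v ⬝ᵥ (D *ᵥ v))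
    (hAv : ∀ x, (A *ᵥ x) ⬝ᵥ (A *ᵥ x) ≤ (2 * r) ^ 2 * (x ⬝ᵥ x))
    (hB2 : ip B B ≤ (2 * N) ^ 2) (hJK : ip J J + ip K K ≤ N ^ 2) {v : ι → ℝ} (hv : v ⬝ᵥ v = 1)
    (hmin : ∀ w, x ^ 2 * (w ⬝ᵥ w) ≤ (Aᵀ *ᵥ w) ⬝ᵥ (Aᵀ *ᵥ w))
    (hz : (Aᵀ *ᵥ v) ⬝ᵥ (Aᵀ *ᵥ v) = x ^ 2) :
    lam * x ^ 2 - 2 * (x ^ 2) ^ 2 < 2 * ((Aᵀ *ᵥ v) ⬝ᵥ ((velA D A B J K)ᵀ *ᵥ v)) := by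
  have hlam : 0 < lam := lt_of_lt_of_le (by positivity) hrN
  set a := Aᵀ *ᵥ v with ha
  set b := Bᵀ *ᵥ v with hb
  -- As a minimizer, `v` is an eigenvector of `A Aᵀ`, so `A a = x ^ 2 v` and the leading term of the
  -- derivative becomes `x ^ 2` times the symmetric form at `v`.
  have hX : (A * Aᵀ - (x ^ 2) • (1 : Matrix ι ι ℝ)) *ᵥ v = 0 := by
    have e : ∀ w : ι → ℝ, w ⬝ᵥ ((A * Aᵀ - (x ^ 2) • (1 : Matrix ι ι ℝ)) *ᵥ w)
        = (Aᵀ *ᵥ w) ⬝ᵥ (Aᵀ *ᵥ w) - x ^ 2 * (w ⬝ᵥ w) := by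
      intro w
      rw [mulVec_dot Aᵀ]
      simp [sub_mulVec, smul_mulVec, dotProduct_sub]
    refine mulVec_eq_zero_of_quadratic (by simp) ?_ ?_
    · intro w
      rw [e]
      linarith [hmin w]
    · rw [e, ← ha, hz, hv]
      ring
  have hAa : A *ᵥ a = (x ^ 2) • v := by
    rw [sub_mulVec, smul_mulVec, one_mulVec, ← mulVec_mulVec, ← ha] at hX
    exact sub_eq_zero.1 hX
  have hvP := dot_symPart_mulVec D A B v
  rw [← ha, ← hb, hz] at hvP
  rw [dot_velA hD _ _ _ _ v ha.symm hb.symm, hAa, smul_dotProduct, smul_eq_mul, hvP]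
  have f8 := hlo v
  rw [hv] at f8
  have hbb : b ⬝ᵥ b ≤ (2 * N) ^ 2 := by
    have := transpose_mulVec_dot_self_le B v
    rw [hv, ← hb] at this
    linarith
  have hb0 := dot_self_nonneg b
  have hJ0 := ip_self_nonneg J
  have hK0 := ip_self_nonneg K
  have hBa : (B *ᵥ a) ⬝ᵥ (B *ᵥ a) ≤ (2 * N * x) ^ 2 := by
    have := mulVec_dot_self_le B a
    rw [hz] at this
    nlinarith [sq_nonneg x, mul_le_mul_of_nonneg_right hB2 (sq_nonneg x)]
  have hAb : (A *ᵥ b) ⬝ᵥ (A *ᵥ b) ≤ (2 * r * (2 * N)) ^ 2 := by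
    have h1 := hAv b
    have h2 : (2 * r) ^ 2 * (b ⬝ᵥ b) ≤ (2 * r) ^ 2 * (2 * N) ^ 2 := by gcongr
    nlinarith
  have hmix := abs_le.1 (abs_dot_le (by positivity) (by positivity) hBa hAb)
  have hKa := mulVec_dot_self_le K a
  have hJa := mulVec_dot_self_le J a
  rw [hz] at hKa hJa
  have hKab := abs_le.1 (abs_mulVec_dot_mulVec_le K hx.le (by positivity) hz.le hbb)
  have hJab := abs_le.1 (abs_mulVec_dot_mulVec_le J hx.le (by positivity) hz.le hbb)
  have g1 : (ip J J + ip K K) * (x * (2 * N)) ≤ N ^ 2 * (x * (2 * N)) := by gcongr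
  have g2 : (ip J J + ip K K) * x ^ 2 ≤ N ^ 2 * x ^ 2 := by gcongr
  have g3 : x ^ 2 * lam ≤ x ^ 2 * (v ⬝ᵥ (D *ᵥ v)) := by
    refine mul_le_mul_of_nonneg_left ?_ (sq_nonneg x)
    linarith
  have g4 : 0 ≤ x ^ 2 * (b ⬝ᵥ b) := by positivity
  have g5 : N ^ 2 ≤ lam / 1000 := by
    have := mul_le_mul_of_nonneg_right hNr hN.le
    linarith
  have g6 : N ^ 2 * x ^ 2 ≤ lam / 1000 * x ^ 2 := by gcongr
  -- The dominant error `(B a) · (A b)` is only linear in `x`. It is absorbed because `x ≥ s / 2`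
  -- and `200 r N ^ 2 ≤ lam s`; this is where the conditioning of the initialization is needed.
  have g7 : r * N ^ 2 * x ≤ lam / 100 * x ^ 2 := by
    have h1 := mul_le_mul_of_nonneg_left hsx hlam.le
    have h2 : r * N ^ 2 ≤ lam / 100 * x := by linarith
    have h3 := mul_le_mul_of_nonneg_right h2 hx.le
    linarith
  have g8 : N ^ 2 * (x * (2 * N)) ≤ r * N ^ 2 * x := by
    have h1 : 0 ≤ N ^ 2 * x := by positivity
    have h2 : 2 * N ≤ r := by linarith
    have h3 := mul_le_mul_of_nonneg_left h2 h1
    linarith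
  have g9 : 0 < lam * x ^ 2 := by positivity
  have g10 : (2 * N * x) ^ 2 = 4 * (N ^ 2 * x ^ 2) := by ring
  have g11 : 2 * N * x * (2 * r * (2 * N)) = 8 * (r * N ^ 2 * x) := by ring
  rw [g10] at hBa
  rw [g11] at hmix
  linarith [hmix.1, hKab.1, hJab.2]

/-- Along the flow, as long as `B` stays small, the smallest eigenvalue of `A Aᵀ` grows at least
like the logistic function. -/
lemma logistic_le_of_flow {D : Matrix ι ι ℝ} (hD : Dᵀ = D) {lam r N s T : ℝ}
    (hr : 0 < r) (hN : 0 < N) (hNr : 200 * N ≤ r)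
    (hrN : 200 * (r * N) ≤ lam) (hs : 0 < s) (hsl : s ^ 2 ≤ lam)
    (hrs : 200 * (r * N ^ 2) ≤ lam * s)
    (hlo : ∀ v, lam * (v ⬝ᵥ v) ≤ v ⬝ᵥ (D *ᵥ v))
    {A B : ℝ → Matrix ι ι ℝ} {J : ℝ → Matrix μ ι ℝ} {K : ℝ → Matrix ν ι ℝ}
    (hA : ∀ t, 0 ≤ t → HasEntryDeriv A (velA D (A t) (B t) (J t) (K t)) t)
    (hJK : ∀ t, 0 ≤ t → ip (J t) (J t) + ip (K t) (K t) ≤ N ^ 2)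
    (hA0 : ∀ v, s ^ 2 * (v ⬝ᵥ v) ≤ ((A 0)ᵀ *ᵥ v) ⬝ᵥ ((A 0)ᵀ *ᵥ v))
    (hB2 : ∀ t, 0 ≤ t → t ≤ T → ip (B t) (B t) ≤ (2 * N) ^ 2)
    (hAv : ∀ t, 0 ≤ t → t ≤ T →
      ∀ x, (A t *ᵥ x) ⬝ᵥ (A t *ᵥ x) ≤ (2 * r) ^ 2 * (x ⬝ᵥ x)) :
    ∀ t, 0 ≤ t → t ≤ T →
      ∀ v, logistic lam s t * (v ⬝ᵥ v) ≤ ((A t)ᵀ *ᵥ v) ⬝ᵥ ((A t)ᵀ *ᵥ v) := by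
  have hlam : 0 < lam := lt_of_lt_of_le (by positivity) hrN
  set q : Unit → ℝ → (ι → ℝ) → ℝ := fun _ t v =>
    ((A t)ᵀ *ᵥ v) ⬝ᵥ ((A t)ᵀ *ᵥ v) - logistic lam s t * (v ⬝ᵥ v) with hq
  have hform : ∀ t, (∀ v, v ⬝ᵥ v = 1 → 0 ≤ q () t v) →
      ∀ v, logistic lam s t * (v ⬝ᵥ v) ≤ ((A t)ᵀ *ᵥ v) ⬝ᵥ ((A t)ᵀ *ᵥ v) := by
    intro t ht v
    have := forall_of_forall_unit (q := q () t) (fun c x => by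
      simp only [hq, mulVec_smul, smul_dotProduct, dotProduct_smul, smul_eq_mul]
      ring) ht v
    simp only [hq] at this
    linarith
  have key := forall_pos_of_barrier (isCompact_dot_self_eq_one (ι := ι)) (φ := q) (T := T)
    ?_ ?_ ?_
  · exact fun t h0 h1 => hform t fun v hv => (key t h0 h1 () v hv).le
  · intro i
    have hsub : Icc (0 : ℝ) T ×ˢ {x : ι → ℝ | x ⬝ᵥ x = 1} ⊆ Ici 0 ×ˢ univ :=
      fun p hp => ⟨hp.1.1, trivial⟩
    refine ContinuousOn.mono ?_ hsub
    have h1 := continuousOn_mulVec_dot_self fun t ht => (hA t ht).transpose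
    have h2 : Continuous (logistic lam s) :=
      continuous_iff_continuousAt.2 fun t => (hasDerivAt_logistic hlam hs t).continuousAt
    have h3 : Continuous fun p : ℝ × (ι → ℝ) => p.2 ⬝ᵥ p.2 := by
      simp only [dotProduct]
      fun_prop
    exact h1.sub ((h2.comp continuous_fst).mul h3).continuousOn
  · intro i v hv
    replace hv : v ⬝ᵥ v = 1 := hv
    have h1 := hA0 v
    have h2 := logistic_zero_lt hlam hs
    simp only [hq]
    rw [hv] at h1 ⊢
    linarith
  · intro t h0 h1 hnn i v hv hz
    replace hv : v ⬝ᵥ v = 1 := hv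
    have hmin := hform t fun v hv => hnn () v hv
    have hpos := logistic_pos hlam hs t
    have hge := logistic_ge hlam hs hsl h0
    have hx2 := Real.sq_sqrt hpos.le
    set x := Real.sqrt (logistic lam s t) with hx
    have hxs : s ≤ 2 * x := by
      have : s / 2 ≤ x := by
        rw [hx]
        exact Real.le_sqrt_of_sq_le hge
      linarith
    have hz' : ((A t)ᵀ *ᵥ v) ⬝ᵥ ((A t)ᵀ *ᵥ v) = x ^ 2 := by
      simp only [hq] at hz
      rw [hv] at hz
      linarith
    refine ⟨_, ?_, ((hA t h0).transpose.mulVec_dot_self v).sub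
      (((hasDerivAt_logistic hlam hs t).hasDerivWithinAt).mul_const (v ⬝ᵥ v))⟩
    have := deriv_gram_gt hD hr hN hNr hrN (Real.sqrt_pos.2 hpos) hxs hrs hlo (hAv t h0 h1)
      (hB2 t h0 h1) (hJK t h0) hv (by rw [hx2]; exact hmin) hz'
    rw [← hx, hx2] at this
    rw [hv]
    linarith

end Growth

/-! ### Block form of the flow, dissipation, balance and convergence -/

section Block

variable {ι μ ν : Type*} [Fintype ι] [DecidableEq ι] [Fintype μ] [Fintype ν]

/-- The gradient flow written in the singular bases of the target: `U` and `V` are the components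
of the factors in the singular subspaces and `J` and `K` the orthogonal components. -/
structure IsBlockFlow (D : Matrix ι ι ℝ) (U V : ℝ → Matrix ι ι ℝ) (J : ℝ → Matrix μ ι ℝ)
    (K : ℝ → Matrix ν ι ℝ) : Prop where
  deriv_U : ∀ t, 0 ≤ t →
    HasEntryDeriv U ((D - U t * (V t)ᵀ) * V t - U t * ((K t)ᵀ * K t)) t
  deriv_V : ∀ t, 0 ≤ t →
    HasEntryDeriv V ((D - U t * (V t)ᵀ)ᵀ * U t - V t * ((J t)ᵀ * J t)) t
  deriv_J : ∀ t, 0 ≤ t → HasEntryDeriv J (-(J t * ((V t)ᵀ * V t + (K t)ᵀ * K t))) t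
  deriv_K : ∀ t, 0 ≤ t → HasEntryDeriv K (-(K t * ((U t)ᵀ * U t + (J t)ᵀ * J t))) t

/-- The objective in block form. -/
def blockLoss (D U V : Matrix ι ι ℝ) (J : Matrix μ ι ℝ) (K : Matrix ν ι ℝ) : ℝ :=
  (1 / 2) * (ip (D - U * Vᵀ) (D - U * Vᵀ) + ip (U * Kᵀ) (U * Kᵀ) + ip (J * Vᵀ) (J * Vᵀ)
    + ip (J * Kᵀ) (J * Kᵀ))

/-- The squared norm of the gradient in block form. -/
def blockGradSq (D U V : Matrix ι ι ℝ) (J : Matrix μ ι ℝ) (K : Matrix ν ι ℝ) : ℝ :=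
  ip ((D - U * Vᵀ) * V - U * (Kᵀ * K)) ((D - U * Vᵀ) * V - U * (Kᵀ * K))
    + ip ((D - U * Vᵀ)ᵀ * U - V * (Jᵀ * J)) ((D - U * Vᵀ)ᵀ * U - V * (Jᵀ * J))
    + ip (J * (Vᵀ * V + Kᵀ * K)) (J * (Vᵀ * V + Kᵀ * K))
    + ip (K * (Uᵀ * U + Jᵀ * J)) (K * (Uᵀ * U + Jᵀ * J))

lemma blockGradSq_nonneg (D U V : Matrix ι ι ℝ) (J : Matrix μ ι ℝ) (K : Matrix ν ι ℝ) :
    0 ≤ blockGradSq D U V J K :=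
  add_nonneg (add_nonneg (add_nonneg (ip_self_nonneg _) (ip_self_nonneg _)) (ip_self_nonneg _))
    (ip_self_nonneg _)

lemma ip_mul_transpose_mul_transpose {α β γ δ : Type*} [Fintype α] [Fintype β] [Fintype γ]
    [Fintype δ] (M : Matrix α β ℝ) (P : Matrix γ β ℝ) (X : Matrix α δ ℝ) (Y : Matrix γ δ ℝ) :
    ip (M * Pᵀ) (X * Yᵀ) = ip (M * (Pᵀ * Y)) X := by
  rw [← Matrix.mul_assoc, ip_mul_left_right (M * Pᵀ)]

lemma ip_mul_transpose_mul_transpose' {α β γ δ : Type*} [Fintype α] [Fintype β] [Fintype γ]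
    [Fintype δ] (M : Matrix α β ℝ) (P : Matrix γ β ℝ) (X : Matrix α δ ℝ) (Y : Matrix γ δ ℝ) :
    ip (M * Pᵀ) (X * Yᵀ) = ip (P * (Mᵀ * X)) Y := by
  rw [← ip_transpose, transpose_mul, transpose_mul, transpose_transpose, transpose_transpose,
    ip_mul_transpose_mul_transpose]

/-- The flow is still a gradient flow in block form: `blockGradSq` is the sum of the squared norms
of the four block velocities, and the loss dissipates at exactly this rate. -/
lemma hasDerivWithinAt_blockLoss {D : Matrix ι ι ℝ} {U V : ℝ → Matrix ι ι ℝ}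
    {J : ℝ → Matrix μ ι ℝ} {K : ℝ → Matrix ν ι ℝ} (h : IsBlockFlow D U V J K) {t : ℝ}
    (ht : 0 ≤ t) :
    HasDerivWithinAt (fun τ => blockLoss D (U τ) (V τ) (J τ) (K τ))
      (-blockGradSq D (U t) (V t) (J t) (K t)) (Ici 0) t := by
  have hU := h.deriv_U t ht
  have hV := h.deriv_V t ht
  have hJ := h.deriv_J t ht
  have hK := h.deriv_K t ht
  unfold blockLoss blockGradSq
  set R := D - U t * (V t)ᵀ with hR
  set X := R * V t - U t * ((K t)ᵀ * K t) with hX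
  set Y := Rᵀ * U t - V t * ((J t)ᵀ * J t) with hY
  set E := J t * ((V t)ᵀ * V t + (K t)ᵀ * K t) with hE
  set F := K t * ((U t)ᵀ * U t + (J t)ᵀ * J t) with hF
  have h1 := ((HasEntryDeriv.const D).sub (hU.mul hV.transpose)).ip_self
  have h2 := (hU.mul hK.transpose).ip_self
  have h3 := (hJ.mul hV.transpose).ip_self
  have h4 := (hJ.mul hK.transpose).ip_self
  refine ((((h1.add h2).add h3).add h4).const_mul (1 / 2)).congr_deriv ?_
  rw [← hR]
  have e1 : ip R (0 - (X * (V t)ᵀ + U t * Yᵀ)) = -ip (R * V t) X - ip (Rᵀ * U t) Y := by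
    have a1 : ip R (X * (V t)ᵀ) = ip (R * V t) X := (ip_mul_left_right _ _ _).symm
    have a2 : ip R (U t * Yᵀ) = ip (Rᵀ * U t) Y := by
      rw [ip_mul_left_right, ← ip_transpose R]
      simp
    rw [ip_sub_right, ip_add_right, a1, a2]
    simp [ip]
    ring
  have e2 : ip (U t * (K t)ᵀ) (X * (K t)ᵀ + U t * (-F)ᵀ)
      = ip (U t * ((K t)ᵀ * K t)) X - ip (K t * ((U t)ᵀ * U t)) F := by
    rw [ip_add_right, ip_mul_transpose_mul_transpose, ip_mul_transpose_mul_transpose', ip_neg_right]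
    ring
  have e3 : ip (J t * (V t)ᵀ) (-E * (V t)ᵀ + J t * Yᵀ)
      = -ip (J t * ((V t)ᵀ * V t)) E + ip (V t * ((J t)ᵀ * J t)) Y := by
    rw [ip_add_right, ip_mul_transpose_mul_transpose, ip_mul_transpose_mul_transpose', ip_neg_right]
  have e4 : ip (J t * (K t)ᵀ) (-E * (K t)ᵀ + J t * (-F)ᵀ)
      = -ip (J t * ((K t)ᵀ * K t)) E - ip (K t * ((J t)ᵀ * J t)) F := by
    rw [ip_add_right, ip_mul_transpose_mul_transpose, ip_mul_transpose_mul_transpose', ip_neg_right,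
      ip_neg_right]
    ring
  have x1 : ip X X = ip (R * V t) X - ip (U t * ((K t)ᵀ * K t)) X := by
    rw [← ip_sub_left]
  have x2 : ip Y Y = ip (Rᵀ * U t) Y - ip (V t * ((J t)ᵀ * J t)) Y := by
    rw [← ip_sub_left]
  have x3 : ip E E = ip (J t * ((V t)ᵀ * V t)) E + ip (J t * ((K t)ᵀ * K t)) E := by
    rw [← ip_add_left, ← Matrix.mul_add]
  have x4 : ip F F = ip (K t * ((U t)ᵀ * U t)) F + ip (K t * ((J t)ᵀ * J t)) F := by
    rw [← ip_add_left, ← Matrix.mul_add]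
  rw [e1, e2, e3, e4, x1, x2, x3, x4]
  ring

lemma IsBlockFlow.blockLoss_antitone {D : Matrix ι ι ℝ} {U V : ℝ → Matrix ι ι ℝ}
    {J : ℝ → Matrix μ ι ℝ} {K : ℝ → Matrix ν ι ℝ} (h : IsBlockFlow D U V J K) {a b : ℝ}
    (ha : 0 ≤ a) (hab : a ≤ b) :
    blockLoss D (U b) (V b) (J b) (K b) ≤ blockLoss D (U a) (V a) (J a) (K a) :=
  le_of_hasDerivWithinAt_nonpos ha hab
    (g := fun τ => blockLoss D (U τ) (V τ) (J τ) (K τ))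
    (fun _ ht => hasDerivWithinAt_blockLoss h ht)
    (fun _ _ _ => neg_nonpos.2 (blockGradSq_nonneg _ _ _ _ _))

lemma ip_mul_gram_add_gram (J : Matrix μ ι ℝ) (V : Matrix ι ι ℝ) (K : Matrix ν ι ℝ) :
    ip J (J * (Vᵀ * V + Kᵀ * K)) = ip (J * Vᵀ) (J * Vᵀ) + ip (J * Kᵀ) (J * Kᵀ) := by
  rw [Matrix.mul_add, ip_add_right, ip_comm J, ip_comm J, ← ip_mul_transpose_mul_transpose,
    ← ip_mul_transpose_mul_transpose]

/-- The velocity of `J` is `-J` times a sum of Gram matrices, so its inner product with `J` is minus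
a sum of squares. Components outside the singular subspaces therefore never exceed their initial
size. -/
lemma IsBlockFlow.ip_J_le {D : Matrix ι ι ℝ} {U V : ℝ → Matrix ι ι ℝ}
    {J : ℝ → Matrix μ ι ℝ} {K : ℝ → Matrix ν ι ℝ} (h : IsBlockFlow D U V J K) {t : ℝ}
    (ht : 0 ≤ t) : ip (J t) (J t) ≤ ip (J 0) (J 0) :=
  le_of_hasDerivWithinAt_nonpos le_rfl ht (g := fun τ => ip (J τ) (J τ))
    (fun _ hτ => (h.deriv_J _ hτ).ip_self) (fun τ _ _ => by
      rw [ip_neg_right, ip_mul_gram_add_gram]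
      linarith [ip_self_nonneg (J τ * (V τ)ᵀ), ip_self_nonneg (J τ * (K τ)ᵀ)])

lemma IsBlockFlow.ip_K_le {D : Matrix ι ι ℝ} {U V : ℝ → Matrix ι ι ℝ}
    {J : ℝ → Matrix μ ι ℝ} {K : ℝ → Matrix ν ι ℝ} (h : IsBlockFlow D U V J K) {t : ℝ}
    (ht : 0 ≤ t) : ip (K t) (K t) ≤ ip (K 0) (K 0) :=
  le_of_hasDerivWithinAt_nonpos le_rfl ht (g := fun τ => ip (K τ) (K τ))
    (fun _ hτ => (h.deriv_K _ hτ).ip_self) (fun τ _ _ => by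
      rw [ip_neg_right, ip_mul_gram_add_gram]
      linarith [ip_self_nonneg (K τ * (U τ)ᵀ), ip_self_nonneg (K τ * (J τ)ᵀ)])

lemma dot_mulVec_self_eq_zero_of_skew {W : Matrix ι ι ℝ} (hW : Wᵀ = -W) (z : ι → ℝ) :
    z ⬝ᵥ (W *ᵥ z) = 0 := by
  have h1 : z ⬝ᵥ (W *ᵥ z) = z ⬝ᵥ (Wᵀ *ᵥ z) := by
    rw [← mulVec_dot, dotProduct_comm]
  rw [hW, neg_mulVec, dotProduct_neg] at h1
  linarith

/-- The difference of the Gram matrices of the two factors is conserved. -/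
lemma IsBlockFlow.balance {D : Matrix ι ι ℝ} {U V : ℝ → Matrix ι ι ℝ}
    {J : ℝ → Matrix μ ι ℝ} {K : ℝ → Matrix ν ι ℝ} (h : IsBlockFlow D U V J K) (z : ι → ℝ) {t : ℝ}
    (ht : 0 ≤ t) :
    (U t *ᵥ z) ⬝ᵥ (U t *ᵥ z) + (J t *ᵥ z) ⬝ᵥ (J t *ᵥ z) - (V t *ᵥ z) ⬝ᵥ (V t *ᵥ z)
        - (K t *ᵥ z) ⬝ᵥ (K t *ᵥ z)
      = (U 0 *ᵥ z) ⬝ᵥ (U 0 *ᵥ z) + (J 0 *ᵥ z) ⬝ᵥ (J 0 *ᵥ z) - (V 0 *ᵥ z) ⬝ᵥ (V 0 *ᵥ z)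
        - (K 0 *ᵥ z) ⬝ᵥ (K 0 *ᵥ z) := by
  set g : ℝ → ℝ := fun t => (U t *ᵥ z) ⬝ᵥ (U t *ᵥ z) + (J t *ᵥ z) ⬝ᵥ (J t *ᵥ z)
    - (V t *ᵥ z) ⬝ᵥ (V t *ᵥ z) - (K t *ᵥ z) ⬝ᵥ (K t *ᵥ z) with hg
  have hd : ∀ τ, 0 ≤ τ → HasDerivWithinAt g 0 (Ici 0) τ := by
    intro τ hτ
    refine (((((h.deriv_U τ hτ).mulVec_dot_self z).add ((h.deriv_J τ hτ).mulVec_dot_self z)).sub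
      ((h.deriv_V τ hτ).mulVec_dot_self z)).sub
      ((h.deriv_K τ hτ).mulVec_dot_self z)).congr_deriv ?_
    set R := D - U τ * (V τ)ᵀ
    -- Half the derivative of the balance is the quadratic form of a skew-symmetric matrix, since
    -- all symmetric contributions cancel.
    have hW := dot_mulVec_self_eq_zero_of_skew (W := (U τ)ᵀ * (R * V τ - U τ * ((K τ)ᵀ * K τ))
      + (J τ)ᵀ * (-(J τ * ((V τ)ᵀ * V τ + (K τ)ᵀ * K τ)))
      - (V τ)ᵀ * (Rᵀ * U τ - V τ * ((J τ)ᵀ * J τ))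
      - (K τ)ᵀ * (-(K τ * ((U τ)ᵀ * U τ + (J τ)ᵀ * J τ)))) (by
        simp only [transpose_add, transpose_sub, transpose_mul, transpose_neg,
          transpose_transpose, Matrix.mul_add, Matrix.mul_sub, Matrix.mul_neg,
          Matrix.mul_assoc]
        abel) z
    rw [sub_mulVec, sub_mulVec, add_mulVec, dotProduct_sub, dotProduct_sub, dotProduct_add,
      ← mulVec_mulVec, ← mulVec_mulVec, ← mulVec_mulVec, ← mulVec_mulVec] at hW
    simp only [mulVec_dot (U τ), mulVec_dot (V τ), mulVec_dot (J τ), mulVec_dot (K τ)]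
    linarith
  refine le_antisymm ?_ ?_
  · exact le_of_hasDerivWithinAt_nonpos le_rfl ht hd fun _ _ _ => le_rfl
  · have := le_of_hasDerivWithinAt_nonpos le_rfl ht (g := fun t => -g t) (g' := fun _ => 0)
      (fun τ hτ => (hd τ hτ).neg.congr_deriv neg_zero) fun _ _ _ => le_rfl
    exact neg_le_neg_iff.1 this

/-- Row by row this is `E ≥ c ⟹ E² ≥ c E`, obtained from Cauchy–Schwarz for `x · E x`. -/
lemma le_ip_mul_self_of_le_dot {E : Matrix ι ι ℝ} (hE : Eᵀ = E) {c : ℝ} (hc : 0 < c)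
    (h : ∀ x, c * (x ⬝ᵥ x) ≤ x ⬝ᵥ (E *ᵥ x)) (J : Matrix μ ι ℝ) :
    c * ip J (J * E) ≤ ip (J * E) (J * E) := by
  simp only [ip_eq_sum_row, Finset.mul_sum, mul_row, hE]
  refine Finset.sum_le_sum fun i _ => ?_
  set x := J i
  have h1 := h x
  have h2 := sq_dot_le x (E *ᵥ x)
  have h3 := dot_self_nonneg x
  have h4 := dot_self_nonneg (E *ᵥ x)
  have h5 : 0 ≤ x ⬝ᵥ (E *ᵥ x) := by nlinarith
  rcases h5.eq_or_lt with h0 | h0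
  · rw [← h0]
    simpa using h4
  · refine le_of_mul_le_mul_right ?_ h0
    nlinarith [mul_le_mul_of_nonneg_right h1 h4]

lemma half_ip_le_ip_sub (X Y : Matrix μ ν ℝ) :
    (1 / 2) * ip X X - ip Y Y ≤ ip (X - Y) (X - Y) := by
  have h := ip_self_nonneg (X - (2 : ℝ) • Y)
  simp only [ip_sub_left, ip_sub_right, ip_smul_left, ip_smul_right] at h ⊢
  linarith [ip_comm X Y]

/-- The Polyak–Łojasiewicz inequality where both factors are well conditioned. -/
lemma mul_blockLoss_le_blockGradSq {D U V : Matrix ι ι ℝ} {J : Matrix μ ι ℝ} {K : Matrix ν ι ℝ}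
    {c : ℝ} (hc : 0 < c) (hU : ∀ x, c * (x ⬝ᵥ x) ≤ (Uᵀ *ᵥ x) ⬝ᵥ (Uᵀ *ᵥ x))
    (hV : ∀ x, c * (x ⬝ᵥ x) ≤ (Vᵀ *ᵥ x) ⬝ᵥ (Vᵀ *ᵥ x)) (hJ : ip J J ≤ c / 2)
    (hK : ip K K ≤ c / 2) : c * blockLoss D U V J K ≤ blockGradSq D U V J K := by
  unfold blockLoss blockGradSq
  set R := D - U * Vᵀ
  -- The cross terms `U KᵀK` and `V JᵀJ` cost at most half of `c` times the off-diagonal losses,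
  -- because `|J|²` and `|K|²` are at most `c / 2`. The gradients in `J` and `K` supply the full
  -- multiple `c` of those losses.
  have a1 := half_ip_le_ip_sub (R * V) (U * (Kᵀ * K))
  have a2 := half_ip_le_ip_sub (Rᵀ * U) (V * (Jᵀ * J))
  have b1 := le_ip_mul_self_of_forall hV R
  have b2 := le_ip_mul_self_of_forall hU Rᵀ
  rw [ip_transpose] at b2
  have c1 : ip (U * (Kᵀ * K)) (U * (Kᵀ * K)) ≤ ip (U * Kᵀ) (U * Kᵀ) * (c / 2) := by
    rw [← Matrix.mul_assoc]
    exact (ip_mul_self_le _ _).trans (mul_le_mul_of_nonneg_left hK (ip_self_nonneg _))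
  have c2 : ip (V * (Jᵀ * J)) (V * (Jᵀ * J)) ≤ ip (J * Vᵀ) (J * Vᵀ) * (c / 2) := by
    rw [← Matrix.mul_assoc, ← ip_transpose (J * Vᵀ), transpose_mul, transpose_transpose]
    exact (ip_mul_self_le _ _).trans (mul_le_mul_of_nonneg_left hJ (ip_self_nonneg _))
  have hgram : ∀ {M : Matrix ι ι ℝ}, (∀ x, c * (x ⬝ᵥ x) ≤ (Mᵀ *ᵥ x) ⬝ᵥ (Mᵀ *ᵥ x)) →
      ∀ {S : Matrix ι ι ℝ}, (∀ x, 0 ≤ x ⬝ᵥ (S *ᵥ x)) →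
      ∀ x, c * (x ⬝ᵥ x) ≤ x ⬝ᵥ ((Mᵀ * M + S) *ᵥ x) := by
    intro M hM S hS x
    have := le_mulVec_of_le_transpose_mulVec hc hM x
    rw [mulVec_dot] at this
    rw [add_mulVec, ← mulVec_mulVec, dotProduct_add]
    linarith [hS x]
  have d1 := le_ip_mul_self_of_le_dot (E := Vᵀ * V + Kᵀ * K) (by simp) hc
    (hgram hV fun x => by rw [← mulVec_mulVec, ← mulVec_dot]; exact dot_self_nonneg _) J
  have d2 := le_ip_mul_self_of_le_dot (E := Uᵀ * U + Jᵀ * J) (by simp) hc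
    (hgram hU fun x => by rw [← mulVec_mulVec, ← mulVec_dot]; exact dot_self_nonneg _) K
  rw [ip_mul_gram_add_gram] at d1 d2
  have e1 : ip (K * Uᵀ) (K * Uᵀ) = ip (U * Kᵀ) (U * Kᵀ) := by
    rw [← ip_transpose]
    simp
  rw [e1] at d2
  have p1 := mul_nonneg hc.le (ip_self_nonneg R)
  have p2 := mul_nonneg hc.le (ip_self_nonneg (J * Kᵀ))
  have p3 := mul_nonneg hc.le (ip_self_nonneg (K * Jᵀ))
  linarith

/-- A small residual and nearly balanced factors make the first factor well conditioned. -/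
lemma le_transpose_mulVec_of_residual {D U V : Matrix ι ι ℝ} {lam : ℝ} (hlam : 0 < lam)
    (hlo : ∀ v, lam * (v ⬝ᵥ v) ≤ v ⬝ᵥ (D *ᵥ v))
    (hR : ip (D - U * Vᵀ) (D - U * Vᵀ) ≤ (lam / 4) ^ 2)
    (hbal : ∀ z, (V *ᵥ z) ⬝ᵥ (V *ᵥ z) ≤ (U *ᵥ z) ⬝ᵥ (U *ᵥ z) + lam / 8 * (z ⬝ᵥ z)) :
    ∀ x, lam / 8 * (x ⬝ᵥ x) ≤ (Uᵀ *ᵥ x) ⬝ᵥ (Uᵀ *ᵥ x) := by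
  rcases isEmpty_or_nonempty ι with hemp | ⟨⟨i₀⟩⟩
  · intro x
    simp [dotProduct]
  have hne : ({x : ι → ℝ | x ⬝ᵥ x = 1}).Nonempty :=
    ⟨Pi.single i₀ 1, by simp⟩
  have hcont : Continuous fun x : ι → ℝ => (Uᵀ *ᵥ x) ⬝ᵥ (Uᵀ *ᵥ x) := by
    simp only [dotProduct, mulVec]
    fun_prop
  obtain ⟨v, hv, hvmin⟩ := (isCompact_dot_self_eq_one (ι := ι)).exists_isMinOn hne
    hcont.continuousOn
  replace hv : v ⬝ᵥ v = 1 := hv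
  set α := (Uᵀ *ᵥ v) ⬝ᵥ (Uᵀ *ᵥ v) with hα
  have hmin : ∀ x, α * (x ⬝ᵥ x) ≤ (Uᵀ *ᵥ x) ⬝ᵥ (Uᵀ *ᵥ x) := by
    intro x
    have := forall_of_forall_unit
      (q := fun x => (Uᵀ *ᵥ x) ⬝ᵥ (Uᵀ *ᵥ x) - α * (x ⬝ᵥ x)) (fun c x => by
        simp only [mulVec_smul, smul_dotProduct, dotProduct_smul, smul_eq_mul]
        ring) (fun w hw => by
        have h2 : α ≤ (Uᵀ *ᵥ w) ⬝ᵥ (Uᵀ *ᵥ w) := hvmin hw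
        rw [hw]
        linarith) x
    linarith
  suffices hge : lam / 8 ≤ α from
    fun x => (mul_le_mul_of_nonneg_right hge (dot_self_nonneg x)).trans (hmin x)
  -- The minimizer is an eigenvector, so `U Uᵀ v = α v`. Approximate balance applied to `Uᵀ v` then
  -- bounds `|V Uᵀ v|²` by `α ^ 2 + lam α / 8`.
  have hX : (U * Uᵀ - α • (1 : Matrix ι ι ℝ)) *ᵥ v = 0 := by
    have e : ∀ w : ι → ℝ, w ⬝ᵥ ((U * Uᵀ - α • (1 : Matrix ι ι ℝ)) *ᵥ w)
        = (Uᵀ *ᵥ w) ⬝ᵥ (Uᵀ *ᵥ w) - α * (w ⬝ᵥ w) := by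
      intro w
      rw [mulVec_dot Uᵀ]
      simp [sub_mulVec, smul_mulVec, dotProduct_sub]
    refine mulVec_eq_zero_of_quadratic (by simp) (fun w => ?_) ?_
    · rw [e]
      linarith [hmin w]
    · rw [e, ← hα, hv]
      ring
  have hUa : U *ᵥ (Uᵀ *ᵥ v) = α • v := by
    rw [sub_mulVec, smul_mulVec, one_mulVec, ← mulVec_mulVec] at hX
    exact sub_eq_zero.1 hX
  have h1 := hbal (Uᵀ *ᵥ v)
  rw [hUa, ← hα, smul_dotProduct, dotProduct_smul, hv, smul_eq_mul, smul_eq_mul, mul_one] at h1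
  have h2 := sq_dot_le v (V *ᵥ (Uᵀ *ᵥ v))
  rw [hv, one_mul] at h2
  have h3 : v ⬝ᵥ (V *ᵥ (Uᵀ *ᵥ v)) = v ⬝ᵥ (D *ᵥ v) - v ⬝ᵥ ((D - U * Vᵀ) *ᵥ v) := by
    have : v ⬝ᵥ (V *ᵥ (Uᵀ *ᵥ v)) = v ⬝ᵥ (U *ᵥ (Vᵀ *ᵥ v)) := by
      rw [dotProduct_comm, mulVec_dot, mulVec_dot, transpose_transpose]
    rw [this, sub_mulVec, dotProduct_sub, ← mulVec_mulVec]
    ring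
  have h4 : |v ⬝ᵥ ((D - U * Vᵀ) *ᵥ v)| ≤ 1 * (lam / 4) := by
    refine abs_dot_le zero_le_one (by positivity) (by rw [hv]; norm_num) ?_
    have := mulVec_dot_self_le (D - U * Vᵀ) v
    rw [hv] at this
    linarith
  have h5 := hlo v
  rw [hv] at h5
  have h6 : 3 / 4 * lam ≤ v ⬝ᵥ (V *ᵥ (Uᵀ *ᵥ v)) := by
    rw [h3]
    linarith [(abs_le.1 h4).2]
  -- The lower bound gives `(3 lam / 4) ^ 2 ≤ α ^ 2 + lam α / 8`, whereas `α < lam / 8` would make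
  -- the right side smaller than `lam ^ 2 / 32`.
  by_contra! hlt
  have hα0 : 0 ≤ α := dot_self_nonneg _
  nlinarith

lemma velA_eq {D : Matrix ι ι ℝ} (hD : Dᵀ = D) (A B : Matrix ι ι ℝ) (J : Matrix μ ι ℝ)
    (K : Matrix ν ι ℝ) :
    (1 / 2 : ℝ) • (((D - (A + B) * (A - B)ᵀ) * (A - B) - (A + B) * (Kᵀ * K))
      + ((D - (A + B) * (A - B)ᵀ)ᵀ * (A + B) - (A - B) * (Jᵀ * J))) = velA D A B J K := by
  simp only [velA, symPart, skewPart, transpose_add, transpose_sub, transpose_mul,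
    transpose_transpose, hD, Matrix.mul_add, Matrix.mul_sub, Matrix.add_mul, Matrix.sub_mul,
    Matrix.mul_assoc]
  module

lemma velB_eq {D : Matrix ι ι ℝ} (hD : Dᵀ = D) (A B : Matrix ι ι ℝ) (J : Matrix μ ι ℝ)
    (K : Matrix ν ι ℝ) :
    (1 / 2 : ℝ) • (((D - (A + B) * (A - B)ᵀ) * (A - B) - (A + B) * (Kᵀ * K))
      - ((D - (A + B) * (A - B)ᵀ)ᵀ * (A + B) - (A - B) * (Jᵀ * J))) = velB D A B J K := by
  simp only [velB, symPart, skewPart, transpose_add, transpose_sub, transpose_mul,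
    transpose_transpose, hD, Matrix.mul_add, Matrix.mul_sub, Matrix.add_mul, Matrix.sub_mul,
    Matrix.mul_assoc]
  module

lemma ip_half_add_le (U V : Matrix ι ι ℝ) :
    ip ((1 / 2 : ℝ) • (U + V)) ((1 / 2 : ℝ) • (U + V)) ≤ ip U U + ip V V := by
  have h := ip_self_nonneg (U - V)
  have h1 := ip_self_nonneg U
  have h2 := ip_self_nonneg V
  simp only [ip_smul_left, ip_smul_right, ip_add_left, ip_add_right, ip_sub_left,
    ip_sub_right] at h ⊢
  linarith [ip_comm U V]

lemma ip_half_sub_le (U V : Matrix ι ι ℝ) :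
    ip ((1 / 2 : ℝ) • (U - V)) ((1 / 2 : ℝ) • (U - V)) ≤ ip U U + ip V V := by
  have h := ip_self_nonneg (U + V)
  have h1 := ip_self_nonneg U
  have h2 := ip_self_nonneg V
  simp only [ip_smul_left, ip_smul_right, ip_add_left, ip_add_right, ip_sub_left,
    ip_sub_right] at h ⊢
  linarith [ip_comm U V]

/-- The difference of the two sides is a quarter of `|a + 4 b|²`. -/
lemma dot_add_self_ge (a b : ι → ℝ) :
    3 / 4 * (a ⬝ᵥ a) - 3 * (b ⬝ᵥ b) ≤ (a + b) ⬝ᵥ (a + b) := by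
  have h := dot_self_nonneg (a + (4 : ℝ) • b)
  simp only [add_dotProduct, dotProduct_add, smul_dotProduct, dotProduct_smul, smul_eq_mul] at h ⊢
  linarith [dotProduct_comm a b]

lemma dot_sub_self_ge (a b : ι → ℝ) :
    3 / 4 * (a ⬝ᵥ a) - 3 * (b ⬝ᵥ b) ≤ (a - b) ⬝ᵥ (a - b) := by
  have h := dot_add_self_ge a (-b)
  simpa [sub_eq_add_neg] using h

/-- Once the logistic phase is over, both factors are well conditioned up to the time horizon. -/
lemma IsBlockFlow.well_conditioned [Nonempty ι] {D : Matrix ι ι ℝ} (hD : Dᵀ = D)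
    {U V : ℝ → Matrix ι ι ℝ} {J : ℝ → Matrix μ ι ℝ} {K : ℝ → Matrix ν ι ℝ}
    (h : IsBlockFlow D U V J K) {lam r N s T : ℝ} (hr : 0 < r) (hN : 0 < N) (hs : 0 < s)
    (hlr : lam ≤ r ^ 2) (hrs : 200 * (r * N ^ 2) ≤ lam * s) (hsN : s ≤ N)
    (hlo : ∀ v, lam * (v ⬝ᵥ v) ≤ v ⬝ᵥ (D *ᵥ v))
    (hhi : ∀ v, v ⬝ᵥ (D *ᵥ v) ≤ r ^ 2 * (v ⬝ᵥ v))
    (hinit : ip (U 0) (U 0) + ip (J 0) (J 0) + (ip (V 0) (V 0) + ip (K 0) (K 0)) ≤ N ^ 2)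
    (hA0 : ∀ v, s ^ 2 * (v ⬝ᵥ v)
      ≤ (((1 / 2 : ℝ) • (U 0 + V 0))ᵀ *ᵥ v) ⬝ᵥ (((1 / 2 : ℝ) • (U 0 + V 0))ᵀ *ᵥ v))
    (hT : 0 < T) (hNT : r * N * T ≤ 1 / 5) {t : ℝ} (ht0 : 0 ≤ t)
    (ht1 : Real.log (lam / s ^ 2) / lam ≤ t) (htT : t ≤ T) :
    (∀ x, lam / 8 * (x ⬝ᵥ x) ≤ ((U t)ᵀ *ᵥ x) ⬝ᵥ ((U t)ᵀ *ᵥ x)) ∧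
      ∀ x, lam / 8 * (x ⬝ᵥ x) ≤ ((V t)ᵀ *ᵥ x) ⬝ᵥ ((V t)ᵀ *ᵥ x) := by
  have hlam : 0 < lam := by
    have : 0 < lam * s := lt_of_lt_of_le (by positivity) hrs
    exact pos_of_mul_pos_left this hs.le
  have hrN : 200 * (r * N) ≤ lam := by
    have h1 : 200 * (r * N) * N ≤ lam * N := by
      have := mul_le_mul_of_nonneg_left hsN hlam.le
      linarith
    exact le_of_mul_le_mul_right h1 hN
  have hNr : 200 * N ≤ r := by
    have h1 : 200 * N * r ≤ r * r := by linarith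
    exact le_of_mul_le_mul_right h1 hr
  have hN2 : N ^ 2 ≤ lam / 1000 := by
    have := mul_le_mul_of_nonneg_right hNr hN.le
    linarith
  have hsl : s ^ 2 ≤ lam := by
    have : s ^ 2 ≤ N ^ 2 := by gcongr
    linarith
  set A : ℝ → Matrix ι ι ℝ := fun t => (1 / 2 : ℝ) • (U t + V t) with hAdef
  set B : ℝ → Matrix ι ι ℝ := fun t => (1 / 2 : ℝ) • (U t - V t) with hBdef
  have hUAB : ∀ t, U t = A t + B t := fun t => by
    simp only [hAdef, hBdef]
    module
  have hVAB : ∀ t, V t = A t - B t := fun t => by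
    simp only [hAdef, hBdef]
    module
  have hA : ∀ t, 0 ≤ t → HasEntryDeriv A (velA D (A t) (B t) (J t) (K t)) t := by
    intro t ht
    have := ((h.deriv_U t ht).add (h.deriv_V t ht)).const_smul (1 / 2)
    rw [hUAB t, hVAB t, velA_eq hD] at this
    exact this
  have hB : ∀ t, 0 ≤ t → HasEntryDeriv B (velB D (A t) (B t) (J t) (K t)) t := by
    intro t ht
    have := ((h.deriv_U t ht).sub (h.deriv_V t ht)).const_smul (1 / 2)
    rw [hUAB t, hVAB t, velB_eq hD] at this
    exact this
  have hU0 := ip_self_nonneg (U 0)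
  have hV0 := ip_self_nonneg (V 0)
  have hJ0 := ip_self_nonneg (J 0)
  have hK0 := ip_self_nonneg (K 0)
  have hJK : ∀ t, 0 ≤ t → ip (J t) (J t) + ip (K t) (K t) ≤ N ^ 2 := fun t ht => by
    linarith [h.ip_J_le ht, h.ip_K_le ht]
  have hsmall := small_difference_of_flow hD hr hN hlr hrN hT hNT hlo hhi hA hB hJK
    ((ip_half_add_le _ _).trans (by linarith)) ((ip_half_sub_le _ _).trans (by linarith))
  have hlog := logistic_le_of_flow (T := T) hD hr hN hNr hrN hs hsl hrs hlo hA hJK hA0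
    (fun t h0 h1 => (hsmall t h0 h1).1) (fun t h0 h1 =>
      mulVec_le_of_transpose_mulVec_le (by positivity)
        (transpose_mulVec_le_of_symPart hr hN hNr hhi (hsmall t h0 h1).1 (hsmall t h0 h1).2))
    t ht0 htT
  -- Now `A Aᵀ ≥ lam / 4`, and `B Bᵀ ≤ 4 N ^ 2 ≤ lam / 250`, so passing to `A ± B` costs less than
  -- half of the bound.
  have hge := logistic_ge_of_exp_le hlam hs ht1
  have hkey : ∀ x, lam / 8 * (x ⬝ᵥ x)
      ≤ 3 / 4 * (((A t)ᵀ *ᵥ x) ⬝ᵥ ((A t)ᵀ *ᵥ x)) - 3 * (((B t)ᵀ *ᵥ x) ⬝ᵥ ((B t)ᵀ *ᵥ x)) := by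
    intro x
    have hx := dot_self_nonneg x
    have h1 := hlog x
    have h2 := transpose_mulVec_dot_self_le (B t) x
    have h3 := mul_le_mul_of_nonneg_right (hsmall t ht0 htT).1 hx
    have h4 := mul_le_mul_of_nonneg_right hge hx
    have h5 := mul_le_mul_of_nonneg_right hN2 hx
    nlinarith
  refine ⟨fun x => ?_, fun x => ?_⟩
  · rw [hUAB t, transpose_add, add_mulVec]
    exact (hkey x).trans (dot_add_self_ge _ _)
  · rw [hVAB t, transpose_sub, sub_mulVec]
    exact (hkey x).trans (dot_sub_self_ge _ _)

/-- Convergence of the flow in block form from a small initialization. -/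
theorem IsBlockFlow.blockLoss_le [Nonempty ι] {D : Matrix ι ι ℝ} (hD : Dᵀ = D)
    {U V : ℝ → Matrix ι ι ℝ} {J : ℝ → Matrix μ ι ℝ} {K : ℝ → Matrix ν ι ℝ}
    (h : IsBlockFlow D U V J K) {lam r N s L T : ℝ} (hr : 0 < r) (hN : 0 < N) (hs : 0 < s)
    (hlr : lam ≤ r ^ 2) (hrs : 200 * (r * N ^ 2) ≤ lam * s) (hsN : s ≤ N)
    (hlo : ∀ v, lam * (v ⬝ᵥ v) ≤ v ⬝ᵥ (D *ᵥ v))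
    (hhi : ∀ v, v ⬝ᵥ (D *ᵥ v) ≤ r ^ 2 * (v ⬝ᵥ v))
    (hinit : ip (U 0) (U 0) + ip (J 0) (J 0) + (ip (V 0) (V 0) + ip (K 0) (K 0)) ≤ N ^ 2)
    (hA0 : ∀ v, s ^ 2 * (v ⬝ᵥ v)
      ≤ (((1 / 2 : ℝ) • (U 0 + V 0))ᵀ *ᵥ v) ⬝ᵥ (((1 / 2 : ℝ) • (U 0 + V 0))ᵀ *ᵥ v))
    (hL : blockLoss D (U 0) (V 0) (J 0) (K 0) ≤ L) (hLlam : lam ^ 2 / 32 ≤ L)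
    (hT : T = Real.log (lam / s ^ 2) / lam + 8 / lam * Real.log (32 * L / lam ^ 2))
    (hNT : r * N * T ≤ 1 / 5) {t : ℝ} (ht : T ≤ t) :
    blockLoss D (U t) (V t) (J t) (K t)
      ≤ lam ^ 2 / 32 * Real.exp (-(lam / 8) * (t - T)) := by
  have hlam : 0 < lam := by
    have : 0 < lam * s := lt_of_lt_of_le (by positivity) hrs
    exact pos_of_mul_pos_left this hs.le
  have hrN : 200 * (r * N) ≤ lam := by
    have h1 : 200 * (r * N) * N ≤ lam * N := by
      have := mul_le_mul_of_nonneg_left hsN hlam.le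
      linarith
    exact le_of_mul_le_mul_right h1 hN
  have hNr : 200 * N ≤ r := by
    have h1 : 200 * N * r ≤ r * r := by linarith
    exact le_of_mul_le_mul_right h1 hr
  have hN2 : N ^ 2 ≤ lam / 1000 := by
    have := mul_le_mul_of_nonneg_right hNr hN.le
    linarith
  have hsl : s ^ 2 < lam := by
    have : s ^ 2 ≤ N ^ 2 := by gcongr
    linarith
  have hL0 : 0 < L := lt_of_lt_of_le (by positivity) hLlam
  set T₁ := Real.log (lam / s ^ 2) / lam with hT₁
  have hT₁pos : 0 < T₁ := by
    refine div_pos (Real.log_pos ?_) hlam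
    rwa [one_lt_div (by positivity)]
  have hone : 1 ≤ 32 * L / lam ^ 2 := by
    rw [one_le_div (by positivity)]
    linarith
  have hlog0 : 0 ≤ Real.log (32 * L / lam ^ 2) := Real.log_nonneg hone
  have hT₁T : T₁ ≤ T := by
    rw [hT]
    have : 0 ≤ 8 / lam * Real.log (32 * L / lam ^ 2) := by positivity
    linarith
  have hTpos : 0 < T := hT₁pos.trans_le hT₁T
  have hU0 := ip_self_nonneg (U 0)
  have hV0 := ip_self_nonneg (V 0)
  have hJ0 := ip_self_nonneg (J 0)
  have hK0 := ip_self_nonneg (K 0)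
  have hJ : ∀ t, 0 ≤ t → ip (J t) (J t) ≤ N ^ 2 := fun t ht => by
    linarith [h.ip_J_le ht]
  have hK : ∀ t, 0 ≤ t → ip (K t) (K t) ≤ N ^ 2 := fun t ht => by
    linarith [h.ip_K_le ht]
  have hPL : ∀ τ, 0 ≤ τ →
      ((∀ x, lam / 8 * (x ⬝ᵥ x) ≤ ((U τ)ᵀ *ᵥ x) ⬝ᵥ ((U τ)ᵀ *ᵥ x)) ∧
        ∀ x, lam / 8 * (x ⬝ᵥ x) ≤ ((V τ)ᵀ *ᵥ x) ⬝ᵥ ((V τ)ᵀ *ᵥ x)) →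
      -blockGradSq D (U τ) (V τ) (J τ) (K τ)
        ≤ -(lam / 8) * blockLoss D (U τ) (V τ) (J τ) (K τ) := by
    intro τ hτ hc
    have := mul_blockLoss_le_blockGradSq (D := D) (by positivity) hc.1 hc.2
      ((hJ τ hτ).trans (by linarith)) ((hK τ hτ).trans (by linarith))
    linarith
  -- From `T₁` on both factors have Gram matrices at least `lam / 8`. The length `T - T₁` is exactly
  -- the time that decay at rate `lam / 8` takes from `L` to `lam ^ 2 / 32`.
  have hstage : blockLoss D (U T) (V T) (J T) (K T) ≤ lam ^ 2 / 32 := by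
    have h1 := le_exp_mul_of_hasDerivWithinAt (c := lam / 8) hT₁pos.le hT₁T
      (fun τ hτ => hasDerivWithinAt_blockLoss h hτ) (fun τ h1 h2 =>
        hPL τ (hT₁pos.le.trans h1) (h.well_conditioned hD hr hN hs hlr hrs hsN hlo hhi hinit hA0
          hTpos hNT (hT₁pos.le.trans h1) h1 h2))
    have h2 := (h.blockLoss_antitone le_rfl hT₁pos.le).trans hL
    have h3 : Real.exp (-(lam / 8) * (T - T₁)) = lam ^ 2 / (32 * L) := by
      have : -(lam / 8) * (T - T₁) = -Real.log (32 * L / lam ^ 2) := by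
        rw [hT]
        field_simp
        ring
      rw [this, Real.exp_neg, Real.exp_log (by positivity), inv_div]
    rw [h3] at h1
    refine h1.trans ?_
    calc _ ≤ L * (lam ^ 2 / (32 * L)) := by gcongr
      _ = lam ^ 2 / 32 := by field_simp
  have hbal : ∀ τ, 0 ≤ τ → ∀ z,
      |(U τ *ᵥ z) ⬝ᵥ (U τ *ᵥ z) - (V τ *ᵥ z) ⬝ᵥ (V τ *ᵥ z)| ≤ lam / 8 * (z ⬝ᵥ z) := by
    intro τ hτ z
    have hz := dot_self_nonneg z
    have b0 := h.balance z hτ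
    have p1 := mulVec_dot_self_le (U 0) z
    have p2 := mulVec_dot_self_le (V 0) z
    have p3 := mulVec_dot_self_le (J 0) z
    have p4 := mulVec_dot_self_le (K 0) z
    have p5 := (mulVec_dot_self_le (J τ) z).trans (mul_le_mul_of_nonneg_right (hJ τ hτ) hz)
    have p6 := (mulVec_dot_self_le (K τ) z).trans (mul_le_mul_of_nonneg_right (hK τ hτ) hz)
    have p7 := mul_le_mul_of_nonneg_right hinit hz
    have p8 := mul_le_mul_of_nonneg_right hN2 hz
    have q1 := dot_self_nonneg (U 0 *ᵥ z)
    have q2 := dot_self_nonneg (V 0 *ᵥ z)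
    have q3 := dot_self_nonneg (J 0 *ᵥ z)
    have q4 := dot_self_nonneg (K 0 *ᵥ z)
    have q5 := dot_self_nonneg (J τ *ᵥ z)
    have q6 := dot_self_nonneg (K τ *ᵥ z)
    rw [abs_le]
    constructor <;> linarith
  -- Beyond `T` nothing is known about `B`. Monotonicity of the loss keeps the residual norm below
  -- `lam / 4`, and with the balance `hbal` this restores the Polyak–Łojasiewicz inequality for all
  -- later times.
  have hfinal := le_exp_mul_of_hasDerivWithinAt (c := lam / 8) hTpos.le ht
      (fun τ hτ => hasDerivWithinAt_blockLoss h hτ) (fun τ h1 h2 => by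
        have hτ : 0 ≤ τ := hTpos.le.trans h1
        have hf := (h.blockLoss_antitone hTpos.le h1).trans hstage
        have hR : ip (D - U τ * (V τ)ᵀ) (D - U τ * (V τ)ᵀ) ≤ (lam / 4) ^ 2 := by
          unfold blockLoss at hf
          have g1 := ip_self_nonneg (U τ * (K τ)ᵀ)
          have g2 := ip_self_nonneg (J τ * (V τ)ᵀ)
          have g3 := ip_self_nonneg (J τ * (K τ)ᵀ)
          linarith
        refine hPL τ hτ ⟨?_, ?_⟩
        · exact le_transpose_mulVec_of_residual hlam hlo hR fun z => by
            linarith [(abs_le.1 (hbal τ hτ z)).1]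
        · refine le_transpose_mulVec_of_residual (V := U τ) hlam hlo ?_ fun z => by
            linarith [(abs_le.1 (hbal τ hτ z)).2]
          have e : D - V τ * (U τ)ᵀ = (D - U τ * (V τ)ᵀ)ᵀ := by
            simp [hD]
          rw [e, ip_transpose]
          exact hR)
  refine hfinal.trans ?_
  gcongr

end Block

/-! ### Thin singular value decomposition -/

section SVD

lemma finrank_range_toEuclideanLin {m n : ℕ} (S : Matrix (Fin m) (Fin n) ℝ) :
    Module.finrank ℝ (LinearMap.range (Matrix.toEuclideanLin S)) = S.rank := by
  exact (Matrix.rank_eq_finrank_range_toLin S (PiLp.basisFun 2 ℝ _) (PiLp.basisFun 2 ℝ _)).symm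

lemma sigma_pos {m n d : ℕ} {S : Matrix (Fin m) (Fin n) ℝ} (hd : 0 < d) (hS : S.rank = d) :
    0 < sigma S d := by
  unfold sigma
  rw [LinearMap.singularValues_pos_iff_lt_finrank_range, finrank_range_toEuclideanLin, hS]
  omega

lemma sigma_le_sigma_one {m n : ℕ} (S : Matrix (Fin m) (Fin n) ℝ) (d : ℕ) :
    sigma S d ≤ sigma S 1 :=
  LinearMap.singularValues_antitone _ (by omega)

/-- The thin singular value decomposition. -/
theorem exists_thin_svd {m n d : ℕ} {S : Matrix (Fin m) (Fin n) ℝ} (hS : S.rank = d) :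
    ∃ (Φ : Matrix (Fin m) (Fin d) ℝ) (Ψ : Matrix (Fin n) (Fin d) ℝ) (σ : Fin d → ℝ),
      Φᵀ * Φ = 1 ∧ Ψᵀ * Ψ = 1 ∧ S = Φ * Matrix.diagonal σ * Ψᵀ ∧
        ∀ i, sigma S d ≤ σ i ∧ σ i ≤ sigma S 1 := by
  have hdn : d ≤ n := by
    rw [← hS]
    exact Matrix.rank_le_width S
  obtain ⟨k, rfl⟩ := Nat.exists_eq_add_of_le hdn
  set T := Matrix.toEuclideanLin S with hT
  have hn : Module.finrank ℝ (EuclideanSpace ℝ (Fin (d + k))) = d + k := by simp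
  set b := T.isSymmetric_adjoint_comp_self.eigenvectorBasis hn with hb
  set c : Fin (d + k) → Fin (d + k) → ℝ := fun j => WithLp.ofLp (b j) with hc
  set τ : Fin (d + k) → ℝ := fun j => T.singularValues j with hτ
  have hinner : ∀ {l : ℕ} (x y : EuclideanSpace ℝ (Fin l)),
      inner ℝ x y = WithLp.ofLp x ⬝ᵥ WithLp.ofLp y := by
    intro l x y
    rw [EuclideanSpace.inner_eq_star_dotProduct, dotProduct_comm]
    simp
  have horth : ∀ i j, c i ⬝ᵥ c j = if i = j then 1 else 0 := by
    intro i j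
    rw [← hinner]
    exact orthonormal_iff_ite.1 b.orthonormal i j
  have hgram : ∀ i j, (S *ᵥ c i) ⬝ᵥ (S *ᵥ c j) = if i = j then τ j ^ 2 else 0 := by
    intro i j
    have h1 : inner ℝ (T (b i)) (T (b j)) = (S *ᵥ c i) ⬝ᵥ (S *ᵥ c j) := by
      rw [hinner, hT, Matrix.ofLp_toLpLin, Matrix.ofLp_toLpLin, Matrix.toLin'_apply,
        Matrix.toLin'_apply]
    have h2 := T.isSymmetric_adjoint_comp_self.apply_eigenvectorBasis hn j
    rw [← h1, ← LinearMap.adjoint_inner_right]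
    rw [LinearMap.comp_apply] at h2
    rw [h2, inner_smul_right, orthonormal_iff_ite.1 b.orthonormal i j, hτ]
    simp only
    rw [T.sq_singularValues_fin hn j]
    split_ifs <;> simp
  have hτpos : ∀ j : Fin d, 0 < τ (Fin.castAdd k j) := by
    intro j
    simp only [hτ]
    rw [LinearMap.singularValues_pos_iff_lt_finrank_range, finrank_range_toEuclideanLin, hS]
    exact j.2
  have hτzero : ∀ j : Fin k, S *ᵥ c (Fin.natAdd d j) = 0 := by
    intro j
    have h1 := hgram (Fin.natAdd d j) (Fin.natAdd d j)
    have h2 : τ (Fin.natAdd d j) = 0 := by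
      simp only [hτ]
      by_contra hne
      have h3 := (LinearMap.singularValues_pos_iff_ne_zero _ _).2 hne
      rw [LinearMap.singularValues_pos_iff_lt_finrank_range, finrank_range_toEuclideanLin, hS] at h3
      simp at h3
    rw [if_pos rfl, h2] at h1
    exact dotProduct_self_eq_zero.1 (by simpa using h1)
  set Q : Matrix (Fin (d + k)) (Fin (d + k)) ℝ := Matrix.of fun i j => c j i with hQ
  have hQQ : Qᵀ * Q = 1 := by
    ext i j
    rw [Matrix.mul_apply, Matrix.one_apply, ← horth i j]
    rfl
  have hQQ' : Q * Qᵀ = 1 := mul_eq_one_comm.1 hQQ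
  have hSQ : ∀ a j, (S * Q) a j = (S *ᵥ c j) a := fun a j => rfl
  -- The right singular vectors are eigenvectors of `Sᵀ S`, and the left ones are their normalized
  -- images. Division is possible since the first `d` singular values are positive; the remaining
  -- directions are killed by `S`.
  refine ⟨Matrix.of fun a j => (τ (Fin.castAdd k j))⁻¹ * (S *ᵥ c (Fin.castAdd k j)) a,
    Matrix.of fun b j => c (Fin.castAdd k j) b, fun j => τ (Fin.castAdd k j), ?_, ?_, ?_, ?_⟩
  · ext i j
    have h1 : (∑ a, (τ (Fin.castAdd k i))⁻¹ * (S *ᵥ c (Fin.castAdd k i)) a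
        * ((τ (Fin.castAdd k j))⁻¹ * (S *ᵥ c (Fin.castAdd k j)) a))
        = (τ (Fin.castAdd k i))⁻¹ * (τ (Fin.castAdd k j))⁻¹
          * ((S *ᵥ c (Fin.castAdd k i)) ⬝ᵥ (S *ᵥ c (Fin.castAdd k j))) := by
      rw [dotProduct, Finset.mul_sum]
      exact Finset.sum_congr rfl fun a _ => by ring
    rw [Matrix.mul_apply, Matrix.one_apply]
    simp only [Matrix.transpose_apply, Matrix.of_apply]
    rw [h1, hgram]
    have hp := (hτpos j).ne'
    by_cases hij : i = j
    · subst hij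
      simp only [if_true]
      field_simp
    · have : Fin.castAdd k i ≠ Fin.castAdd k j := fun h => hij (Fin.castAdd_injective _ _ h)
      simp [hij, this]
  · ext i j
    have := horth (Fin.castAdd k i) (Fin.castAdd k j)
    rw [Matrix.mul_apply, Matrix.one_apply]
    simp only [Matrix.transpose_apply, Matrix.of_apply]
    refine this.trans ?_
    simp [Fin.ext_iff]
  · have h1 : S = (S * Q) * Qᵀ := by
      rw [Matrix.mul_assoc, hQQ', Matrix.mul_one]
    ext a b'
    conv_lhs => rw [h1]
    rw [Matrix.mul_apply, Matrix.mul_apply, Fin.sum_univ_add]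
    have h2 : ∀ j : Fin k, (S * Q) a (Fin.natAdd d j) * Qᵀ (Fin.natAdd d j) b' = 0 := by
      intro j
      rw [hSQ, hτzero]
      simp
    rw [Finset.sum_congr rfl fun j _ => h2 j, Finset.sum_const_zero, add_zero]
    refine Finset.sum_congr rfl fun j _ => ?_
    have hp := (hτpos j).ne'
    rw [hSQ, Matrix.mul_diagonal]
    simp only [Matrix.transpose_apply, Matrix.of_apply, hQ]
    field_simp
  · intro j
    -- `sigma S d` has index `d - 1` and `sigma S 1` has index `0`, which enclose every `j < d`.
    refine ⟨LinearMap.singularValues_antitone _ ?_, LinearMap.singularValues_antitone _ ?_⟩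
    · have := j.2
      simp
      omega
    · omega

end SVD

/-! ### Passing from the flow to its block form -/

section Reduction

variable {m n d : ℕ}

lemma ip_of_orthonormal {α β γ : Type*} [Fintype α] [Fintype β] [Fintype γ] [DecidableEq β]
    {Φ : Matrix α β ℝ} (hΦ : Φᵀ * Φ = 1) (X Y : Matrix β γ ℝ) : ip (Φ * X) (Φ * Y) = ip X Y := by
  rw [ip_mul_left_left, ← Matrix.mul_assoc, hΦ, Matrix.one_mul]

/-- The gradient flow in the singular bases. -/
lemma IsGradientFlow.isBlockFlow {Φ : Matrix (Fin m) (Fin d) ℝ} {Ψ : Matrix (Fin n) (Fin d) ℝ}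
    {D : Matrix (Fin d) (Fin d) ℝ} (hΦ : Φᵀ * Φ = 1) (hΨ : Ψᵀ * Ψ = 1)
    {U₀ : Matrix (Fin m) (Fin d) ℝ} {V₀ : Matrix (Fin n) (Fin d) ℝ}
    {U : ℝ → Matrix (Fin m) (Fin d) ℝ} {V : ℝ → Matrix (Fin n) (Fin d) ℝ}
    (h : IsGradientFlow (Φ * D * Ψᵀ) U₀ V₀ U V) :
    IsBlockFlow D (fun t => Φᵀ * U t) (fun t => Ψᵀ * V t) (fun t => U t - Φ * (Φᵀ * U t))
      (fun t => V t - Ψ * (Ψᵀ * V t)) := by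
  have hU : ∀ t, 0 ≤ t →
      HasEntryDeriv U (((Φ * D * Ψᵀ) - U t * (V t)ᵀ) * V t) t := fun t ht => h.deriv_U t ht
  have hV : ∀ t, 0 ≤ t →
      HasEntryDeriv V (((Φ * D * Ψᵀ) - U t * (V t)ᵀ)ᵀ * U t) t := fun t ht => h.deriv_V t ht
  have hΦ' : ∀ {γ : Type} (X : Matrix (Fin d) γ ℝ), Φᵀ * (Φ * X) = X := fun X => by
    rw [← Matrix.mul_assoc, hΦ, Matrix.one_mul]
  have hΨ' : ∀ {γ : Type} (X : Matrix (Fin d) γ ℝ), Ψᵀ * (Ψ * X) = X := fun X => by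
    rw [← Matrix.mul_assoc, hΨ, Matrix.one_mul]
  have hl : ∀ {a : ℕ} (Θ : Matrix (Fin d) (Fin a) ℝ) {X : ℝ → Matrix (Fin a) (Fin d) ℝ}
      {X' : Matrix (Fin a) (Fin d) ℝ} {t : ℝ}, HasEntryDeriv X X' t →
      HasEntryDeriv (fun τ => Θ * X τ) (Θ * X') t := by
    intro a Θ X X' t hX
    have := (HasEntryDeriv.const Θ).mul hX
    simpa using this
  have hl' : ∀ {a : ℕ} (Θ : Matrix (Fin a) (Fin d) ℝ) {X : ℝ → Matrix (Fin d) (Fin d) ℝ}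
      {X' : Matrix (Fin d) (Fin d) ℝ} {t : ℝ}, HasEntryDeriv X X' t →
      HasEntryDeriv (fun τ => Θ * X τ) (Θ * X') t := by
    intro a Θ X X' t hX
    have := (HasEntryDeriv.const Θ).mul hX
    simpa using this
  refine ⟨fun t ht => ?_, fun t ht => ?_, fun t ht => ?_, fun t ht => ?_⟩
  · convert hl Φᵀ (hU t ht) using 1
    simp only [Matrix.mul_sub, Matrix.sub_mul, Matrix.mul_assoc, transpose_sub, transpose_mul,
      transpose_transpose, hΦ', hΨ']
    abel
  · convert hl Ψᵀ (hV t ht) using 1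
    simp only [Matrix.mul_sub, Matrix.sub_mul, Matrix.mul_assoc, transpose_sub, transpose_mul,
      transpose_transpose, hΦ', hΨ']
    abel
  · convert (hU t ht).sub (hl' Φ (hl Φᵀ (hU t ht))) using 1
    simp only [Matrix.mul_sub, Matrix.sub_mul, Matrix.mul_assoc, transpose_sub, transpose_mul,
      transpose_transpose, hΦ', hΨ', Matrix.mul_add]
    abel
  · convert (hV t ht).sub (hl' Ψ (hl Ψᵀ (hV t ht))) using 1
    simp only [Matrix.mul_sub, Matrix.sub_mul, Matrix.mul_assoc, transpose_sub, transpose_mul,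
      transpose_transpose, hΦ', hΨ', Matrix.mul_add]
    abel

end Reduction

/-! ### Global existence of the gradient flow -/

section Existence

variable {ι : Type*} [Fintype ι]

/-- Coordinatewise truncation to `[-ρ, ρ]`. -/
def clamp (ρ : ℝ) (x : ι → ℝ) : ι → ℝ := fun i => max (-ρ) (min ρ (x i))

lemma lipschitzWith_clamp (ρ : ℝ) : LipschitzWith 1 (clamp ρ : (ι → ℝ) → ι → ℝ) := by
  refine LipschitzWith.of_dist_le_mul fun x y => ?_
  rw [NNReal.coe_one, one_mul, dist_pi_le_iff dist_nonneg]
  intro i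
  refine le_trans ?_ (dist_le_pi_dist x y i)
  have h : LipschitzWith 1 fun z : ℝ => max (-ρ) (min ρ z) :=
    (LipschitzWith.id.const_min ρ).const_max (-ρ)
  simpa [clamp] using h.dist_le_mul (x i) (y i)

lemma clamp_mem {ρ : ℝ} (hρ : 0 ≤ ρ) (x : ι → ℝ) : clamp ρ x ∈ Metric.closedBall (0 : ι → ℝ) ρ := by
  rw [mem_closedBall_zero_iff, pi_norm_le_iff_of_nonneg hρ]
  intro i
  rw [Real.norm_eq_abs, abs_le]
  exact ⟨le_max_left _ _, max_le (by linarith) (min_le_left _ _)⟩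

lemma clamp_eq_self {ρ : ℝ} (hρ : 0 ≤ ρ) {x : ι → ℝ} (h : x ⬝ᵥ x ≤ ρ ^ 2) : clamp ρ x = x := by
  ext i
  have h1 : x i * x i ≤ x ⬝ᵥ x :=
    Finset.single_le_sum (f := fun i => x i * x i) (fun j _ => mul_self_nonneg (x j))
      (Finset.mem_univ i)
  have h2 := abs_le.1 (abs_le_of_sq_le_sq (by nlinarith : x i ^ 2 ≤ ρ ^ 2) hρ)
  simp only [clamp]
  rw [min_eq_right h2.2, max_eq_right h2.1]

lemma exists_lipschitzOnWith_closedBall {F : (ι → ℝ) → ι → ℝ} (hF : ContDiff ℝ 1 F) (ρ : ℝ) :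
    ∃ C, LipschitzOnWith C F (Metric.closedBall 0 ρ) := by
  have hcomp : IsCompact (Metric.closedBall (0 : ι → ℝ) ρ) := isCompact_closedBall 0 ρ
  obtain ⟨C, hC⟩ := hcomp.exists_bound_of_continuousOn
    (hF.continuous_fderiv one_ne_zero).continuousOn
  refine ⟨C.toNNReal, (convex_closedBall 0 ρ).lipschitzOnWith_of_nnnorm_fderiv_le
    (fun x _ => (hF.differentiable one_ne_zero).differentiableAt) fun x hx => ?_⟩
  rw [← NNReal.coe_le_coe, coe_nnnorm]
  exact (hC x hx).trans (Real.le_coe_toNNReal C)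

lemma hasDerivWithinAt_dot_self {α : ℝ → ι → ℝ} {α' : ι → ℝ} {s : Set ℝ} {t : ℝ}
    (h : HasDerivWithinAt α α' s t) :
    HasDerivWithinAt (fun τ => α τ ⬝ᵥ α τ) (2 * (α t ⬝ᵥ α')) s t := by
  have h' := hasDerivWithinAt_pi.1 h
  have : 2 * (α t ⬝ᵥ α') = ∑ i, (α' i * α t i + α t i * α' i) := by
    rw [dotProduct, Finset.mul_sum]
    exact Finset.sum_congr rfl fun i _ => by ring
  rw [this]
  exact HasDerivWithinAt.fun_sum fun i _ => (h' i).mul (h' i)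

/-- Solutions up to a given time for a vector field along which the squared length grows at most
linearly. -/
lemma exists_solution_Icc {F : (ι → ℝ) → ι → ℝ} (hF : ContDiff ℝ 1 F) {c : ℝ} (hc : 0 ≤ c)
    (hgrow : ∀ x, x ⬝ᵥ F x ≤ c) (x₀ : ι → ℝ) {T : ℝ} (hT : 0 ≤ T) :
    ∃ α : ℝ → ι → ℝ, α 0 = x₀ ∧
      ∀ t, 0 ≤ t → t ≤ T → HasDerivWithinAt α (F (α t)) (Ici 0) t := by
  have hx₀ := dot_self_nonneg x₀
  set b : ℝ := x₀ ⬝ᵥ x₀ + 1 + (2 * c + 1) * T with hb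
  have hb0 : 0 ≤ b := by positivity
  set ρ := Real.sqrt b with hρ
  have hρ0 : 0 ≤ ρ := Real.sqrt_nonneg _
  have hρ2 : ρ ^ 2 = b := Real.sq_sqrt hb0
  obtain ⟨C, hC⟩ := exists_lipschitzOnWith_closedBall hF ρ
  obtain ⟨L, hL⟩ := (isCompact_closedBall (0 : ι → ℝ) ρ).exists_bound_of_continuousOn
    hF.continuous.continuousOn
  -- Truncating the argument makes the field globally Lipschitz and bounded, so Picard–Lindelöf
  -- applies on the whole interval. The interval ends at `T + 1` so that derivatives at time `T` are
  -- still taken within `[0, ∞)`.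
  have hlip : LipschitzWith C (fun x => F (clamp ρ x)) := by
    have := hC.comp (lipschitzWith_clamp (ι := ι) ρ |>.lipschitzOnWith (s := univ))
      (fun x _ => clamp_mem hρ0 x)
    simpa [Function.comp_def] using lipschitzOnWith_univ.1 this
  have hL0 : 0 ≤ L := (norm_nonneg _).trans (hL 0 (Metric.mem_closedBall_self hρ0))
  have hpl : IsPicardLindelof (fun _ x => F (clamp ρ x)) (tmin := 0) (tmax := T + 1)
      ⟨0, by constructor <;> linarith⟩ x₀ (L * (T + 1)).toNNReal 0 L.toNNReal C := by
    refine IsPicardLindelof.of_time_independent ?_ hlip.lipschitzOnWith ?_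
    · intro x _
      exact (hL _ (clamp_mem hρ0 x)).trans (Real.le_coe_toNNReal L)
    · rw [Real.coe_toNNReal _ hL0, Real.coe_toNNReal _ (by positivity)]
      simp only [sub_zero, sub_self, NNReal.coe_zero]
      rw [max_eq_left (by linarith)]
  obtain ⟨α, hα0, hα⟩ := hpl.exists_eq_forall_mem_Icc_hasDerivWithinAt₀
  replace hα0 : α 0 = x₀ := hα0
  have hder : ∀ t, 0 ≤ t → t ≤ T → HasDerivWithinAt α (F (clamp ρ (α t))) (Ici 0) t := by
    intro t h0 h1
    refine (hα t ⟨h0, by linarith⟩).mono_of_mem_nhdsWithin ?_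
    rw [← Ici_inter_Iic]
    exact inter_mem self_mem_nhdsWithin (mem_nhdsWithin_of_mem_nhds (Iic_mem_nhds (by linarith)))
  -- The barrier shows that the truncation is never active. The extra `1` in the value and in the
  -- slope provides strictness at time `0` and at a touching time.
  have key := forall_pos_of_barrier (isCompact_univ (X := Unit)) (T := T)
    (φ := fun (_ : Unit) t _ => x₀ ⬝ᵥ x₀ + 1 + (2 * c + 1) * t - α t ⬝ᵥ α t) ?_ ?_ ?_
  · refine ⟨α, hα0, fun t h0 h1 => ?_⟩
    have h2 := key t h0 h1 () () trivial
    have h3 := hder t h0 h1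
    rwa [clamp_eq_self hρ0 (by
      rw [hρ2, hb]
      nlinarith)] at h3
  · intro _
    refine ContinuousOn.sub (by fun_prop) ?_
    have : ContinuousOn (fun t => α t ⬝ᵥ α t) (Icc 0 T) := fun t ht =>
      ((hasDerivWithinAt_dot_self (hder t ht.1 ht.2)).continuousWithinAt).mono Icc_subset_Ici_self
    exact this.comp continuousOn_fst fun p hp => hp.1
  · intro _ _ _
    simp [hα0]
  · intro t h0 h1 _ _ _ _ hz
    have hz' : α t ⬝ᵥ α t = x₀ ⬝ᵥ x₀ + 1 + (2 * c + 1) * t := by linarith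
    have h3 := hder t h0 h1
    rw [clamp_eq_self hρ0 (by
      rw [hρ2, hb, hz']
      gcongr)] at h3
    refine ⟨(2 * c + 1) - 2 * (α t ⬝ᵥ F (α t)), by linarith [hgrow (α t)], ?_⟩
    have d1 : HasDerivAt (fun τ : ℝ => x₀ ⬝ᵥ x₀ + 1 + (2 * c + 1) * τ) (2 * c + 1) t := by
      simpa using ((hasDerivAt_id t).const_mul (2 * c + 1)).const_add (x₀ ⬝ᵥ x₀ + 1)
    exact d1.hasDerivWithinAt.sub (hasDerivWithinAt_dot_self h3)

/-- On a compact time interval both curves stay in a common ball, where the field is Lipschitz. This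
uniqueness makes the solutions on `[0, n]` fit together. -/
lemma eqOn_of_solutions {F : (ι → ℝ) → ι → ℝ} (hF : ContDiff ℝ 1 F) {α β : ℝ → ι → ℝ} {T : ℝ}
    (h0 : α 0 = β 0) (hα : ∀ t, 0 ≤ t → t ≤ T → HasDerivWithinAt α (F (α t)) (Ici 0) t)
    (hβ : ∀ t, 0 ≤ t → t ≤ T → HasDerivWithinAt β (F (β t)) (Ici 0) t) :
    EqOn α β (Icc 0 T) := by
  have cα : ContinuousOn α (Icc 0 T) := fun t ht =>
    (hα t ht.1 ht.2).continuousWithinAt.mono Icc_subset_Ici_self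
  have cβ : ContinuousOn β (Icc 0 T) := fun t ht =>
    (hβ t ht.1 ht.2).continuousWithinAt.mono Icc_subset_Ici_self
  obtain ⟨M₁, hM₁⟩ := isCompact_Icc.exists_bound_of_continuousOn cα
  obtain ⟨M₂, hM₂⟩ := isCompact_Icc.exists_bound_of_continuousOn cβ
  obtain ⟨C, hC⟩ := exists_lipschitzOnWith_closedBall hF (max M₁ M₂)
  refine ODE_solution_unique_of_mem_Icc_right (v := fun _ => F) (K := C)
    (s := fun _ => Metric.closedBall 0 (max M₁ M₂)) (fun _ _ => hC) cα ?_ ?_ cβ ?_ ?_ h0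
  · exact fun t ht => (hα t ht.1 ht.2.le).mono (Ici_subset_Ici.2 ht.1)
  · exact fun t ht => mem_closedBall_zero_iff.2
      ((hM₁ t ⟨ht.1, ht.2.le⟩).trans (le_max_left _ _))
  · exact fun t ht => (hβ t ht.1 ht.2.le).mono (Ici_subset_Ici.2 ht.1)
  · exact fun t ht => mem_closedBall_zero_iff.2
      ((hM₂ t ⟨ht.1, ht.2.le⟩).trans (le_max_right _ _))

/-- Global forward existence for a vector field along which the squared length grows at most
linearly. -/
theorem exists_solution_Ici {F : (ι → ℝ) → ι → ℝ} (hF : ContDiff ℝ 1 F) {c : ℝ} (hc : 0 ≤ c)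
    (hgrow : ∀ x, x ⬝ᵥ F x ≤ c) (x₀ : ι → ℝ) :
    ∃ α : ℝ → ι → ℝ, α 0 = x₀ ∧ ∀ t, 0 ≤ t → HasDerivWithinAt α (F (α t)) (Ici 0) t := by
  choose β hβ0 hβ using fun n : ℕ =>
    exists_solution_Icc hF hc hgrow x₀ (T := n) (Nat.cast_nonneg n)
  have hagree : ∀ n k : ℕ, ∀ t : ℝ, 0 ≤ t → t ≤ n → t ≤ k → β n t = β k t := by
    intro n k t h0 h1 h2
    exact eqOn_of_solutions hF (T := t) (by rw [hβ0, hβ0])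
      (fun s hs hst => hβ n s hs (hst.trans h1)) (fun s hs hst => hβ k s hs (hst.trans h2))
      ⟨h0, le_rfl⟩
  have hceil : ∀ {t : ℝ} {k : ℕ}, 0 ≤ t → t ≤ k → β ⌈t⌉₊ t = β k t := fun h0 h1 =>
    hagree _ _ _ h0 (Nat.le_ceil _) h1
  refine ⟨fun t => β ⌈t⌉₊ t, by simp [hβ0], fun t ht => ?_⟩
  set k := ⌈t⌉₊ + 1 with hk
  have htk : t < k := by
    rw [hk]
    push_cast
    linarith [Nat.le_ceil t]
  have h1 := hβ k t ht htk.le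
  simp only
  rw [hceil ht htk.le]
  refine h1.congr_of_eventuallyEq ?_ (hceil ht htk.le)
  filter_upwards [self_mem_nhdsWithin, mem_nhdsWithin_of_mem_nhds (Iic_mem_nhds htk)] with s hs hs'
  exact hceil hs hs'

end Existence

/-- The gradient flow exists for all times. -/
theorem exists_isGradientFlow {m n d : ℕ} (S : Matrix (Fin m) (Fin n) ℝ)
    (U₀ : Matrix (Fin m) (Fin d) ℝ) (V₀ : Matrix (Fin n) (Fin d) ℝ) :
    ∃ U V, IsGradientFlow S U₀ V₀ U V := by
  set left : ((Fin m × Fin d) ⊕ (Fin n × Fin d) → ℝ) → Matrix (Fin m) (Fin d) ℝ :=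
    fun x => Matrix.of fun i k => x (Sum.inl (i, k)) with hleft
  set right : ((Fin m × Fin d) ⊕ (Fin n × Fin d) → ℝ) → Matrix (Fin n) (Fin d) ℝ :=
    fun x => Matrix.of fun j k => x (Sum.inr (j, k)) with hright
  set F : ((Fin m × Fin d) ⊕ (Fin n × Fin d) → ℝ) → (Fin m × Fin d) ⊕ (Fin n × Fin d) → ℝ :=
    fun x => Sum.elim (fun p => ((S - left x * (right x)ᵀ) * right x) p.1 p.2)
      (fun p => ((S - left x * (right x)ᵀ)ᵀ * left x) p.1 p.2) with hF
  have hsmooth : ContDiff ℝ 1 F := by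
    rw [contDiff_pi]
    rintro (⟨i, k⟩ | ⟨j, k⟩)
    · simp only [hF, hleft, hright, Sum.elim_inl, Matrix.mul_apply, Matrix.sub_apply,
        Matrix.transpose_apply, Matrix.of_apply]
      fun_prop
    · simp only [hF, hleft, hright, Sum.elim_inr, Matrix.mul_apply, Matrix.sub_apply,
        Matrix.transpose_apply, Matrix.of_apply]
      fun_prop
  -- With `W = U Vᵀ` the left side is `2 ⟨W, S - W⟩`, and expanding `|S - 2 W|² ≥ 0` bounds it.
  -- Hence the cubic field cannot blow up in finite forward time.
  have hgrow : ∀ x, x ⬝ᵥ F x ≤ (1 / 2) * ip S S := by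
    intro x
    have h1 : x ⬝ᵥ F x = ip (left x) ((S - left x * (right x)ᵀ) * right x)
        + ip (right x) ((S - left x * (right x)ᵀ)ᵀ * left x) := by
      simp only [dotProduct, Fintype.sum_sum_type, Fintype.sum_prod_type, hF, ip, Sum.elim_inl,
        Sum.elim_inr, hleft, hright, Matrix.of_apply]
    set W := left x * (right x)ᵀ with hW
    have h2 : ip (left x) ((S - W) * right x) = ip W (S - W) := by
      rw [ip_comm, ip_mul_left_right, ip_comm]
    have h3 : ip (right x) ((S - W)ᵀ * left x) = ip W (S - W) := by
      rw [ip_comm, ip_mul_left_right, ← ip_transpose, transpose_transpose, ip_comm]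
      simp [hW]
    have h4 := ip_self_nonneg (S - (2 : ℝ) • W)
    rw [h1, h2, h3]
    simp only [ip_sub_left, ip_sub_right, ip_smul_left, ip_smul_right] at h4 ⊢
    linarith [ip_comm S W]
  obtain ⟨α, hα0, hα⟩ := exists_solution_Ici hsmooth
    (mul_nonneg (by norm_num) (ip_self_nonneg S)) hgrow
    (Sum.elim (fun p => U₀ p.1 p.2) (fun p => V₀ p.1 p.2))
  refine ⟨fun t => left (α t), fun t => right (α t), ?_, ?_, ?_, ?_⟩
  · ext i k
    simp [hleft, hα0]
  · ext j k
    simp [hright, hα0]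
  · intro t ht i k
    exact hasDerivWithinAt_pi.1 (hα t ht) (Sum.inl (i, k))
  · intro t ht j k
    exact hasDerivWithinAt_pi.1 (hα t ht) (Sum.inr (j, k))

/-! ### The objective in block form and the deterministic convergence theorem -/

section Reduction

variable {m n d : ℕ}

lemma ip_eq_add_of_orthonormal {α β γ : Type*} [Fintype α] [Fintype β] [Fintype γ] [DecidableEq β]
    {Φ : Matrix α β ℝ} (hΦ : Φᵀ * Φ = 1) (X : Matrix α γ ℝ) :
    ip X X = ip (Φᵀ * X) (Φᵀ * X) + ip (X - Φ * (Φᵀ * X)) (X - Φ * (Φᵀ * X)) := by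
  have h1 : ip X (Φ * (Φᵀ * X)) = ip (Φᵀ * X) (Φᵀ * X) := by
    rw [ip_comm, ip_mul_left_left]
  have h2 := ip_of_orthonormal hΦ (Φᵀ * X) (Φᵀ * X)
  simp only [ip_sub_left, ip_sub_right]
  rw [ip_comm (Φ * (Φᵀ * X)) X, h1, h2]
  ring

lemma ip_eq_add_of_orthonormal_right {α β γ : Type*} [Fintype α] [Fintype β] [Fintype γ]
    [DecidableEq β] {Ψ : Matrix γ β ℝ} (hΨ : Ψᵀ * Ψ = 1) (X : Matrix α γ ℝ) :
    ip X X = ip (X * Ψ) (X * Ψ) + ip (X - (X * Ψ) * Ψᵀ) (X - (X * Ψ) * Ψᵀ) := by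
  have h := ip_eq_add_of_orthonormal hΨ Xᵀ
  rw [ip_transpose] at h
  rw [h, ← ip_transpose (X * Ψ), ← ip_transpose (X - (X * Ψ) * Ψᵀ)]
  simp [transpose_mul]

lemma objective_eq_half_ip (S : Matrix (Fin m) (Fin n) ℝ)
    (U : Matrix (Fin m) (Fin d) ℝ) (V : Matrix (Fin n) (Fin d) ℝ) :
    objective S U V = (1 / 2) * ip (S - U * Vᵀ) (S - U * Vᵀ) := by
  unfold objective ip
  congr 1
  refine Finset.sum_congr rfl fun i _ => Finset.sum_congr rfl fun j _ => ?_
  simp only [Matrix.sub_apply]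
  ring

/-- Pythagoras on both sides: splitting the residual along and across the frames `Φ` and `Ψ` gives
the four blocks, up to sign. -/
lemma objective_eq_blockLoss {Φ : Matrix (Fin m) (Fin d) ℝ} {Ψ : Matrix (Fin n) (Fin d) ℝ}
    {D : Matrix (Fin d) (Fin d) ℝ} (hΦ : Φᵀ * Φ = 1) (hΨ : Ψᵀ * Ψ = 1)
    (U : Matrix (Fin m) (Fin d) ℝ) (V : Matrix (Fin n) (Fin d) ℝ) :
    objective (Φ * D * Ψᵀ) U V
      = blockLoss D (Φᵀ * U) (Ψᵀ * V) (U - Φ * (Φᵀ * U)) (V - Ψ * (Ψᵀ * V)) := by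
  have hΦ' : ∀ {γ : Type} (X : Matrix (Fin d) γ ℝ), Φᵀ * (Φ * X) = X := fun X => by
    rw [← Matrix.mul_assoc, hΦ, Matrix.one_mul]
  have hΨ' : ∀ {γ : Type} (X : Matrix (Fin d) γ ℝ), Ψᵀ * (Ψ * X) = X := fun X => by
    rw [← Matrix.mul_assoc, hΨ, Matrix.one_mul]
  have hneg : ∀ {α β : Type} [Fintype α] [Fintype β] (X Y : Matrix α β ℝ), X = -Y →
      ip X X = ip Y Y := by
    rintro α β _ _ X Y rfl
    rw [ip_neg_left, ip_neg_right, neg_neg]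
  rw [objective_eq_half_ip, blockLoss]
  set Z := Φ * D * Ψᵀ - U * Vᵀ with hZ
  rw [ip_eq_add_of_orthonormal hΦ Z, ip_eq_add_of_orthonormal_right hΨ (Φᵀ * Z),
    ip_eq_add_of_orthonormal_right hΨ (Z - Φ * (Φᵀ * Z))]
  have e1 : Φᵀ * Z * Ψ = D - Φᵀ * U * (Ψᵀ * V)ᵀ := by
    simp only [hZ, Matrix.mul_sub, Matrix.sub_mul, Matrix.mul_assoc, transpose_mul,
      transpose_transpose, hΦ', hΨ, Matrix.mul_one]
  have e2 := hneg (Φᵀ * Z - Φᵀ * Z * Ψ * Ψᵀ) (Φᵀ * U * (V - Ψ * (Ψᵀ * V))ᵀ) (by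
    simp only [hZ, Matrix.mul_sub, Matrix.sub_mul, Matrix.mul_assoc, transpose_mul, transpose_sub,
      transpose_transpose, hΦ', hΨ']
    abel)
  have e3 := hneg ((Z - Φ * (Φᵀ * Z)) * Ψ) ((U - Φ * (Φᵀ * U)) * (Ψᵀ * V)ᵀ) (by
    simp only [hZ, Matrix.mul_sub, Matrix.sub_mul, Matrix.mul_assoc, transpose_mul,
      transpose_transpose, hΦ']
    abel)
  have e4 := hneg ((Z - Φ * (Φᵀ * Z)) - (Z - Φ * (Φᵀ * Z)) * Ψ * Ψᵀ)
    ((U - Φ * (Φᵀ * U)) * (V - Ψ * (Ψᵀ * V))ᵀ) (by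
    simp only [hZ, Matrix.mul_sub, Matrix.sub_mul, Matrix.mul_assoc, transpose_mul, transpose_sub,
      transpose_transpose, hΦ', hΨ']
    abel)
  rw [e2, e1, e3, e4]
  ring

/-- `|S - W|² ≤ 2 |S|² + 2 |W|²`, where `|S|² ≤ d Λ ^ 2` and the product `W = U Vᵀ` has norm at most
`Λ`. This supplies the initial loss bound `L`. -/
lemma objective_le_of_small {S : Matrix (Fin m) (Fin n) ℝ} {Φ : Matrix (Fin m) (Fin d) ℝ}
    {Ψ : Matrix (Fin n) (Fin d) ℝ} {σ : Fin d → ℝ} (hΦ : Φᵀ * Φ = 1) (hΨ : Ψᵀ * Ψ = 1)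
    (hS : S = Φ * Matrix.diagonal σ * Ψᵀ) {Λ N : ℝ} (hd : 0 < d)
    (hσ : ∀ i, 0 ≤ σ i ∧ σ i ≤ Λ) (hN : N ^ 2 ≤ Λ)
    {U : Matrix (Fin m) (Fin d) ℝ} {V : Matrix (Fin n) (Fin d) ℝ}
    (hUV : ip U U + ip V V ≤ N ^ 2) : objective S U V ≤ 2 * d * Λ ^ 2 := by
  have hd1 : (1 : ℝ) ≤ d := by exact_mod_cast hd
  have h1 : ip S S ≤ d * Λ ^ 2 := by
    rw [hS, Matrix.mul_assoc, ip_of_orthonormal hΦ, ← ip_transpose, transpose_mul,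
      transpose_transpose, ip_of_orthonormal hΨ, ip_transpose]
    have h2 : ip (Matrix.diagonal σ) (Matrix.diagonal σ) = ∑ i, σ i ^ 2 := by
      simp only [ip]
      refine Finset.sum_congr rfl fun i _ => ?_
      rw [Finset.sum_eq_single i]
      · simp [sq]
      · intro j _ hj
        simp [Matrix.diagonal_apply_ne' _ hj]
      · simp
    rw [h2]
    calc ∑ i, σ i ^ 2 ≤ ∑ _i : Fin d, Λ ^ 2 := Finset.sum_le_sum fun i _ => by
          have := hσ i
          gcongr
          · exact this.1
          · exact this.2
      _ = d * Λ ^ 2 := by simp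
  have hU := ip_self_nonneg U
  have hV := ip_self_nonneg V
  have h3 : ip (U * Vᵀ) (U * Vᵀ) ≤ Λ ^ 2 := by
    have h4 := ip_mul_self_le U Vᵀ
    rw [ip_transpose] at h4
    refine h4.trans ?_
    rw [sq]
    exact mul_le_mul (by linarith) (by linarith) hV (by linarith)
  have h5 := ip_self_nonneg (S + U * Vᵀ)
  rw [objective_eq_half_ip]
  simp only [ip_add_left, ip_add_right, ip_sub_left, ip_sub_right] at h5 ⊢
  nlinarith [sq_nonneg Λ]

lemma diagonal_dot (σ : Fin d → ℝ) (v : Fin d → ℝ) :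
    v ⬝ᵥ (Matrix.diagonal σ *ᵥ v) = ∑ i, σ i * (v i * v i) := by
  simp only [dotProduct, Matrix.mulVec_diagonal]
  exact Finset.sum_congr rfl fun i _ => by ring

/-- The deterministic convergence theorem: from a small initialization whose component along the
singular directions is not too degenerate, the flow reaches a prescribed accuracy. -/
theorem reachesBy_of_small {S : Matrix (Fin m) (Fin n) ℝ} {Φ : Matrix (Fin m) (Fin d) ℝ}
    {Ψ : Matrix (Fin n) (Fin d) ℝ} {σ : Fin d → ℝ} (hΦ : Φᵀ * Φ = 1) (hΨ : Ψᵀ * Ψ = 1)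
    (hS : S = Φ * Matrix.diagonal σ * Ψᵀ) (hd : 0 < d) {lam r N s δ T : ℝ} (hlam : 0 < lam)
    (hσ : ∀ i, lam ≤ σ i ∧ σ i ≤ r ^ 2) (hr : 0 < r) (hN : 0 < N) (hs : 0 < s)
    (hrs : 200 * (r * N ^ 2) ≤ lam * s) (hsN : s ≤ N) (hδ : 0 < δ)
    (hT : T = Real.log (lam / s ^ 2) / lam + 8 / lam * Real.log (64 * d * (r ^ 2 / lam) ^ 2))
    (hNT : r * N * T ≤ 1 / 5)
    {U₀ : Matrix (Fin m) (Fin d) ℝ} {V₀ : Matrix (Fin n) (Fin d) ℝ}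
    (hUV : ip U₀ U₀ + ip V₀ V₀ ≤ N ^ 2)
    (hA : ∀ v, s ^ 2 * (v ⬝ᵥ v) ≤ (((1 / 2 : ℝ) • (Φᵀ * U₀ + Ψᵀ * V₀))ᵀ *ᵥ v)
      ⬝ᵥ (((1 / 2 : ℝ) • (Φᵀ * U₀ + Ψᵀ * V₀))ᵀ *ᵥ v)) :
    ReachesBy S δ (T + 8 / lam * Real.posLog (lam ^ 2 / δ)) U₀ V₀ := by
  refine ⟨exists_isGradientFlow S U₀ V₀, fun U V hflow t ht => ?_⟩
  have hd1 : (1 : ℝ) ≤ d := by exact_mod_cast hd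
  have : Nonempty (Fin d) := ⟨⟨0, hd⟩⟩
  have hlr : lam ≤ r ^ 2 := (hσ ⟨0, hd⟩).1.trans (hσ ⟨0, hd⟩).2
  have hrN : 200 * (r * N) ≤ lam := by
    have h1 : 200 * (r * N) * N ≤ lam * N := by
      have := mul_le_mul_of_nonneg_left hsN hlam.le
      linarith
    exact le_of_mul_le_mul_right h1 hN
  have hNr : 200 * N ≤ r := by
    have h1 : 200 * N * r ≤ r * r := by linarith
    exact le_of_mul_le_mul_right h1 hr
  have hN2 : N ^ 2 ≤ r ^ 2 := by
    have : N ≤ r := by linarith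
    gcongr
  have hobj := objective_le_of_small hΦ hΨ hS hd
    (fun i => ⟨hlam.le.trans (hσ i).1, (hσ i).2⟩) hN2 hUV
  have hL : (32 : ℝ) * (2 * d * (r ^ 2) ^ 2) / lam ^ 2 = 64 * d * (r ^ 2 / lam) ^ 2 := by
    field_simp
    ring
  have hU0 := hflow.init_U
  have hV0 := hflow.init_V
  rw [hS] at hflow hobj ⊢
  rw [objective_eq_blockLoss hΦ hΨ] at hobj ⊢
  have hblock := hflow.isBlockFlow hΦ hΨ
  have hpos0 : 0 ≤ Real.posLog (lam ^ 2 / δ) := Real.posLog_nonneg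
  have hTt : T ≤ t := by
    have : 0 ≤ 8 / lam * Real.posLog (lam ^ 2 / δ) := by positivity
    linarith
  have hmain := hblock.blockLoss_le (lam := lam) (r := r) (N := N) (s := s)
    (L := 2 * d * (r ^ 2) ^ 2) (T := T) (Matrix.diagonal_transpose σ) hr hN hs hlr hrs hsN
    (fun v => by
      rw [diagonal_dot, dotProduct, Finset.mul_sum]
      exact Finset.sum_le_sum fun i _ =>
        mul_le_mul_of_nonneg_right (hσ i).1 (mul_self_nonneg _))
    (fun v => by
      rw [diagonal_dot, dotProduct, Finset.mul_sum]
      exact Finset.sum_le_sum fun i _ =>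
        mul_le_mul_of_nonneg_right (hσ i).2 (mul_self_nonneg _))
    (by
      simp only [hU0, hV0]
      rw [← ip_eq_add_of_orthonormal hΦ, ← ip_eq_add_of_orthonormal hΨ]
      exact hUV)
    (by
      simp only [hU0, hV0]
      exact hA)
    (by
      simp only [hU0, hV0]
      exact hobj)
    (by
      have h1 : lam ^ 2 ≤ (r ^ 2) ^ 2 := by gcongr
      nlinarith)
    (by rw [hL]; exact hT) hNT hTt
  refine hmain.trans ?_
  have hexp : Real.exp (-(lam / 8) * (t - T)) ≤ δ / lam ^ 2 := by
    calc Real.exp (-(lam / 8) * (t - T)) ≤ Real.exp (-Real.log (lam ^ 2 / δ)) := by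
          refine Real.exp_le_exp.2 ?_
          have h1 : Real.log (lam ^ 2 / δ) ≤ Real.posLog (lam ^ 2 / δ) := le_max_right _ _
          have h2 : lam / 8 * (8 / lam * Real.posLog (lam ^ 2 / δ)) ≤ lam / 8 * (t - T) := by
            refine mul_le_mul_of_nonneg_left ?_ (by positivity)
            linarith
          have h3 : lam / 8 * (8 / lam * Real.posLog (lam ^ 2 / δ))
              = Real.posLog (lam ^ 2 / δ) := by field_simp
          linarith
      _ = δ / lam ^ 2 := by rw [Real.exp_neg, Real.exp_log (by positivity), inv_div]
  calc lam ^ 2 / 32 * Real.exp (-(lam / 8) * (t - T)) ≤ lam ^ 2 / 32 * (δ / lam ^ 2) := by gcongr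
    _ = δ / 32 := by field_simp
    _ ≤ δ := by linarith

end Reduction

/-! ### Gaussian matrices: rotation invariance, anti-concentration and norm -/

section Gaussian

open scoped NNReal ENNReal

/-- The law of a vector of independent centered Gaussians of variance `v`. -/
def gaussianVec (d : ℕ) (v : ℝ≥0) : Measure (Fin d → ℝ) := Measure.pi fun _ => gaussianReal 0 v

instance (d : ℕ) (v : ℝ≥0) : IsProbabilityMeasure (gaussianVec d v) := by
  unfold gaussianVec; infer_instance

instance (m d : ℕ) (ε : ℝ) : IsProbabilityMeasure (gaussianEntries m d ε) := by
  unfold gaussianEntries; infer_instance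

instance (m n d : ℕ) (ε : ℝ) : IsProbabilityMeasure (initLaw m n d ε) := by
  unfold initLaw; infer_instance

lemma gaussianEntries_eq (m d : ℕ) (ε : ℝ) :
    gaussianEntries m d ε = Measure.pi fun _ => gaussianVec d (Real.toNNReal (ε ^ 2)) := rfl

lemma charFunDual_gaussianReal (v : ℝ≥0) (L : StrongDual ℝ ℝ) :
    charFunDual (gaussianReal 0 v) L = Complex.exp (-((v / 2 * L 1 ^ 2 : ℝ) : ℂ)) := by
  rw [charFunDual_eq_charFun_map_one]
  have h : (L : ℝ → ℝ) = fun x => L 1 * x := by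
    ext x
    have := L.map_smul x 1
    simp only [smul_eq_mul, mul_one] at this
    rw [this, mul_comm]
  rw [h, gaussianReal_map_const_mul, charFun_gaussianReal]
  congr 1
  push_cast
  simp
  ring

lemma charFunDual_gaussianVec (d : ℕ) (v : ℝ≥0) (L : StrongDual ℝ (Fin d → ℝ)) :
    charFunDual (gaussianVec d v) L
      = Complex.exp (-((v / 2 * ∑ k, L (Pi.single k 1) ^ 2 : ℝ) : ℂ)) := by
  unfold gaussianVec
  rw [charFunDual_pi]
  simp only [charFunDual_gaussianReal]
  rw [← Complex.exp_sum]
  congr 1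
  rw [Finset.mul_sum]
  push_cast
  rw [Finset.sum_neg_distrib]
  rfl

/-- The functional `L` enters only through the sum of squares of its coefficients, which isometries
preserve; this is the source of rotation invariance. -/
lemma charFunDual_gaussianEntries (m d : ℕ) (ε : ℝ) (L : StrongDual ℝ (Fin m → Fin d → ℝ)) :
    charFunDual (gaussianEntries m d ε) L
      = Complex.exp (-((ε ^ 2 / 2 * ∑ i, ∑ k, L (Pi.single i (Pi.single k 1)) ^ 2 : ℝ) : ℂ)) := by
  rw [gaussianEntries_eq, charFunDual_pi]
  simp only [charFunDual_gaussianVec]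
  rw [← Complex.exp_sum, Real.coe_toNNReal _ (sq_nonneg ε)]
  congr 1
  rw [Finset.mul_sum]
  push_cast
  rw [Finset.sum_neg_distrib]
  rfl

/-- Left multiplication of the entries by `Φᵀ`. -/
def mulTransposeCLM {m d l : ℕ} (Φ : Matrix (Fin m) (Fin l) ℝ) :
    (Fin m → Fin d → ℝ) →L[ℝ] (Fin l → Fin d → ℝ) :=
  LinearMap.toContinuousLinearMap
    { toFun := fun U => Φᵀ * (Matrix.of U)
      map_add' := fun U V => Matrix.mul_add Φᵀ (Matrix.of U) (Matrix.of V)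
      map_smul' := fun c U => Matrix.mul_smul Φᵀ c (Matrix.of U) }

lemma mulTransposeCLM_apply {m d l : ℕ} (Φ : Matrix (Fin m) (Fin l) ℝ) (U : Fin m → Fin d → ℝ) :
    mulTransposeCLM Φ U = Φᵀ * (Matrix.of U) := rfl

lemma sum_sq_comp_mulTransposeCLM {m d l : ℕ} {Φ : Matrix (Fin m) (Fin l) ℝ} (hΦ : Φᵀ * Φ = 1)
    (L : StrongDual ℝ (Fin l → Fin d → ℝ)) :
    ∑ i, ∑ k, (L.comp (mulTransposeCLM Φ)) (Pi.single i (Pi.single k 1)) ^ 2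
      = ∑ j, ∑ k, L (Pi.single j (Pi.single k 1)) ^ 2 := by
  set X : Matrix (Fin l) (Fin d) ℝ := Matrix.of fun j k => L (Pi.single j (Pi.single k 1)) with hX
  have h : ∀ i k, (L.comp (mulTransposeCLM Φ)) (Pi.single i (Pi.single k 1)) = (Φ * X) i k := by
    intro i k
    have h1 : mulTransposeCLM Φ (Pi.single i (Pi.single k 1) : Fin m → Fin d → ℝ)
        = ∑ j, Φ i j • (Pi.single j (Pi.single k 1) : Fin l → Fin d → ℝ) := by
      rw [mulTransposeCLM_apply]
      ext j k'
      rw [Matrix.mul_apply, Finset.sum_apply, Finset.sum_apply,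
        Finset.sum_eq_single i (fun b _ hb => by simp [Pi.single_eq_of_ne hb]) (by simp),
        Finset.sum_eq_single j (fun b _ hb => by simp [Pi.single_eq_of_ne' hb]) (by simp)]
      simp
    rw [ContinuousLinearMap.comp_apply, h1, map_sum, Matrix.mul_apply]
    simp [hX]
  have h2 := ip_of_orthonormal hΦ X X
  simp only [ip, ← sq] at h2
  simp only [h]
  exact h2

/-- Left multiplication by an isometry preserves Gaussian matrices. -/
theorem map_mulTransposeCLM_gaussianEntries {m d l : ℕ} {Φ : Matrix (Fin m) (Fin l) ℝ}
    (hΦ : Φᵀ * Φ = 1) (ε : ℝ) :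
    (gaussianEntries m d ε).map (mulTransposeCLM Φ) = gaussianEntries l d ε := by
  have := Measure.isProbabilityMeasure_map (μ := gaussianEntries m d ε)
    (mulTransposeCLM Φ).continuous.measurable.aemeasurable
  apply Measure.ext_of_charFunDual
  ext L
  rw [charFunDual_map, charFunDual_gaussianEntries, charFunDual_gaussianEntries,
    sum_sq_comp_mulTransposeCLM hΦ]

/-- The compressed sum of the two initial matrices is a Gaussian matrix. -/
theorem map_add_initLaw {m n d : ℕ} {Φ : Matrix (Fin m) (Fin d) ℝ} {Ψ : Matrix (Fin n) (Fin d) ℝ}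
    (hΦ : Φᵀ * Φ = 1) (hΨ : Ψᵀ * Ψ = 1) (ε : ℝ) :
    (initLaw m n d ε).map ((mulTransposeCLM Φ).coprod (mulTransposeCLM Ψ))
      = gaussianEntries d d (√2 * ε) := by
  have := Measure.isProbabilityMeasure_map (μ := initLaw m n d ε)
    ((mulTransposeCLM Φ).coprod (mulTransposeCLM (d := d) Ψ)).continuous.measurable.aemeasurable
  apply Measure.ext_of_charFunDual
  ext L
  unfold initLaw
  rw [charFunDual_map, charFunDual_prod, ContinuousLinearMap.comp_assoc,
    ContinuousLinearMap.comp_assoc, ContinuousLinearMap.coprod_comp_inl,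
    ContinuousLinearMap.coprod_comp_inr, charFunDual_gaussianEntries, charFunDual_gaussianEntries,
    charFunDual_gaussianEntries, sum_sq_comp_mulTransposeCLM hΦ, sum_sq_comp_mulTransposeCLM hΨ,
    ← Complex.exp_add, mul_pow, Real.sq_sqrt zero_le_two]
  congr 1
  push_cast
  ring

/-- A linear functional of a Gaussian vector is Gaussian. -/
lemma map_dot_gaussianVec (d : ℕ) (v : ℝ≥0) (a : Fin d → ℝ) :
    (gaussianVec d v).map (fun x => x ⬝ᵥ a)
      = gaussianReal 0 (v * Real.toNNReal (a ⬝ᵥ a)) := by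
  set L : StrongDual ℝ (Fin d → ℝ) := LinearMap.toContinuousLinearMap
    { toFun := fun x => x ⬝ᵥ a
      map_add' := fun x y => add_dotProduct x y a
      map_smul' := fun c x => smul_dotProduct c x a } with hL
  have hLa : ∀ x, L x = x ⬝ᵥ a := fun x => rfl
  change (gaussianVec d v).map L = _
  have := Measure.isProbabilityMeasure_map (μ := gaussianVec d v)
    L.continuous.measurable.aemeasurable
  apply Measure.ext_of_charFun
  ext t
  rw [charFun_map_eq_charFunDual_smul, charFunDual_gaussianVec, charFun_gaussianReal]
  congr 1
  have : ∑ k, (t • L) (Pi.single k 1) ^ 2 = t ^ 2 * (a ⬝ᵥ a) := by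
    rw [dotProduct, Finset.mul_sum]
    refine Finset.sum_congr rfl fun k _ => ?_
    simp [hLa]
    ring
  rw [this]
  push_cast
  rw [Real.coe_toNNReal _ (dot_self_nonneg a)]
  ring

lemma gaussianReal_Icc_le {v : ℝ≥0} {b ε : ℝ} (hε : 0 < ε) (hv : (v : ℝ) = ε ^ 2) :
    gaussianReal 0 v (Icc (-b) b) ≤ ENNReal.ofReal (b / ε) := by
  have hv0 : v ≠ 0 := by
    intro h
    rw [h] at hv
    exact (pow_pos hε 2).ne hv
  rw [gaussianReal_apply _ hv0]
  have hpdf : ∀ x, gaussianPDF 0 v x ≤ ENNReal.ofReal (1 / (2 * ε)) := by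
    intro x
    refine ENNReal.ofReal_le_ofReal ?_
    unfold gaussianPDFReal
    have h1 : 2 * ε ≤ √(2 * Real.pi * v) := by
      refine Real.le_sqrt_of_sq_le ?_
      rw [hv]
      have := Real.pi_gt_three
      nlinarith [pow_pos hε 2]
    have h2 : Real.exp (-(x - 0) ^ 2 / (2 * v)) ≤ 1 := by
      refine Real.exp_le_one_iff.2 ?_
      refine div_nonpos_of_nonpos_of_nonneg ?_ (by positivity)
      simp [sq_nonneg]
    calc (√(2 * Real.pi * v))⁻¹ * Real.exp (-(x - 0) ^ 2 / (2 * v)) ≤ (2 * ε)⁻¹ * 1 := by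
          gcongr
      _ = 1 / (2 * ε) := by simp
  calc ∫⁻ x in Icc (-b) b, gaussianPDF 0 v x
      ≤ ∫⁻ _ in Icc (-b) b, ENNReal.ofReal (1 / (2 * ε)) := lintegral_mono hpdf
    _ = ENNReal.ofReal (b / ε) := by
      rw [setLIntegral_const, Real.volume_Icc, ← ENNReal.ofReal_mul (by positivity)]
      congr 1
      field_simp
      ring

/-- Anti-concentration of a linear functional of a Gaussian vector. -/
lemma gaussianVec_abs_dot_le {d : ℕ} {v : ℝ≥0} {ε : ℝ} (hε : 0 < ε) (hv : (v : ℝ) = ε ^ 2)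
    {a : Fin d → ℝ} (ha : a ⬝ᵥ a = 1) (b : ℝ) :
    gaussianVec d v {x | |x ⬝ᵥ a| ≤ b} ≤ ENNReal.ofReal (b / ε) := by
  have h := map_dot_gaussianVec d v a
  rw [ha, Real.toNNReal_one, mul_one] at h
  have h2 := gaussianReal_Icc_le (b := b) hε hv
  rw [← h, Measure.map_apply (by unfold dotProduct; fun_prop) measurableSet_Icc] at h2
  refine le_trans (measure_mono fun x hx => ?_) h2
  exact abs_le.1 hx

lemma lintegral_sq_gaussianReal (v : ℝ≥0) :
    ∫⁻ x, ENNReal.ofReal (x ^ 2) ∂(gaussianReal 0 v) = v := by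
  have h1 := evariance_eq_lintegral_ofReal (X := id) (μ := gaussianReal 0 v)
  have h2 : MemLp id 2 (gaussianReal 0 v) := IsGaussian.memLp_two_id
  rw [← h2.ofReal_variance_eq, variance_id_gaussianReal] at h1
  simp at h1
  exact h1.symm

lemma lintegral_dot_self_gaussianVec (d : ℕ) (v : ℝ≥0) :
    ∫⁻ x, ENNReal.ofReal (x ⬝ᵥ x) ∂(gaussianVec d v) = d * v := by
  have h1 : ∀ x : Fin d → ℝ, ENNReal.ofReal (x ⬝ᵥ x) = ∑ i, ENNReal.ofReal (x i ^ 2) := by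
    intro x
    rw [← ENNReal.ofReal_sum_of_nonneg fun i _ => sq_nonneg _]
    simp [dotProduct, sq]
  simp only [h1]
  rw [lintegral_finsetSum _ fun i _ => by fun_prop]
  have h2 : ∀ i, ∫⁻ x, ENNReal.ofReal (x i ^ 2) ∂(gaussianVec d v) = v := by
    intro i
    rw [← lintegral_sq_gaussianReal v]
    exact (measurePreserving_eval (fun _ : Fin d => gaussianReal 0 v) i).lintegral_comp
      (f := fun y => ENNReal.ofReal (y ^ 2)) (by fun_prop)
  simp [h2]

lemma lintegral_ip_self_gaussianEntries (m d : ℕ) (ε : ℝ) :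
    ∫⁻ U, ENNReal.ofReal (ip (Matrix.of U) (Matrix.of U)) ∂(gaussianEntries m d ε)
      = ENNReal.ofReal (m * d * ε ^ 2) := by
  have h1 : ∀ U : Fin m → Fin d → ℝ, ENNReal.ofReal (ip (Matrix.of U) (Matrix.of U))
      = ∑ i, ENNReal.ofReal (U i ⬝ᵥ U i) := by
    intro U
    rw [← ENNReal.ofReal_sum_of_nonneg fun i _ => dot_self_nonneg _]
    rfl
  simp only [h1]
  rw [lintegral_finsetSum _ fun i _ => by unfold dotProduct; fun_prop]
  have h2 : ∀ i, ∫⁻ U, ENNReal.ofReal (U i ⬝ᵥ U i) ∂(gaussianEntries m d ε)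
      = d * (Real.toNNReal (ε ^ 2) : ℝ≥0∞) := by
    intro i
    rw [← lintegral_dot_self_gaussianVec]
    exact (measurePreserving_eval (fun _ : Fin m => gaussianVec d (Real.toNNReal (ε ^ 2)))
      i).lintegral_comp (f := fun y => ENNReal.ofReal (y ⬝ᵥ y)) (by unfold dotProduct; fun_prop)
  simp only [h2, Finset.sum_const, Finset.card_univ, Fintype.card_fin, nsmul_eq_mul]
  rw [ENNReal.ofReal_mul (by positivity), ENNReal.ofReal_mul (by positivity), mul_assoc,
    ENNReal.ofReal_natCast, ENNReal.ofReal_natCast]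
  rfl

/-- Markov's inequality for the squared norm of the initialization. -/
theorem initLaw_norm_le {m n d : ℕ} {ε N p : ℝ} (hN : 0 < N)
    (h : (m + n) * d * ε ^ 2 ≤ p * N ^ 2) :
    initLaw m n d ε {z | N ^ 2 < ip (Matrix.of z.1) (Matrix.of z.1)
      + ip (Matrix.of z.2) (Matrix.of z.2)} ≤ ENNReal.ofReal p := by
  set F : (Fin m → Fin d → ℝ) × (Fin n → Fin d → ℝ) → ℝ≥0∞ := fun z =>
    ENNReal.ofReal (ip (Matrix.of z.1) (Matrix.of z.1)) +
      ENNReal.ofReal (ip (Matrix.of z.2) (Matrix.of z.2)) with hF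
  have hm1 : Measurable fun z : (Fin m → Fin d → ℝ) × (Fin n → Fin d → ℝ) =>
      ENNReal.ofReal (ip (Matrix.of z.1) (Matrix.of z.1)) := by
    unfold ip; simp only [Matrix.of_apply]; fun_prop
  have hm2 : Measurable fun z : (Fin m → Fin d → ℝ) × (Fin n → Fin d → ℝ) =>
      ENNReal.ofReal (ip (Matrix.of z.2) (Matrix.of z.2)) := by
    unfold ip; simp only [Matrix.of_apply]; fun_prop
  have hint : ∫⁻ z, F z ∂(initLaw m n d ε) = ENNReal.ofReal ((m + n) * d * ε ^ 2) := by
    rw [lintegral_add_left hm1]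
    have e1 : ∫⁻ z, ENNReal.ofReal (ip (Matrix.of z.1) (Matrix.of z.1)) ∂(initLaw m n d ε)
        = ENNReal.ofReal (m * d * ε ^ 2) := by
      rw [← lintegral_ip_self_gaussianEntries]
      exact measurePreserving_fst.lintegral_comp
        (f := fun U : Fin m → Fin d → ℝ => ENNReal.ofReal (ip (Matrix.of U) (Matrix.of U)))
        (by unfold ip; simp only [Matrix.of_apply]; fun_prop)
    have e2 : ∫⁻ z, ENNReal.ofReal (ip (Matrix.of z.2) (Matrix.of z.2)) ∂(initLaw m n d ε)
        = ENNReal.ofReal (n * d * ε ^ 2) := by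
      rw [← lintegral_ip_self_gaussianEntries]
      exact measurePreserving_snd.lintegral_comp
        (f := fun U : Fin n → Fin d → ℝ => ENNReal.ofReal (ip (Matrix.of U) (Matrix.of U)))
        (by unfold ip; simp only [Matrix.of_apply]; fun_prop)
    rw [e1, e2, ← ENNReal.ofReal_add (by positivity) (by positivity)]
    congr 1
    ring
  have hN2 : (0 : ℝ) < N ^ 2 := by positivity
  have hmark := meas_ge_le_lintegral_div (μ := initLaw m n d ε) (hm1.add hm2).aemeasurable
    (ε := ENNReal.ofReal (N ^ 2)) (by simpa using hN.ne') ENNReal.ofReal_ne_top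
  refine le_trans (measure_mono fun z hz => ?_) (hmark.trans ?_)
  · simp only [mem_ofPred_eq, Pi.add_apply] at hz ⊢
    rw [← ENNReal.ofReal_add (ip_self_nonneg _) (ip_self_nonneg _)]
    exact ENNReal.ofReal_le_ofReal hz.le
  · have : (∫⁻ z, F z ∂(initLaw m n d ε)) / ENNReal.ofReal (N ^ 2) ≤ ENNReal.ofReal p := by
      rw [hint, ← ENNReal.ofReal_div_of_pos hN2]
      refine ENNReal.ofReal_le_ofReal ?_
      rw [div_le_iff₀ hN2]
      exact h
    exact this

end Gaussian

/-! ### Smallest singular value of a square Gaussian matrix -/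

section SmallestSingularValue

open scoped NNReal ENNReal

/-- A Householder reflection moves any vector to the first axis. -/
lemma exists_orthogonal_mulVec {d : ℕ} (g : Fin (d + 1) → ℝ) :
    ∃ H : Matrix (Fin (d + 1)) (Fin (d + 1)) ℝ, Hᵀ * H = 1 ∧ Hᵀ = H ∧
      H *ᵥ g = √(g ⬝ᵥ g) • (Pi.single 0 1 : Fin (d + 1) → ℝ) := by
  set e : Fin (d + 1) → ℝ := Pi.single 0 1 with he
  set ρ := √(g ⬝ᵥ g) with hρ
  have hρ2 : ρ * ρ = g ⬝ᵥ g := Real.mul_self_sqrt (dot_self_nonneg g)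
  set u := g - ρ • e with hu
  have hee : e ⬝ᵥ e = 1 := by simp [he]
  have huu : u ⬝ᵥ u = 2 * (u ⬝ᵥ g) := by
    simp only [hu, sub_dotProduct, dotProduct_sub, smul_dotProduct, dotProduct_smul, smul_eq_mul,
      hee, dotProduct_comm e g]
    linarith
  by_cases h0 : u ⬝ᵥ u = 0
  · refine ⟨1, by simp, by simp, ?_⟩
    rw [dotProduct_self_eq_zero, hu, sub_eq_zero] at h0
    rw [Matrix.one_mulVec]
    exact h0
  · have htr : (1 - (2 / (u ⬝ᵥ u)) • vecMulVec u u)ᵀ = 1 - (2 / (u ⬝ᵥ u)) • vecMulVec u u := by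
      rw [transpose_sub, transpose_one, transpose_smul, transpose_vecMulVec]
    refine ⟨1 - (2 / (u ⬝ᵥ u)) • vecMulVec u u, ?_, htr, ?_⟩
    · rw [htr]
      have h2 : vecMulVec u u * vecMulVec u u = (u ⬝ᵥ u) • vecMulVec u u := by
        rw [vecMulVec_mul_vecMulVec, vecMulVec_smul]
      rw [Matrix.sub_mul, Matrix.mul_sub, Matrix.mul_sub, Matrix.one_mul, Matrix.mul_one,
        Matrix.one_mul, Matrix.smul_mul, Matrix.mul_smul, h2, smul_smul, smul_smul]
      have : 2 / (u ⬝ᵥ u) * (2 / (u ⬝ᵥ u)) * (u ⬝ᵥ u) = 2 / (u ⬝ᵥ u) + 2 / (u ⬝ᵥ u) := by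
        field_simp; norm_num
      rw [this, add_smul]
      abel
    · rw [Matrix.sub_mulVec, Matrix.one_mulVec, Matrix.smul_mulVec, vecMulVec_mulVec]
      have : (2 / (u ⬝ᵥ u)) * (u ⬝ᵥ g) = 1 := by
        rw [huu] at h0 ⊢
        rw [div_mul_eq_mul_div, div_self h0]
      rw [op_smul_eq_smul, smul_smul, this, one_smul]
      rw [hu]
      abel

/-- The pairs `(G, g)` for which no short vector is mapped to `g` by `G`. -/
def noShortPreimage (d : ℕ) (ρ : ℝ) : Set ((Fin d → Fin d → ℝ) × (Fin d → ℝ)) :=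
  {z | ∀ w : Fin d → ℝ, w ⬝ᵥ w ≤ ρ ^ 2 → Matrix.of z.1 *ᵥ w ≠ z.2}

lemma isCompact_dot_self_le (d : ℕ) (c : ℝ) : IsCompact {w : Fin d → ℝ | w ⬝ᵥ w ≤ c} := by
  refine Metric.isCompact_of_isClosed_isBounded
    (isClosed_le (by unfold dotProduct; fun_prop) continuous_const) ?_
  refine (Metric.isBounded_closedBall (x := (0 : Fin d → ℝ)) (r := √c)).subset fun w hw => ?_
  rw [mem_closedBall_zero_iff, pi_norm_le_iff_of_nonneg (Real.sqrt_nonneg c)]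
  intro i
  rw [Real.norm_eq_abs]
  refine Real.abs_le_sqrt (le_trans ?_ hw)
  rw [sq]
  exact Finset.single_le_sum (f := fun j => w j * w j) (fun j _ => mul_self_nonneg _)
    (Finset.mem_univ i)

/-- The set is an uncountable intersection over `w`; compactness of the ball of vectors `w` makes it
open, hence measurable. -/
lemma isOpen_noShortPreimage (d : ℕ) (ρ : ℝ) : IsOpen (noShortPreimage d ρ) := by
  rw [isOpen_iff_eventually]
  intro z hz
  refine (isCompact_dot_self_le d (ρ ^ 2)).eventually_forall_of_forall_eventually
    (P := fun (z : (Fin d → Fin d → ℝ) × (Fin d → ℝ)) w => Matrix.of z.1 *ᵥ w ≠ z.2) fun w hw => ?_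
  have hc : Continuous fun q : ((Fin d → Fin d → ℝ) × (Fin d → ℝ)) × (Fin d → ℝ) =>
      Matrix.of q.1.1 *ᵥ q.2 := by
    refine continuous_pi fun i => ?_
    simp only [Matrix.mulVec, dotProduct, Matrix.of_apply]
    fun_prop
  exact (isOpen_ne_fun hc (by fun_prop)).mem_nhds (hz w hw)

lemma exists_unit_orthogonal {d : ℕ} (R : Matrix (Fin d) (Fin (d + 1)) ℝ) :
    ∃ v : Fin (d + 1) → ℝ, v ⬝ᵥ v = 1 ∧ R *ᵥ v = 0 := by
  have h : LinearMap.ker R.mulVecLin ≠ ⊥ := LinearMap.ker_ne_bot_of_finrank_lt (by simp)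
  obtain ⟨w, hw, hw0⟩ := (Submodule.ne_bot_iff _).1 h
  have hw' : R *ᵥ w = 0 := hw
  have hpos : 0 < w ⬝ᵥ w :=
    lt_of_le_of_ne (dot_self_nonneg w) fun h => hw0 (dotProduct_self_eq_zero.1 h.symm)
  refine ⟨(√(w ⬝ᵥ w))⁻¹ • w, ?_, ?_⟩
  · rw [smul_dotProduct, dotProduct_smul, smul_eq_mul, smul_eq_mul, ← mul_assoc, ← mul_inv,
      Real.mul_self_sqrt hpos.le, inv_mul_cancel₀ hpos.ne']
  · rw [Matrix.mulVec_smul, hw', smul_zero]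

/-- A unit vector `w` orthogonal to all rows but the first depends only on those rows, so it is
independent of the first row `x`. The multiple `(a / (x · w)) w` is mapped to `a e₀`, and it is
short unless `|x · w| ≤ a / ρ`, an event of probability at most `a / (ρ ε)`. -/
lemma gaussianEntries_noShortPreimage_single {d : ℕ} {ε ρ a : ℝ} (hε : 0 < ε) (hρ : 0 < ρ)
    (ha : 0 ≤ a) :
    gaussianEntries (d + 1) (d + 1) ε
        {G | (G, a • (Pi.single 0 1 : Fin (d + 1) → ℝ)) ∈ noShortPreimage (d + 1) ρ}
      ≤ ENNReal.ofReal (a / (ρ * ε)) := by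
  set v := Real.toNNReal (ε ^ 2) with hv
  have hv' : (v : ℝ) = ε ^ 2 := Real.coe_toNNReal _ (sq_nonneg ε)
  set E := {G : Fin (d + 1) → Fin (d + 1) → ℝ |
    (G, a • (Pi.single 0 1 : Fin (d + 1) → ℝ)) ∈ noShortPreimage (d + 1) ρ} with hE
  have hEm : MeasurableSet E :=
    ((isOpen_noShortPreimage (d + 1) ρ).preimage (by fun_prop)).measurableSet
  have hmp := (measurePreserving_piFinSuccAbove
    (fun _ : Fin (d + 1) => gaussianVec (d + 1) v) 0).symm
  rw [gaussianEntries_eq, ← hmp.measure_preimage_equiv, Measure.prod_apply_symm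
    (hmp.measurable hEm)]
  refine (lintegral_mono (g := fun _ => ENNReal.ofReal (a / (ρ * ε))) fun R => ?_).trans ?_
  · obtain ⟨w, hw1, hw2⟩ := exists_unit_orthogonal (Matrix.of R)
    have h1 := gaussianVec_abs_dot_le hε hv' hw1 (a / ρ)
    rw [div_div] at h1
    refine le_trans (measure_mono fun x hx => ?_) h1
    by_contra hcon
    rw [mem_ofPred_eq, not_le] at hcon
    have hxw : x ⬝ᵥ w ≠ 0 := by
      intro h
      rw [h, abs_zero] at hcon
      exact absurd hcon (not_lt.2 (by positivity))
    refine hx ((a / (x ⬝ᵥ w)) • w) ?_ ?_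
    · rw [smul_dotProduct, dotProduct_smul, hw1, smul_eq_mul, smul_eq_mul, mul_one, ← sq]
      refine sq_le_sq.2 ?_
      rw [abs_div, abs_of_nonneg ha, abs_of_pos hρ, div_le_iff₀ (abs_pos.2 hxw)]
      rw [div_lt_iff₀ hρ] at hcon
      linarith
    · rw [Matrix.mulVec_smul]
      ext i
      refine Fin.cases ?_ (fun j => ?_) i
      · have : (Matrix.of ((MeasurableEquiv.piFinSuccAbove (fun _ => Fin (d + 1) → ℝ) 0).symm
            (x, R)) *ᵥ w) 0 = x ⬝ᵥ w := rfl
        simp only [Pi.smul_apply, smul_eq_mul]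
        rw [this]
        simp [hxw]
      · have : (Matrix.of ((MeasurableEquiv.piFinSuccAbove (fun _ => Fin (d + 1) → ℝ) 0).symm
            (x, R)) *ᵥ w) j.succ = (Matrix.of R *ᵥ w) j := rfl
        simp only [Pi.smul_apply, smul_eq_mul]
        rw [this, hw2]
        simp
  · simp

/-- A reflection turns `g` into a multiple of the first axis without changing the law of `G`. -/
lemma gaussianEntries_noShortPreimage {d : ℕ} {ε ρ : ℝ} (hε : 0 < ε) (hρ : 0 < ρ)
    (g : Fin (d + 1) → ℝ) :
    gaussianEntries (d + 1) (d + 1) ε {G | (G, g) ∈ noShortPreimage (d + 1) ρ}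
      ≤ ENNReal.ofReal (√(g ⬝ᵥ g) / (ρ * ε)) := by
  obtain ⟨H, hH, hHt, hHg⟩ := exists_orthogonal_mulVec g
  have h1 := gaussianEntries_noShortPreimage_single (d := d) hε hρ (Real.sqrt_nonneg (g ⬝ᵥ g))
  have hm : MeasurableSet {G : Fin (d + 1) → Fin (d + 1) → ℝ |
      (G, √(g ⬝ᵥ g) • (Pi.single 0 1 : Fin (d + 1) → ℝ)) ∈ noShortPreimage (d + 1) ρ} :=
    ((isOpen_noShortPreimage (d + 1) ρ).preimage (by fun_prop)).measurableSet
  rw [← map_mulTransposeCLM_gaussianEntries hH ε, Measure.map_apply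
    (mulTransposeCLM H).continuous.measurable hm] at h1
  refine le_trans (measure_mono ?_) h1
  intro G hG w hw hGw
  refine hG w hw ?_
  have h2 : H *ᵥ (Matrix.of G *ᵥ w) = √(g ⬝ᵥ g) • (Pi.single 0 1 : Fin (d + 1) → ℝ) := by
    rw [Matrix.mulVec_mulVec]
    nth_rewrite 1 [← hHt]
    exact hGw
  rw [← hHg] at h2
  have h3 := congrArg (fun x => Hᵀ *ᵥ x) h2
  simpa only [Matrix.mulVec_mulVec, ← Matrix.mul_assoc, hH, Matrix.one_mulVec,
    Matrix.one_mul] using h3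

lemma lintegral_sqrt_dot_self_le (d : ℕ) :
    ∫⁻ g, ENNReal.ofReal √(g ⬝ᵥ g) ∂(gaussianVec (d + 1) 1) ≤ ENNReal.ofReal √(d + 1) := by
  set r := √((d : ℝ) + 1) with hr
  have hr0 : 0 < r := Real.sqrt_pos.2 (by positivity)
  have hr2 : r * r = d + 1 := Real.mul_self_sqrt (by positivity)
  -- The tangent to the square root at the mean value `d + 1`, in place of Jensen's inequality.
  have h1 : ∀ g : Fin (d + 1) → ℝ, ENNReal.ofReal √(g ⬝ᵥ g)
      ≤ ENNReal.ofReal (1 / (2 * r)) * ENNReal.ofReal (g ⬝ᵥ g) + ENNReal.ofReal (r / 2) := by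
    intro g
    have hg := dot_self_nonneg g
    rw [← ENNReal.ofReal_mul (by positivity), ← ENNReal.ofReal_add (by positivity) (by positivity)]
    refine ENNReal.ofReal_le_ofReal ?_
    have h2 : 1 / (2 * r) * (g ⬝ᵥ g) + r / 2 - √(g ⬝ᵥ g)
        = (√(g ⬝ᵥ g) - r) ^ 2 / (2 * r) := by
      rw [sub_sq, Real.sq_sqrt hg]
      field_simp
      ring
    have h3 : 0 ≤ (√(g ⬝ᵥ g) - r) ^ 2 / (2 * r) := by positivity
    linarith
  refine (lintegral_mono h1).trans ?_
  rw [lintegral_add_right _ measurable_const,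
    lintegral_const_mul _ (by unfold dotProduct; fun_prop), lintegral_dot_self_gaussianVec, lintegral_const, measure_univ, mul_one]
  have h4 : ((d + 1 : ℕ) : ℝ≥0∞) * ((1 : ℝ≥0) : ℝ≥0∞) = ENNReal.ofReal (r * r) := by
    rw [hr2, ENNReal.coe_one, mul_one, ← ENNReal.ofReal_natCast]
    push_cast
    rfl
  rw [h4, ← ENNReal.ofReal_mul (by positivity),
    ← ENNReal.ofReal_add (by positivity) (by positivity)]
  refine ENNReal.ofReal_le_ofReal (le_of_eq ?_)
  field_simp
  ring

/-- The smallest singular value of a square Gaussian matrix is rarely much smaller than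
`ε / √d`. -/
theorem gaussianEntries_smallest_singular {d : ℕ} (hd : 0 < d) {ε s : ℝ} (hε : 0 < ε) (hs : 0 < s) :
    gaussianEntries d d ε {G | ∃ v : Fin d → ℝ,
        ((Matrix.of G)ᵀ *ᵥ v) ⬝ᵥ ((Matrix.of G)ᵀ *ᵥ v) < s ^ 2 * (v ⬝ᵥ v)}
      ≤ ENNReal.ofReal (4 * s * √d / ε) := by
  obtain ⟨d, rfl⟩ := Nat.exists_eq_succ_of_ne_zero hd.ne'
  simp only [Nat.succ_eq_add_one]
  set μ := gaussianEntries (d + 1) (d + 1) ε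
  set ν := gaussianVec (d + 1) 1
  -- Chosen so that `ρ s = 1 / 2`: if `|Gᵀ u| < s` for a unit vector `u`, any `g = G w` with `|w| ≤
  -- ρ` satisfies `|g · u| ≤ 1 / 2`.
  set ρ := 1 / (2 * s) with hρ
  have hρ0 : 0 < ρ := by positivity
  set E := noShortPreimage (d + 1) ρ with hE
  have hEm : MeasurableSet E := (isOpen_noShortPreimage _ _).measurableSet
  have hprod : (μ.prod ν) E ≤ ENNReal.ofReal (2 * s * √(d + 1) / ε) := by
    rw [Measure.prod_apply_symm hEm]
    calc ∫⁻ g, μ ((fun G => (G, g)) ⁻¹' E) ∂ν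
        ≤ ∫⁻ g, ENNReal.ofReal (1 / (ρ * ε)) * ENNReal.ofReal √(g ⬝ᵥ g) ∂ν := by
          refine lintegral_mono fun g => (gaussianEntries_noShortPreimage hε hρ0 g).trans_eq ?_
          rw [← ENNReal.ofReal_mul (by positivity)]
          congr 1
          ring
      _ ≤ ENNReal.ofReal (1 / (ρ * ε)) * ENNReal.ofReal √(d + 1) := by
          rw [lintegral_const_mul _ (by unfold dotProduct; fun_prop)]
          gcongr
          exact lintegral_sqrt_dot_self_le d
      _ = ENNReal.ofReal (2 * s * √(d + 1) / ε) := by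
          rw [← ENNReal.ofReal_mul (by positivity)]
          congr 1
          rw [hρ]
          field_simp
  -- An auxiliary independent standard Gaussian `g` tests `G`. For a badly conditioned `G`, `|g · u|
  -- > 1 / 2` has probability at least `1 / 2`, and then `g` has no short preimage. Markov's
  -- inequality for this conditional probability transfers the bound on the pair to `G`, at the cost
  -- of a factor `2`.
  have hmark := meas_ge_le_lintegral_div (μ := μ)
    (measurable_measure_prodMk_left (ν := ν) hEm).aemeasurable
    (ε := ENNReal.ofReal (1 / 2)) (by simp) ENNReal.ofReal_ne_top
  rw [← Measure.prod_apply hEm] at hmark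
  refine le_trans (measure_mono ?_) (hmark.trans ?_)
  · rintro G ⟨v, hv⟩
    have hvpos : 0 < v ⬝ᵥ v := by
      have h1 := dot_self_nonneg ((Matrix.of G)ᵀ *ᵥ v)
      exact pos_of_mul_pos_right (h1.trans_lt hv) (sq_nonneg s)
    set u := (√(v ⬝ᵥ v))⁻¹ • v with hu
    have hu1 : u ⬝ᵥ u = 1 := by
      rw [hu, smul_dotProduct, dotProduct_smul, smul_eq_mul, smul_eq_mul, ← mul_assoc, ← mul_inv,
        Real.mul_self_sqrt hvpos.le, inv_mul_cancel₀ hvpos.ne']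
    have hGu : ((Matrix.of G)ᵀ *ᵥ u) ⬝ᵥ ((Matrix.of G)ᵀ *ᵥ u) < s ^ 2 := by
      rw [hu, Matrix.mulVec_smul, smul_dotProduct, dotProduct_smul, smul_eq_mul, smul_eq_mul,
        ← mul_assoc, ← mul_inv, Real.mul_self_sqrt hvpos.le, inv_mul_lt_iff₀ hvpos]
      linarith
    have h1 := gaussianVec_abs_dot_le (v := 1) one_pos (by simp) hu1 (1 / 2)
    have hmeas : MeasurableSet {x : Fin (d + 1) → ℝ | |x ⬝ᵥ u| ≤ 1 / 2} :=
      measurableSet_le (by unfold dotProduct; fun_prop) measurable_const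
    have h2 : ENNReal.ofReal (1 / 2) ≤ ν {x : Fin (d + 1) → ℝ | |x ⬝ᵥ u| ≤ 1 / 2}ᶜ := by
      rw [prob_compl_eq_one_sub hmeas]
      refine ENNReal.le_sub_of_add_le_right (measure_ne_top _ _) ?_
      calc ENNReal.ofReal (1 / 2) + ν {x : Fin (d + 1) → ℝ | |x ⬝ᵥ u| ≤ 1 / 2}
          ≤ ENNReal.ofReal (1 / 2) + ENNReal.ofReal (1 / 2 / 1) := by gcongr
        _ = 1 := by
          rw [← ENNReal.ofReal_add (by norm_num) (by norm_num)]
          norm_num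
    refine h2.trans (measure_mono fun g hg w hw hGw => hg ?_)
    have h3 : g ⬝ᵥ u = w ⬝ᵥ ((Matrix.of G)ᵀ *ᵥ u) := by
      have h5 : Matrix.of G *ᵥ w = g := hGw
      rw [← h5, mulVec_dot]
    have h4 : (g ⬝ᵥ u) ^ 2 ≤ (1 / 2) ^ 2 := by
      rw [h3]
      refine (sq_dot_le _ _).trans ?_
      calc _ ≤ ρ ^ 2 * s ^ 2 := mul_le_mul hw hGu.le (dot_self_nonneg _) (sq_nonneg _)
        _ = (1 / 2) ^ 2 := by rw [hρ]; field_simp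
    exact abs_le_of_sq_le_sq h4 (by norm_num)
  · calc (μ.prod ν) E / ENNReal.ofReal (1 / 2)
        ≤ ENNReal.ofReal (2 * s * √(d + 1) / ε) / ENNReal.ofReal (1 / 2) := by gcongr
      _ = ENNReal.ofReal (4 * s * √(d + 1 : ℕ) / ε) := by
        rw [← ENNReal.ofReal_div_of_pos (by norm_num)]
        congr 1
        push_cast
        ring

end SmallestSingularValue

/-! ### Choice of parameters and comparison of logarithms -/

section Conclusion

open scoped ENNReal

/-- For `w = √x` one has `-log w ≤ 1 / w`, hence `x log (1 / x) ≤ 2 √x`. -/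
lemma mul_neg_log_le {x y : ℝ} (hx : 0 < x) (hy : 0 ≤ y) (hxy : x ≤ y ^ 2) :
    x * -Real.log x ≤ 2 * y := by
  set w := √x with hw
  have hw0 : 0 < w := Real.sqrt_pos.2 hx
  have hww : x = w * w := (Real.mul_self_sqrt hx.le).symm
  have h1 : Real.log x = 2 * Real.log w := by rw [hww, Real.log_mul hw0.ne' hw0.ne']; ring
  have h2 : -Real.log w ≤ w⁻¹ := by
    rw [← Real.log_inv]
    exact (Real.log_le_sub_one_of_pos (inv_pos.2 hw0)).trans (by linarith)
  have h3 : w ≤ y := by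
    have := Real.sqrt_le_sqrt hxy
    rwa [Real.sqrt_sq hy] at this
  calc x * -Real.log x = 2 * (w * w) * -Real.log w := by rw [h1]; nth_rewrite 1 [hww]; ring
    _ ≤ 2 * (w * w) * w⁻¹ := by gcongr
    _ = 2 * w := by field_simp
    _ ≤ 2 * y := by linarith

/-- The elementary inequalities between the logarithms that enter the time bound. Here
`x = ε √(d³ σ₁) M / σ_d` measures the size of the initialization. -/
lemma log_bounds {p lam r ε d D M s x : ℝ} (hp : 0 < p) (hp1 : p < 1) (hlam : 0 < lam)
    (hr : 0 < r) (hlr : lam ≤ r ^ 2) (hd : 1 ≤ d) (hD : 0 < D) (hDD : D * D = d) (hdM : d ≤ M)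
    (hε : 0 < ε) (hx : x = ε * r * (d * D) * M / lam)
    (hxL : x * (1 + Real.log (M * (r ^ 2 / lam))) ≤ p ^ 4 / 10 ^ 6)
    (hs : s = p * ε / (12 * D)) :
    x ≤ p ^ 4 / 10 ^ 6 ∧
      x * (Real.log (lam / s ^ 2) + 8 * Real.log (64 * d * (r ^ 2 / lam) ^ 2)) ≤ p / 10 ∧
      0 ≤ Real.log (d * lam / ε ^ 2) ∧
      0 ≤ Real.log (lam / s ^ 2) + 8 * Real.log (64 * d * (r ^ 2 / lam) ^ 2) ∧
      Real.log (lam / s ^ 2) + 8 * Real.log (64 * d * (r ^ 2 / lam) ^ 2)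
        ≤ 24 * Real.log (d * lam / ε ^ 2) := by
  have hd0 : 0 < d := by linarith
  have hM0 : 0 < M := by linarith
  have hx0 : 0 < x := by rw [hx]; positivity
  set a := Real.log (r ^ 2 / lam) with ha
  set b := Real.log d with hb
  set c := Real.log M with hc
  set P := -Real.log p with hP
  set y := -Real.log x with hy
  have ha0 : 0 ≤ a := Real.log_nonneg ((one_le_div hlam).2 hlr)
  have hb0 : 0 ≤ b := Real.log_nonneg hd
  have hbc : b ≤ c := Real.log_le_log hd0 hdM
  have hP0 : 0 ≤ P := by
    have := Real.log_nonpos hp.le hp1.le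
    linarith
  have hLeq : Real.log (M * (r ^ 2 / lam)) = c + a := Real.log_mul hM0.ne' (by positivity)
  rw [hLeq] at hxL
  have hxk : x ≤ p ^ 4 / 10 ^ 6 := by nlinarith
  have hlogD : 2 * Real.log D = b := by
    rw [hb, ← hDD, Real.log_mul hD.ne' hD.ne']; ring
  have ha' : a = 2 * Real.log r - Real.log lam := by
    rw [ha, Real.log_div (by positivity) hlam.ne', Real.log_pow]; norm_num
  have hy' : y = Real.log lam - (Real.log ε + Real.log r + (b + Real.log D) + c) := by
    rw [hy, hx, Real.log_div (by positivity) hlam.ne', Real.log_mul (by positivity) hM0.ne',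
      Real.log_mul (by positivity) (by positivity), Real.log_mul hε.ne' hr.ne',
      Real.log_mul hd0.ne' hD.ne']
    ring
  have hB : Real.log (d * lam / ε ^ 2) = a + 4 * b + 2 * c + 2 * y := by
    rw [Real.log_div (by positivity) (by positivity), Real.log_mul hd0.ne' hlam.ne',
      Real.log_pow, hy', ha']
    push_cast
    linarith
  have hsl : Real.log (lam / s ^ 2) = Real.log (d * lam / ε ^ 2) + Real.log 144 + 2 * P := by
    have h1 : lam / s ^ 2 = d * lam / ε ^ 2 * 144 / p ^ 2 := by
      rw [hs, ← hDD]; field_simp; norm_num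
    rw [h1, Real.log_div (by positivity) (by positivity), Real.log_mul (by positivity)
      (by norm_num), Real.log_pow]
    push_cast
    ring
  have hk : Real.log (64 * d * (r ^ 2 / lam) ^ 2) = Real.log 64 + b + 2 * a := by
    rw [Real.log_mul (by positivity) (by positivity), Real.log_mul (by norm_num) hd0.ne',
      Real.log_pow]
    push_cast
    ring
  -- Smallness of `x` in terms of `p` makes `log (1 / x)` dominate `log (1 / p)` and the numerical
  -- constants; this keeps the factor `24` in the time bound independent of `p`.
  have hyP : 4 * P + Real.log (10 ^ 6) ≤ y := by
    have h1 := Real.log_le_log hx0 hxk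
    rw [Real.log_div (by positivity) (by norm_num), Real.log_pow] at h1
    push_cast at h1
    linarith
  have h144 : Real.log 144 ≤ Real.log (10 ^ 6) := Real.log_le_log (by norm_num) (by norm_num)
  have h64 : Real.log 64 ≤ Real.log (10 ^ 6) := Real.log_le_log (by norm_num) (by norm_num)
  have h64' : 0 ≤ Real.log 64 := Real.log_nonneg (by norm_num)
  have h144' : 0 ≤ Real.log 144 := Real.log_nonneg (by norm_num)
  rw [hsl, hk, hB]
  refine ⟨hxk, ?_, by linarith, by linarith, by linarith⟩
  have hlog2 : Real.log 2 ≤ 1 := by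
    have := Real.log_two_lt_d9
    linarith
  have h64u : Real.log 64 ≤ 6 := by
    have : (64 : ℝ) = 2 ^ 6 := by norm_num
    rw [this, Real.log_pow]
    push_cast
    linarith
  have h144u : Real.log 144 ≤ 8 := by
    have h1 : Real.log 144 ≤ Real.log (2 ^ 8) := Real.log_le_log (by norm_num) (by norm_num)
    rw [Real.log_pow] at h1
    push_cast at h1
    linarith
  have hPp : P ≤ p⁻¹ := by
    rw [hP, ← Real.log_inv]
    exact (Real.log_le_sub_one_of_pos (inv_pos.2 hp)).trans (by linarith)
  -- The time horizon contains `log (1 / x)`, which the logarithmic factor in the hypothesis on `ε`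
  -- does not cover; the loss of a square root is afforded by the power `p ^ 4`.
  have hxy : x * y ≤ 2 * (p ^ 2 / 10 ^ 3) :=
    mul_neg_log_le hx0 (by positivity) (hxk.trans_eq (by ring))
  have hxP : x * P ≤ p ^ 3 / 10 ^ 6 := by
    calc x * P ≤ p ^ 4 / 10 ^ 6 * p⁻¹ := by gcongr
      _ = p ^ 3 / 10 ^ 6 := by field_simp
  have hsum : a + 4 * b + 2 * c + 2 * y + Real.log 144 + 2 * P + 8 * (Real.log 64 + b + 2 * a)
      ≤ 56 * (1 + (c + a)) + 2 * y + 2 * P := by linarith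
  have hp4 : p ^ 4 ≤ p := by
    have := pow_le_pow_of_le_one hp.le hp1.le (show 1 ≤ 4 by norm_num)
    simpa using this
  have hp3 : p ^ 3 ≤ p := by
    have := pow_le_pow_of_le_one hp.le hp1.le (show 1 ≤ 3 by norm_num)
    simpa using this
  have hp2 : p ^ 2 ≤ p := by
    have := pow_le_pow_of_le_one hp.le hp1.le (show 1 ≤ 2 by norm_num)
    simpa using this
  calc x * (a + 4 * b + 2 * c + 2 * y + Real.log 144 + 2 * P + 8 * (Real.log 64 + b + 2 * a))
      ≤ x * (56 * (1 + (c + a)) + 2 * y + 2 * P) := mul_le_mul_of_nonneg_left hsum hx0.le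
    _ = 56 * (x * (1 + (c + a))) + 2 * (x * y) + 2 * (x * P) := by ring
    _ ≤ 56 * (p ^ 4 / 10 ^ 6) + 2 * (2 * (p ^ 2 / 10 ^ 3)) + 2 * (p ^ 3 / 10 ^ 6) := by gcongr
    _ ≤ p / 10 := by linarith

/-- The size `N` and the conditioning `s` of the initialization satisfy the hypotheses of the
deterministic convergence theorem. -/
lemma parameter_bounds {p lam r ε d D M s N x Q : ℝ} (hp : 0 < p) (hp1 : p < 1) (hlam : 0 < lam)
    (hr : 0 < r) (hd : 1 ≤ d) (hD : 0 < D) (hDD : D * D = d) (hdM : d ≤ M) (hε : 0 < ε)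
    (hx : x = ε * r * (d * D) * M / lam) (hxk : x ≤ p ^ 4 / 10 ^ 6)
    (hs : s = p * ε / (12 * D)) (hN : N = ε * √(2 * M * d / p)) (hQ0 : 0 ≤ Q)
    (hxQ : x * Q ≤ p / 10) :
    200 * (r * N ^ 2) ≤ lam * s ∧ s ≤ N ∧ r * N * (Q / lam) ≤ 1 / 5 := by
  have hd0 : 0 < d := by linarith
  have hM0 : 0 < M := by linarith
  have hD1 : 1 ≤ D := by nlinarith
  have hNN : N ^ 2 = 2 / p * (M * d * ε ^ 2) := by
    rw [hN, mul_pow, Real.sq_sqrt (by positivity)]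
    ring
  have hxlam : x * lam = ε * r * (d * D) * M := by rw [hx]; field_simp
  have hp4 : p ^ 4 ≤ p ^ 2 := pow_le_pow_of_le_one hp.le hp1.le (by norm_num)
  refine ⟨?_, ?_, ?_⟩
  · have h1 : lam * s - 200 * (r * N ^ 2)
        = p * ε * lam / (12 * D) * (1 - 4800 / p ^ 2 * x) := by
      rw [hNN, hs, hx, ← hDD]
      field_simp
      ring
    have h2 : 4800 / p ^ 2 * x ≤ 1 := by
      rw [div_mul_eq_mul_div, div_le_one (by positivity)]
      have := sq_nonneg p
      linarith
    have h3 : 0 ≤ p * ε * lam / (12 * D) * (1 - 4800 / p ^ 2 * x) :=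
      mul_nonneg (by positivity) (by linarith)
    linarith
  · have h1 : s ≤ ε := by
      rw [hs, div_le_iff₀ (by positivity)]
      nlinarith
    have h2 : 1 ≤ √(2 * M * d / p) := by
      refine Real.one_le_sqrt.2 ((one_le_div hp).2 ?_)
      nlinarith
    rw [hN]
    exact h1.trans (le_mul_of_one_le_right hε.le h2)
  · have h1 : √(2 * M * d / p) ≤ 2 * M / p := by
      refine Real.sqrt_le_iff.2 ⟨by positivity, ?_⟩
      rw [div_pow, div_le_div_iff₀ hp (by positivity)]
      have h2 : d * p ≤ 2 * M := by nlinarith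
      have h3 : 2 * M * p * (d * p) ≤ 2 * M * p * (2 * M) := by gcongr
      linarith
    have h2 : r * N ≤ 2 / p * (x * lam) := by
      calc r * N ≤ r * (ε * (2 * M / p)) := by rw [hN]; gcongr
        _ = 2 / p * (ε * r * M) * 1 := by ring
        _ ≤ 2 / p * (ε * r * M) * (d * D) := by
          gcongr
          exact one_le_mul_of_one_le_of_one_le hd hD1
        _ = 2 / p * (x * lam) := by rw [hxlam]; ring
    calc r * N * (Q / lam) ≤ 2 / p * (x * lam) * (Q / lam) := by gcongr
      _ = 2 / p * (x * Q) := by field_simp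
      _ ≤ 2 / p * (p / 10) := by gcongr
      _ = 1 / 5 := by field_simp; norm_num

/-- Halving the exponents of `ε` and `lam` only changes the constant, except that `log lam` may be
negative. For `lam < 1` the condition `δ ≤ lam ^ 2` gives `log (lam / δ) ≥ -log lam`, which
compensates. -/
lemma log_add_posLog_le {d lam ε δ : ℝ} (hd : 1 ≤ d) (hlam : 0 < lam) (hε : 0 < ε) (hδ : 0 < δ)
    (hB : 0 ≤ Real.log (d * lam / ε ^ 2)) (h : 1 ≤ lam ∨ δ ≤ lam ^ 2) :
    24 * Real.log (d * lam / ε ^ 2) + 8 * Real.posLog (lam ^ 2 / δ)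
      ≤ 64 * (Real.log (d * lam / ε) + Real.posLog (lam / δ)) := by
  have hd0 : 0 < d := by linarith
  have hb0 : 0 ≤ Real.log d := Real.log_nonneg hd
  have e1 : Real.log (d * lam / ε ^ 2) = Real.log d + Real.log lam - 2 * Real.log ε := by
    rw [Real.log_div (by positivity) (by positivity), Real.log_mul hd0.ne' hlam.ne', Real.log_pow]
    push_cast; ring
  have e2 : Real.log (d * lam / ε) = Real.log d + Real.log lam - Real.log ε := by
    rw [Real.log_div (by positivity) (by positivity), Real.log_mul hd0.ne' hlam.ne']
  have e3 : Real.log (lam ^ 2 / δ) = 2 * Real.log lam - Real.log δ := by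
    rw [Real.log_div (by positivity) hδ.ne', Real.log_pow]
    push_cast; ring
  have e4 : Real.log (lam / δ) = Real.log lam - Real.log δ := Real.log_div hlam.ne' hδ.ne'
  have hP'0 : 0 ≤ Real.posLog (lam / δ) := Real.posLog_nonneg
  have hP' : Real.log (lam / δ) ≤ Real.posLog (lam / δ) := le_max_right _ _
  have hpos : Real.posLog (lam ^ 2 / δ) = max 0 (Real.log (lam ^ 2 / δ)) := rfl
  by_cases h1 : 1 ≤ lam
  · have hl0 : 0 ≤ Real.log lam := Real.log_nonneg h1
    have hP : Real.posLog (lam ^ 2 / δ) ≤ Real.posLog (lam / δ) + Real.log lam := by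
      rw [hpos]
      exact max_le (by linarith) (by linarith)
    linarith
  · have h2 : δ ≤ lam ^ 2 := h.resolve_left h1
    have hl0 : Real.log lam ≤ 0 := Real.log_nonpos hlam.le (not_le.1 h1).le
    have h3 : 0 ≤ Real.log (lam ^ 2 / δ) := Real.log_nonneg ((one_le_div hδ).2 h2)
    have hP : Real.posLog (lam ^ 2 / δ) = Real.log (lam ^ 2 / δ) := by
      rw [hpos, max_eq_right h3]
    linarith

/-- The initialization is small and well conditioned with high probability. -/
theorem initLaw_bad_le {m n d : ℕ} (hd : 0 < d) {Φ : Matrix (Fin m) (Fin d) ℝ}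
    {Ψ : Matrix (Fin n) (Fin d) ℝ} (hΦ : Φᵀ * Φ = 1) (hΨ : Ψᵀ * Ψ = 1) {ε p N s : ℝ} (hε : 0 < ε)
    (hp : 0 < p) (hN : 0 < N) (hNeq : (m + n) * d * ε ^ 2 ≤ p / 2 * N ^ 2)
    (hs : s = p * ε / (12 * √d)) :
    initLaw m n d ε {z | ¬ (ip (Matrix.of z.1) (Matrix.of z.1)
        + ip (Matrix.of z.2) (Matrix.of z.2) ≤ N ^ 2 ∧
      ∀ v, s ^ 2 * (v ⬝ᵥ v) ≤ (((1 / 2 : ℝ) • (Φᵀ * Matrix.of z.1 + Ψᵀ * Matrix.of z.2))ᵀ *ᵥ v)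
        ⬝ᵥ (((1 / 2 : ℝ) • (Φᵀ * Matrix.of z.1 + Ψᵀ * Matrix.of z.2))ᵀ *ᵥ v))}
      ≤ ENNReal.ofReal p := by
  have hD : 0 < √(d : ℝ) := Real.sqrt_pos.2 (by exact_mod_cast hd)
  have hs0 : 0 < s := by rw [hs]; positivity
  have h1 := initLaw_norm_le hN hNeq
  -- The sum of the compressed factors has entries of standard deviation `√2 ε`, and `A` is half of
  -- it, which turns the threshold `s` into `2 s`.
  have h2 := gaussianEntries_smallest_singular hd (ε := √2 * ε) (s := 2 * s) (by positivity)
    (by positivity)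
  rw [← map_add_initLaw hΦ hΨ ε] at h2
  -- This inequality holds for arbitrary sets, so the bad event need not be shown measurable.
  have h3 := (Measure.le_map_apply ((mulTransposeCLM Φ).coprod
    (mulTransposeCLM (d := d) Ψ)).continuous.measurable.aemeasurable _).trans h2
  have h4 : 4 * (2 * s) * √d / (√2 * ε) ≤ p / 2 := by
    have h5 : 4 * (2 * s) * √d / (√2 * ε) = 2 * p / (3 * √2) := by
      rw [hs]
      field_simp
      norm_num
    rw [h5, div_le_iff₀ (by positivity)]
    have h6 : (4 : ℝ) / 3 ≤ √2 := Real.le_sqrt_of_sq_le (by norm_num)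
    nlinarith
  have h7 := add_le_add h1 (h3.trans (ENNReal.ofReal_le_ofReal h4))
  rw [← ENNReal.ofReal_add (by positivity) (by positivity), add_halves] at h7
  refine le_trans (measure_mono ?_) ((measure_union_le _ _).trans h7)
  intro z hz
  rw [mem_ofPred_eq, not_and_or] at hz
  rcases hz with hz | hz
  · exact Or.inl (not_le.1 hz)
  · right
    push Not at hz
    obtain ⟨v, hv⟩ := hz
    refine ⟨v, ?_⟩
    have h8 : Matrix.of (((mulTransposeCLM Φ).coprod (mulTransposeCLM Ψ)) z)
        = Φᵀ * Matrix.of z.1 + Ψᵀ * Matrix.of z.2 := rfl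
    rw [h8]
    rw [transpose_smul, Matrix.smul_mulVec, smul_dotProduct, dotProduct_smul, smul_eq_mul,
      smul_eq_mul] at hv
    linarith

end Conclusion

end MatrixFactorization

end

/-! ### The main theorem -/

open MatrixFactorization in
theorem corollary1 :
    ∃ (C : ℝ) (q : ℕ), 0 < C ∧ ∀ p : ℝ, 0 < p → p < 1 → ∃ k : ℝ, 0 < k ∧
      ∀ (m n d : ℕ) (S : Matrix (Fin m) (Fin n) ℝ), 0 < d → S.rank = d →
      ∀ ε : ℝ, 0 < ε →
        ε ≤ k * (sigma S d / (Real.sqrt ((d : ℝ) ^ 3 * sigma S 1) * ((m : ℝ) + n))) /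
              (1 + Real.log (((m : ℝ) + n) * (sigma S 1 / sigma S d))) ^ q →
      ∀ δ : ℝ, 0 < δ →
      ∃ T : ℝ, 0 ≤ T ∧
        T ≤ C * (1 / sigma S d * Real.log (d * sigma S d / ε ^ 2)
              + 1 / sigma S d * Real.posLog (sigma S d ^ 2 / δ)) ∧
        (1 ≤ sigma S d ∨ δ ≤ sigma S d ^ 2 →
          T ≤ C * (1 / sigma S d * Real.log (d * sigma S d / ε)
                + 1 / sigma S d * Real.posLog (sigma S d / δ))) ∧
        initLaw m n d ε {z | ¬ ReachesBy S δ T (Matrix.of z.1) (Matrix.of z.2)}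
          ≤ ENNReal.ofReal p := by
  -- A single logarithm suffices, so `q = 1`. The constant `64` is dictated by `log_add_posLog_le`,
  -- and `k = p ^ 4 / 10 ^ 6` by `log_bounds`.
  refine ⟨64, 1, by norm_num, fun p hp hp1 => ⟨p ^ 4 / 10 ^ 6, by positivity, ?_⟩⟩
  intro m n d S hd hS ε hε hεk δ hδ
  obtain ⟨Φ, Ψ, σ, hΦ, hΨ, hSVD, hσ⟩ := exists_thin_svd hS
  have hlam := sigma_pos hd hS
  have hle := sigma_le_sigma_one S d
  set lam := sigma S d
  set Λ := sigma S 1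
  have hΛ : 0 < Λ := hlam.trans_le hle
  set r := √Λ
  have hr : 0 < r := Real.sqrt_pos.2 hΛ
  have hrr : r ^ 2 = Λ := Real.sq_sqrt hΛ.le
  rw [← hrr] at hεk hle
  have hd1 : (1 : ℝ) ≤ d := by exact_mod_cast hd
  set D := √(d : ℝ)
  have hD : 0 < D := Real.sqrt_pos.2 (by linarith)
  have hDD : D * D = d := Real.mul_self_sqrt (by linarith)
  have hdm : (d : ℝ) ≤ m := by
    have := Matrix.rank_le_height S
    rw [hS] at this
    exact_mod_cast this
  set M : ℝ := m + n
  have hdM : (d : ℝ) ≤ M := hdm.trans (le_add_of_nonneg_right n.cast_nonneg)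
  have hM0 : 0 < M := by linarith
  -- Both `s` and `N` are tuned so that the conditioning and the norm bound each fail with
  -- probability at most `p / 2`.
  set s := p * ε / (12 * D) with hs
  set N := ε * √(2 * M * d / p) with hN
  have hs0 : 0 < s := by positivity
  have hd0 : (0 : ℝ) < d := by linarith
  have hN0 : 0 < N := by positivity
  have hNN : N ^ 2 = 2 / p * (M * d * ε ^ 2) := by
    rw [hN, mul_pow, Real.sq_sqrt (by positivity)]
    ring
  obtain ⟨x, hx⟩ : ∃ x, x = ε * r * (d * D) * M / lam := ⟨_, rfl⟩
  have hL : 0 < 1 + Real.log (M * (r ^ 2 / lam)) := by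
    have : 0 ≤ Real.log (M * (r ^ 2 / lam)) :=
      Real.log_nonneg (one_le_mul_of_one_le_of_one_le (hd1.trans hdM) ((one_le_div hlam).2 hle))
    linarith
  have hsqrt : √((d : ℝ) ^ 3 * r ^ 2) = d * D * r := by
    rw [show (d : ℝ) ^ 3 * r ^ 2 = (d * D * r) ^ 2 by rw [← hDD]; ring]
    exact Real.sqrt_sq (by positivity)
  -- The hypothesis on `ε`, rewritten for `x = ε √(d³ σ_1) (m + n) / σ_d`.
  have hxL : x * (1 + Real.log (M * (r ^ 2 / lam))) ≤ p ^ 4 / 10 ^ 6 := by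
    rw [pow_one, hsqrt, le_div_iff₀ hL, ← mul_div_assoc (p ^ 4 / 10 ^ 6),
      le_div_iff₀ (by positivity)] at hεk
    rw [hx, div_mul_eq_mul_div, div_le_iff₀ hlam]
    linarith
  obtain ⟨hxk, hxQ, hB0, hQ0, hQB⟩ :=
    log_bounds hp hp1 hlam hr hle hd1 hD hDD hdM hε hx hxL hs
  set Q := Real.log (lam / s ^ 2) + 8 * Real.log (64 * d * (r ^ 2 / lam) ^ 2) with hQ
  obtain ⟨T, hT⟩ : ∃ T, T = Real.log (lam / s ^ 2) / lam
      + 8 / lam * Real.log (64 * d * (r ^ 2 / lam) ^ 2) := ⟨_, rfl⟩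
  have hTQ : T = Q / lam := by rw [hT, hQ]; ring
  have hpos : 0 ≤ Real.posLog (lam ^ 2 / δ) := Real.posLog_nonneg
  obtain ⟨hrs, hsN, hNT⟩ :=
    parameter_bounds hp hp1 hlam hr hd1 hD hDD hdM hε hx hxk hs hN hQ0 hxQ
  rw [← hTQ] at hNT
  have hTtot : T + 8 / lam * Real.posLog (lam ^ 2 / δ)
      = 1 / lam * (Q + 8 * Real.posLog (lam ^ 2 / δ)) := by
    rw [hTQ]; ring
  refine ⟨T + 8 / lam * Real.posLog (lam ^ 2 / δ), ?_, ?_, ?_, ?_⟩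
  · rw [hTtot]
    positivity
  · rw [hTtot, ← mul_add, mul_left_comm]
    exact mul_le_mul_of_nonneg_left (by linarith) (by positivity)
  · intro h
    rw [hTtot, ← mul_add, mul_left_comm]
    refine mul_le_mul_of_nonneg_left ?_ (by positivity)
    have := log_add_posLog_le hd1 hlam hε hδ hB0 h
    linarith
  · refine le_trans (MeasureTheory.measure_mono ?_) (initLaw_bad_le hd hΦ hΨ hε hp hN0 ?_ hs)
    · intro z hz hgood
      refine hz (reachesBy_of_small hΦ hΨ hSVD hd hlam ?_ hr hN0 hs0 hrs hsN hδ hT hNT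
        hgood.1 hgood.2)
      rw [hrr]
      exact hσ
    · rw [hNN]
      have h1 : M * d * ε ^ 2 = p / 2 * (2 / p * (M * d * ε ^ 2)) := by field_simp
      exact h1.le
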